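/- Let the language of second-order arithmetic have $0,1,+,\times$, exponentiation, $<$, $=$ on numbers, and $\in$, and let $\mathrm{ATR}_0$ be the theory in two-sorted classical logic consisting of Robinson arithmetic with exponentiation, the induction axiom for sets, arithmetical comprehension, and arithmetical transfinite recursion: for every arithmetical $\varphi(x,Y)$ (with parameters), $\forall\Lambda\,(\mathrm{wo}(\Lambda)\to\exists Y\,\forall\xi\in|\Lambda|\,\forall x\,(\langle\xi,x\rangle\in Y\leftrightarrow\varphi(x,Y_{<_\Lambda\xi})))$, where $Y_{<_\Lambda\xi}=\{\langle\zeta,y\rangle\in Y:\zeta<_\Lambda\xi\}$ and $\mathrm{wo}(\Lambda)$ says that $\Lambda$ codes a linear order in which every nonempty set $X\subseteq|\Lambda|$ has a least element. Call a theory $T$ representable if its axioms are formulas of second-order arithmetic, possibly with an additional unary predicate $\mathfrak O$ on numbers (the oracle), singled out by a $\Delta^0_0$ formula $\mathrm{Axiom}_T(x)$ without set parameters, with derivations being Hilbert-style derivations of two-sorted predicate logic with modus ponens and generalization; for a set $X$, let $T|X$ be $T$ together with $\mathfrak O(\overline n)$ for $n\in X$, $\neg\mathfrak O(\overline n)$ for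 $n\notin X$, and $\exists Z\,\forall x\,(x\in Z\leftrightarrow\mathfrak O(x))$, and let $\mathrm{Proof}_{T|X}(d,\varphi)$ say that $d$ codes a derivation of $\varphi$ in $T|X$. A set $P$ satisfies $\mathrm{IPC}^\Lambda_{T|X}(P)$ if for all $\lambda\in|\Lambda|$ and all $\varphi$, $\langle\lambda,\varphi\rangle\in P$ holds iff either $\exists d\,\mathrm{Proof}_{T|X}(d,\varphi)$, or there are $d$, a formula $\psi$, a variable $x$ and $\xi<_\Lambda\lambda$ such that $\langle\xi,\psi(\overline n)\rangle\in P$ for all $n$ and $\mathrm{Proof}_{T|X}(d,\forall x\,\psi(x)\to\varphi)$; write $[\lambda|X]^\Lambda_T\varphi$ for $\forall P\,(\mathrm{IPC}^\Lambda_{T|X}(P)\to\langle\lambda,\varphi\rangle\in P)$. A set $M$ codes the countable $\omega$-model with sets $M_n=\{i:\langle n,i\rangle\in M\}$; a full satisfaction definition for $M$ is a set of sentences, in the language extended by constants $c_n$ (denoting $n$) and $C_n$ (denoting $M_n$), satisfying Tarski's clauses for all sentences of this language with $\mathfrak O$ interpreted by $M_0$; $M$ is full if it has one; $M\models\varphi$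 means some full satisfaction definition for $M$ contains the universal closure of $\varphi$; and $M$ is a full $\omega$-model for $T$ if $M$ is full and $M\models\theta$ for every axiom $\theta$ of $T$. Then for every representable theory $T$, the following statement, formalized in second-order arithmetic, is provable in $\mathrm{ATR}_0$: for all sets $X,\Lambda,M$, if $\Lambda$ is a well-order and $M$ is a full $\omega$-model for $T$ with $M_0=X$, then for all $\lambda\in|\Lambda|$ and all $\varphi$, if $[\lambda|X]^\Lambda_T\varphi$, then $M\models\varphi$. -/

import Mathlib

/-! ## The language of second-order arithmetic and its proof calculus -/

namespace SOA

/-- Number terms over `0, 1, +, ×, exp`; number variables are de Bruijn indices. -/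
inductive Tm : Type
  | var : ℕ → Tm
  | zero : Tm
  | one : Tm
  | add : Tm → Tm → Tm
  | mul : Tm → Tm → Tm
  | exp : Tm → Tm → Tm

/-- Formulas of second-order arithmetic, built from `¬, ∧, ∀`. Number variables and set variables
are de Bruijn indices in two separate index spaces: `all` binds number index `0`, and `allS` binds
set index `0`. The only set terms are the set variables. -/
inductive Fml : Type
  | eq : Tm → Tm → Fml
  | lt : Tm → Tm → Fml
  | mem : Tm → ℕ → Fml
  | neg : Fml → Fml
  | and : Fml → Fml → Fml
  | all : Fml → Fml
  | allS : Fml → Fml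

/-- Simultaneous substitution of terms for the number variables of a term. -/
def Tm.subst (s : ℕ → Tm) : Tm → Tm
  | .var i => s i
  | .zero => .zero
  | .one => .one
  | .add a b => .add (a.subst s) (b.subst s)
  | .mul a b => .mul (a.subst s) (b.subst s)
  | .exp a b => .exp (a.subst s) (b.subst s)

/-- Raise all number variables by one. -/
def Tm.shift (t : Tm) : Tm := t.subst (fun i => .var (i + 1))

/-- The number substitution `s`, moved under a number quantifier. -/
def upTm (s : ℕ → Tm) : ℕ → Tm
  | 0 => .var 0
  | i + 1 => (s i).shift

/-- The set renaming `r`, moved under a set quantifier. -/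
def upSet (r : ℕ → ℕ) : ℕ → ℕ
  | 0 => 0
  | i + 1 => r i + 1

/-- Simultaneous capture-free substitution of terms for the free number variables and of set
variables for the free set variables. -/
def Fml.subst : (ℕ → Tm) → (ℕ → ℕ) → Fml → Fml
  | s, _, .eq a b => .eq (a.subst s) (b.subst s)
  | s, _, .lt a b => .lt (a.subst s) (b.subst s)
  | s, r, .mem a k => .mem (a.subst s) (r k)
  | s, r, .neg p => .neg (p.subst s r)
  | s, r, .and p q => .and (p.subst s r) (q.subst s r)
  | s, r, .all p => .all (p.subst (upTm s) r)
  | s, r, .allS p => .allS (p.subst s (upSet r))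

/-- Raise all free number variables by one. -/
def Fml.shift (p : Fml) : Fml := p.subst (fun i => .var (i + 1)) id

/-- Raise all free set variables by one. -/
def Fml.shiftS (p : Fml) : Fml := p.subst .var Nat.succ

/-- `p(t)`: number variable `0` is replaced by `t`, the other number variables drop by one. -/
def Fml.inst (p : Fml) (t : Tm) : Fml :=
  p.subst (fun i => match i with | 0 => t | j + 1 => .var j) id

/-- `p(k)`: set variable `0` is replaced by the set variable `k`, the others drop by one. -/
def Fml.instS (p : Fml) (k : ℕ) : Fml :=
  p.subst .var (fun i => match i with | 0 => k | j + 1 => j)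

/-- `p → q`. -/
def Fml.imp (p q : Fml) : Fml := .neg (.and p (.neg q))

/-- `p ∨ q`. -/
def Fml.or (p q : Fml) : Fml := .neg (.and (.neg p) (.neg q))

/-- `p ↔ q`. -/
def Fml.iff (p q : Fml) : Fml := .and (.imp p q) (.imp q p)

/-- The number quantifier `∃`. -/
def Fml.ex (p : Fml) : Fml := .neg (.all (.neg p))

/-- The set quantifier `∃`. -/
def Fml.exS (p : Fml) : Fml := .neg (.allS (.neg p))

/-- All number variables of the term are `< n`. -/
def Tm.ClosedAt (n : ℕ) : Tm → Prop
  | .var i => i < n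
  | .zero => True
  | .one => True
  | .add a b => a.ClosedAt n ∧ b.ClosedAt n
  | .mul a b => a.ClosedAt n ∧ b.ClosedAt n
  | .exp a b => a.ClosedAt n ∧ b.ClosedAt n

/-- All free number variables are `< n` and all free set variables are `< m`. -/
def Fml.ClosedAt : ℕ → ℕ → Fml → Prop
  | n, _, .eq a b => a.ClosedAt n ∧ b.ClosedAt n
  | n, _, .lt a b => a.ClosedAt n ∧ b.ClosedAt n
  | n, m, .mem a k => a.ClosedAt n ∧ k < m
  | n, m, .neg p => p.ClosedAt n m
  | n, m, .and p q => p.ClosedAt n m ∧ q.ClosedAt n m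
  | n, m, .all p => p.ClosedAt (n + 1) m
  | n, m, .allS p => p.ClosedAt n (m + 1)

/-- Formulas without free variables. -/
def Fml.IsSentence (p : Fml) : Prop := p.ClosedAt 0 0

/-- Arithmetic formulas: no set quantifiers, set parameters allowed. -/
def Fml.IsArith : Fml → Prop
  | .eq _ _ => True
  | .lt _ _ => True
  | .mem _ _ => True
  | .neg p => p.IsArith
  | .and p q => p.IsArith ∧ q.IsArith
  | .all p => p.IsArith
  | .allS _ => False

/-- `Δ⁰₀` formulas: no set quantifiers, and all number quantifiers are bounded,
`∀ x (x < t → p)` where the bound `t` does not contain `x`. -/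
inductive Fml.IsDelta0 : Fml → Prop
  | eq (a b : Tm) : IsDelta0 (.eq a b)
  | lt (a b : Tm) : IsDelta0 (.lt a b)
  | mem (a : Tm) (k : ℕ) : IsDelta0 (.mem a k)
  | neg {p : Fml} : IsDelta0 p → IsDelta0 (.neg p)
  | and {p q : Fml} : IsDelta0 p → IsDelta0 q → IsDelta0 (.and p q)
  | ball (t : Tm) {p : Fml} : IsDelta0 p → IsDelta0 (.all (.imp (.lt (.var 0) t.shift) p))

/-- Natural deduction for classical two-sorted first-order logic with equality on numbers. -/
inductive Provable : Set Fml → Fml → Prop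
  | hyp {G : Set Fml} {p : Fml} : p ∈ G → Provable G p
  | andI {G : Set Fml} {p q : Fml} : Provable G p → Provable G q → Provable G (.and p q)
  | andL {G : Set Fml} {p q : Fml} : Provable G (.and p q) → Provable G p
  | andR {G : Set Fml} {p q : Fml} : Provable G (.and p q) → Provable G q
  | negI {G : Set Fml} {p q : Fml} :
      Provable (insert p G) q → Provable (insert p G) (.neg q) → Provable G (.neg p)
  | raa {G : Set Fml} {p q : Fml} :
      Provable (insert (.neg p) G) q → Provable (insert (.neg p) G) (.neg q) → Provable G p
  | allI {G : Set Fml} {p : Fml} : Provable (Fml.shift '' G) p → Provable G (.all p)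
  | allE {G : Set Fml} {p : Fml} (t : Tm) : Provable G (.all p) → Provable G (p.inst t)
  | allSI {G : Set Fml} {p : Fml} : Provable (Fml.shiftS '' G) p → Provable G (.allS p)
  | allSE {G : Set Fml} {p : Fml} (k : ℕ) : Provable G (.allS p) → Provable G (p.instS k)
  | eqI {G : Set Fml} (t : Tm) : Provable G (.eq t t)
  | eqE {G : Set Fml} {p : Fml} {s t : Tm} :
      Provable G (.eq s t) → Provable G (p.inst s) → Provable G (p.inst t)

/-! ## The theory `ATR₀` -/

/-- The pairing term `⟨s, t⟩ = (s + t)² + s`. -/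
def Tm.pair (s t : Tm) : Tm := .add (.mul (.add s t) (.add s t)) s

/-- `x ∈ |L|`. A set `L` codes the ordering with field `{x | ⟨0, x⟩ ∈ L}` and with
`x < y` iff `⟨1, ⟨x, y⟩⟩ ∈ L`. -/
def fieldFml (L : ℕ) (x : Tm) : Fml := .mem (.pair .zero x) L

/-- `x <_L y`. -/
def precFml (L : ℕ) (x y : Tm) : Fml := .mem (.pair .one (.pair x y)) L

/-- `L` is a linear ordering. -/
def linearFml (L : ℕ) : Fml :=
  .and
    (.all (.all (.imp (precFml L (.var 1) (.var 0))
      (.and (fieldFml L (.var 1)) (fieldFml L (.var 0))))))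
  (.and
    (.all (.neg (precFml L (.var 0) (.var 0))))
  (.and
    (.all (.all (.all (.imp (.and (precFml L (.var 2) (.var 1)) (precFml L (.var 1) (.var 0)))
      (precFml L (.var 2) (.var 0))))))
    (.all (.all (.imp (.and (fieldFml L (.var 1)) (fieldFml L (.var 0)))
      (.or (precFml L (.var 1) (.var 0))
        (.or (.eq (.var 1) (.var 0)) (precFml L (.var 0) (.var 1)))))))))

/-- `L` is a well-order: it is linear, and every nonempty set `X ⊆ |L|` has a least element. -/
def woFml (L : ℕ) : Fml :=
  .and (linearFml L)
    (.allS (.imp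
      (.and (.all (.imp (.mem (.var 0) 0) (fieldFml (L + 1) (.var 0))))
        (.ex (.mem (.var 0) 0)))
      (.ex (.and (.mem (.var 0) 0)
        (.all (.imp (.mem (.var 0) 0)
          (.or (.eq (.var 1) (.var 0)) (precFml (L + 1) (.var 1) (.var 0)))))))))

/-- Replaces every `t ∈ Y`, for `Y` the free set variable `0`, by
`t ∈ Y ∧ ∃ a b, t = ⟨a, b⟩ ∧ a <_L ξ`, for `L` the free set variable `1` and `ξ` the free number
variable `1`. The arguments `k`, `l` count the number and set quantifiers passed so far. -/
def Fml.restrictBelow : ℕ → ℕ → Fml → Fml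
  | _, _, .eq a b => .eq a b
  | _, _, .lt a b => .lt a b
  | k, l, .mem t i =>
      if i = l then
        .and (.mem t l) (.ex (.ex (.and (.eq t.shift.shift (.pair (.var 1) (.var 0)))
          (precFml (l + 1) (.var 1) (.var (k + 3))))))
      else .mem t i
  | k, l, .neg p => .neg (p.restrictBelow k l)
  | k, l, .and p q => .and (p.restrictBelow k l) (q.restrictBelow k l)
  | k, l, .all p => .all (p.restrictBelow (k + 1) l)
  | k, l, .allS p => .allS (p.restrictBelow k (l + 1))

/-- For `p(x, Y)`, where `x` is number variable `0`, `Y` is set variable `0` and set variable `1`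
is `L` (all other variables are parameters), the formula
`∀ L (wo(L) → ∃ Y ∀ ξ ∈ |L| ∀ x (⟨ξ, x⟩ ∈ Y ↔ p(x, Y_{<ξ})))`. -/
def recursionFml (p : Fml) : Fml :=
  .allS (.imp (woFml 0) (.exS (.all (.imp (fieldFml 1 (.var 0)) (.all
    (.iff (.mem (.pair (.var 1) (.var 0)) 0)
      ((p.subst (fun i => match i with | 0 => .var 0 | j + 1 => .var (j + 2)) id).restrictBelow 0 0)))))))

/-- The axioms of `ATR₀` before universal closure: Robinson arithmetic with exponentiation, the
induction axiom for sets, arithmetical comprehension, and arithmetical transfinite recursion. -/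
inductive ATR0Basic : Fml → Prop
  | succ_ne : ATR0Basic (.neg (.eq (.add (.var 0) .one) .zero))
  | succ_inj : ATR0Basic
      (.imp (.eq (.add (.var 0) .one) (.add (.var 1) .one)) (.eq (.var 0) (.var 1)))
  | pred : ATR0Basic (.or (.eq (.var 0) .zero) (.ex (.eq (.var 1) (.add (.var 0) .one))))
  | add_zero : ATR0Basic (.eq (.add (.var 0) .zero) (.var 0))
  | add_succ : ATR0Basic
      (.eq (.add (.var 0) (.add (.var 1) .one)) (.add (.add (.var 0) (.var 1)) .one))
  | mul_zero : ATR0Basic (.eq (.mul (.var 0) .zero) .zero)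
  | mul_succ : ATR0Basic
      (.eq (.mul (.var 0) (.add (.var 1) .one)) (.add (.mul (.var 0) (.var 1)) (.var 0)))
  | exp_zero : ATR0Basic (.eq (.exp (.var 0) .zero) .one)
  | exp_succ : ATR0Basic
      (.eq (.exp (.var 0) (.add (.var 1) .one)) (.mul (.exp (.var 0) (.var 1)) (.var 0)))
  | lt_zero : ATR0Basic (.neg (.lt (.var 0) .zero))
  | lt_succ : ATR0Basic (.iff (.lt (.var 0) (.add (.var 1) .one))
      (.or (.lt (.var 0) (.var 1)) (.eq (.var 0) (.var 1))))
  | induction : ATR0Basic (.imp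
      (.and (.mem .zero 0) (.all (.imp (.mem (.var 0) 0) (.mem (.add (.var 0) .one) 0))))
      (.all (.mem (.var 0) 0)))
  | comprehension (p : Fml) : p.IsArith →
      ATR0Basic (.exS (.all (.iff (.mem (.var 0) 0) p.shiftS)))
  | recursion (p : Fml) : p.IsArith → ATR0Basic (recursionFml p)

/-- The theory `ATR₀`: the universal closures of its axioms. -/
def ATR0 : Set Fml :=
  {q | q.IsSentence ∧ ∃ (p : Fml) (n m : ℕ), ATR0Basic p ∧ q = Fml.all^[n] (Fml.allS^[m] p)}

/-! ## Structures for the language -/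

/-- A structure for the language of second-order arithmetic: a structure for the first-order part
together with a nonempty family of subsets of its universe, over which set variables range. -/
structure Struct where
  N : Type
  zero : N
  one : N
  add : N → N → N
  mul : N → N → N
  exp : N → N → N
  lt : N → N → Prop
  sets : Set (Set N)
  nonempty : sets.Nonempty

/-- The value of a term under an assignment. -/
def Tm.val (S : Struct) (e : ℕ → S.N) : Tm → S.N
  | .var i => e i
  | .zero => S.zero
  | .one => S.one
  | .add a b => S.add (a.val S e) (b.val S e)
  | .mul a b => S.mul (a.val S e) (b.val S e)
  | .exp a b => S.exp (a.val S e) (b.val S e)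

/-- Tarskian satisfaction under an assignment `e` to number and `E` to set variables. -/
def Fml.Holds (S : Struct) : (ℕ → S.N) → (ℕ → S.sets) → Fml → Prop
  | e, _, .eq a b => a.val S e = b.val S e
  | e, _, .lt a b => S.lt (a.val S e) (b.val S e)
  | e, E, .mem a k => a.val S e ∈ (E k : Set S.N)
  | e, E, .neg p => ¬ p.Holds S e E
  | e, E, .and p q => p.Holds S e E ∧ q.Holds S e E
  | e, E, .all p => ∀ a : S.N, p.Holds S (fun i => match i with | 0 => a | j + 1 => e j) E
  | e, E, .allS p => ∀ A : S.sets, p.Holds S e (fun i => match i with | 0 => A | j + 1 => E j)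

/-- A theory presented by its set of axioms, which is given by a `Δ⁰₀` formula `ax(x)` with at most
the number variable `0` free and without set variables. -/
structure RepTheory where
  ax : Fml
  delta0 : ax.IsDelta0
  closed : ax.ClosedAt 1 0

/-! ## Arithmetized notions, evaluated in a structure

In the definitions below every quantifier over numbers ranges over the universe `S.N` of an
arbitrary, possibly nonstandard, structure `S`, and every quantifier over sets ranges over
`S.sets`. Thus each of them is the interpretation in `S` of a formula of second-order arithmetic. -/

namespace Struct

variable (S : Struct)

/-- `⟨x, y⟩ = (x + y)² + x`. -/
def pair (x y : S.N) : S.N := S.add (S.mul (S.add x y) (S.add x y)) x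

/-- The value in `S` of the standard numeral `k`. -/
def std : ℕ → S.N
  | 0 => S.zero
  | k + 1 => S.add (std k) S.one

/-- Membership in the finite set with binary code `z`: the digit of `2 ^ x` in `z` is `1`, that is,
`z = (2 q + 1) 2 ^ x + r` with `r < 2 ^ x`. -/
def inFin (x z : S.N) : Prop :=
  ∃ q r : S.N, S.lt r (S.exp (S.std 2) x) ∧
    z = S.add (S.mul (S.add (S.mul (S.std 2) q) S.one) (S.exp (S.std 2) x)) r

/-- `x` has a finite construction in which every member `y` arises from other members by `step`:
there is a code `z < 2 ^ (x + 1)` of a finite set that contains `x` and all of whose members `y`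
satisfy `step (· ∈ z) y`. In all uses below, `step` requires only objects with smaller codes
than `y`, so that constructions are well-founded. -/
def Built (step : (S.N → Prop) → S.N → Prop) (x : S.N) : Prop :=
  ∃ z : S.N, S.lt z (S.exp (S.std 2) (S.add x S.one)) ∧ S.inFin x z ∧
    ∀ y : S.N, S.inFin y z → step (fun a => S.inFin a z) y

/-! ### Codes of terms and formulas

The coded language has variables `v_i` and `X_i`, the oracle predicate, and the additional constants
`c_n` and `C_n` naming numbers and the members of a coded model. -/

/-- The code with tag `k` and components `x`, `y`. -/
def tag (k : ℕ) (x y : S.N) : S.N := S.pair (S.std k) (S.pair x y)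

def cZero : S.N := S.tag 1 S.zero S.zero
def cOne : S.N := S.tag 2 S.zero S.zero
/-- The number variable `v_i`. -/
def cVar (i : S.N) : S.N := S.tag 3 i S.zero
/-- The constant `c_n`. -/
def cConst (n : S.N) : S.N := S.tag 4 n S.zero
def cAdd (s t : S.N) : S.N := S.tag 5 s t
def cMul (s t : S.N) : S.N := S.tag 6 s t
def cExp (s t : S.N) : S.N := S.tag 7 s t
/-- The set variable `X_i`. -/
def cSVar (i : S.N) : S.N := S.tag 8 i S.zero
/-- The set constant `C_n`. -/
def cSConst (n : S.N) : S.N := S.tag 9 n S.zero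
def cEq (s t : S.N) : S.N := S.tag 10 s t
def cLt (s t : S.N) : S.N := S.tag 11 s t
/-- `t ∈ X`. -/
def cMem (t X : S.N) : S.N := S.tag 12 t X
/-- The oracle predicate applied to `t`. -/
def cOracle (t : S.N) : S.N := S.tag 13 t S.zero
def cNeg (f : S.N) : S.N := S.tag 14 f S.zero
def cAnd (f g : S.N) : S.N := S.tag 15 f g
/-- `∀ v_i f`. -/
def cAll (i f : S.N) : S.N := S.tag 16 i f
/-- `∀ X_i f`. -/
def cAllS (i f : S.N) : S.N := S.tag 17 i f

def cImp (f g : S.N) : S.N := S.cNeg (S.cAnd f (S.cNeg g))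
def cIff (f g : S.N) : S.N := S.cAnd (S.cImp f g) (S.cImp g f)

/-- `x` codes a term; the constants `c_n` are allowed iff `K` holds. -/
def IsTm (K : Prop) (x : S.N) : Prop :=
  S.Built (fun R y =>
    y = S.cZero ∨ y = S.cOne ∨ (∃ i, y = S.cVar i) ∨ (K ∧ ∃ n, y = S.cConst n) ∨
    ∃ a b, R a ∧ R b ∧ (y = S.cAdd a b ∨ y = S.cMul a b ∨ y = S.cExp a b)) x

/-- `x` codes a set term; the constants `C_n` are allowed iff `K` holds. -/
def IsSTm (K : Prop) (x : S.N) : Prop :=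
  (∃ i, x = S.cSVar i) ∨ (K ∧ ∃ n, x = S.cSConst n)

/-- `x` codes a formula; the constants `c_n` and `C_n` are allowed iff `K` holds. -/
def IsFml (K : Prop) (x : S.N) : Prop :=
  S.Built (fun R y =>
    (∃ s t, S.IsTm K s ∧ S.IsTm K t ∧ (y = S.cEq s t ∨ y = S.cLt s t)) ∨
    (∃ t X, S.IsTm K t ∧ S.IsSTm K X ∧ y = S.cMem t X) ∨
    (∃ t, S.IsTm K t ∧ y = S.cOracle t) ∨
    (∃ a, R a ∧ y = S.cNeg a) ∨
    (∃ a b, R a ∧ R b ∧ y = S.cAnd a b) ∨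
    (∃ i a, R a ∧ (y = S.cAll i a ∨ y = S.cAllS i a))) x

/-- The term `s'` is the result of substituting `t` for `v_i` in the term `s`. -/
def TmSub (i t s s' : S.N) : Prop :=
  S.Built (fun R y => ∃ a a', y = S.pair a a' ∧
    ((a = S.cVar i ∧ a' = t) ∨
     (∃ j, j ≠ i ∧ a = S.cVar j ∧ a' = a) ∨
     ((a = S.cZero ∨ a = S.cOne ∨ ∃ n, a = S.cConst n) ∧ a' = a) ∨
     (∃ b b' c c', R (S.pair b b') ∧ R (S.pair c c') ∧
       ((a = S.cAdd b c ∧ a' = S.cAdd b' c') ∨ (a = S.cMul b c ∧ a' = S.cMul b' c') ∨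
        (a = S.cExp b c ∧ a' = S.cExp b' c'))))) (S.pair s s')

/-- The term `t` is free for `v_i` in the formula `f`, and `f'` is the result of substituting `t`
for the free occurrences of `v_i` in `f`. At a quantifier `∀ v_j`, `j ≠ i`, either nothing is
substituted in its scope, or `v_j` does not occur in `t` (replacing `v_j` by `0` leaves `t`
unchanged). -/
def Sub (i t f f' : S.N) : Prop :=
  S.Built (fun R y => ∃ a a', y = S.pair a a' ∧
    ((∃ s s' u u', S.TmSub i t s s' ∧ S.TmSub i t u u' ∧
       ((a = S.cEq s u ∧ a' = S.cEq s' u') ∨ (a = S.cLt s u ∧ a' = S.cLt s' u'))) ∨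
     (∃ s s' X, S.TmSub i t s s' ∧ a = S.cMem s X ∧ a' = S.cMem s' X) ∨
     (∃ s s', S.TmSub i t s s' ∧ a = S.cOracle s ∧ a' = S.cOracle s') ∨
     (∃ b b', R (S.pair b b') ∧ a = S.cNeg b ∧ a' = S.cNeg b') ∨
     (∃ b b' c c', R (S.pair b b') ∧ R (S.pair c c') ∧ a = S.cAnd b c ∧ a' = S.cAnd b' c') ∨
     (∃ b, a = S.cAll i b ∧ a' = a) ∨
     (∃ j b b', j ≠ i ∧ R (S.pair b b') ∧ a = S.cAll j b ∧ a' = S.cAll j b' ∧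
       (b' = b ∨ S.TmSub j S.cZero t t)) ∨
     (∃ j b b', R (S.pair b b') ∧ a = S.cAllS j b ∧ a' = S.cAllS j b'))) (S.pair f f')

/-- The set term `T` is free for `X_i` in the formula `f`, and `f'` is the result of substituting
`T` for the free occurrences of `X_i` in `f`. -/
def SubS (i T f f' : S.N) : Prop :=
  S.Built (fun R y => ∃ a a', y = S.pair a a' ∧
    ((∃ s u, (a = S.cEq s u ∨ a = S.cLt s u ∨ a = S.cOracle s) ∧ a' = a) ∨
     (∃ s, a = S.cMem s (S.cSVar i) ∧ a' = S.cMem s T) ∨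
     (∃ s X, X ≠ S.cSVar i ∧ a = S.cMem s X ∧ a' = a) ∨
     (∃ b b', R (S.pair b b') ∧ a = S.cNeg b ∧ a' = S.cNeg b') ∨
     (∃ b b' c c', R (S.pair b b') ∧ R (S.pair c c') ∧ a = S.cAnd b c ∧ a' = S.cAnd b' c') ∨
     (∃ j b b', R (S.pair b b') ∧ a = S.cAll j b ∧ a' = S.cAll j b') ∨
     (∃ b, a = S.cAllS i b ∧ a' = a) ∨
     (∃ j b b', j ≠ i ∧ R (S.pair b b') ∧ a = S.cAllS j b ∧ a' = S.cAllS j b' ∧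
       (b' = b ∨ T ≠ S.cSVar j)))) (S.pair f f')

/-- `v_i` is not free in `f`: replacing it by the closed term `0` leaves `f` unchanged. -/
def NotFree (i f : S.N) : Prop := S.Sub i S.cZero f f

/-- `X_i` is not free in `f`: replacing it by the constant `C_0` leaves `f` unchanged. -/
def NotFreeS (i f : S.N) : Prop := S.SubS i (S.cSConst S.zero) f f

/-- `x` codes a sentence of the language with the constants `c_n`, `C_n`. -/
def IsSent (x : S.N) : Prop :=
  S.IsFml True x ∧ ∀ i, S.NotFree i x ∧ S.NotFreeS i x

/-- `t` codes the numeral of `n`, where the numeral of `0` is `0` and that of `n + 1` is the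
numeral of `n` followed by `+ 1`. -/
def Numeral (n t : S.N) : Prop :=
  S.Built (fun R y => ∃ m s, y = S.pair m s ∧
    ((m = S.zero ∧ s = S.cZero) ∨
     ∃ m' s', R (S.pair m' s') ∧ m = S.add m' S.one ∧ s = S.cAdd s' S.cOne)) (S.pair n t)

/-! ### Provability in `T` with an oracle -/

/-- `f` has the shape of a logical axiom of two-sorted predicate calculus with equality. -/
def LogAx (f : S.N) : Prop :=
  (∃ a b, f = S.cImp a (S.cImp b a)) ∨
  (∃ a b c, f = S.cImp (S.cImp a (S.cImp b c)) (S.cImp (S.cImp a b) (S.cImp a c))) ∨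
  (∃ a b, f = S.cImp (S.cImp (S.cNeg a) (S.cNeg b)) (S.cImp b a)) ∨
  (∃ a b, f = S.cImp (S.cAnd a b) a) ∨
  (∃ a b, f = S.cImp (S.cAnd a b) b) ∨
  (∃ a b, f = S.cImp a (S.cImp b (S.cAnd a b))) ∨
  (∃ i t a a', S.IsTm False t ∧ S.Sub i t a a' ∧ f = S.cImp (S.cAll i a) a') ∨
  (∃ i a b, S.NotFree i a ∧ f = S.cImp (S.cAll i (S.cImp a b)) (S.cImp a (S.cAll i b))) ∨
  (∃ i j a a', S.SubS i (S.cSVar j) a a' ∧ f = S.cImp (S.cAllS i a) a') ∨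
  (∃ i a b, S.NotFreeS i a ∧ f = S.cImp (S.cAllS i (S.cImp a b)) (S.cImp a (S.cAllS i b))) ∨
  (∃ t, f = S.cEq t t) ∨
  (∃ s t i a a' a'', S.IsFml False a ∧ S.Sub i s a a' ∧ S.Sub i t a a'' ∧
    f = S.cImp (S.cEq s t) (S.cImp a' a''))

/-- `f` is an axiom of `T`. -/
def AxT (T : RepTheory) (f : S.N) : Prop :=
  S.IsFml False f ∧ ∀ E : ℕ → S.sets, T.ax.Holds S (fun _ => f) E

/-- `f` is an axiom of `T|X`: an axiom of `T`, or `O(n)` for some `n ∈ X`, or `¬ O(n)` for some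
`n ∉ X`, or `∃ X ∀ x (x ∈ X ↔ O(x))`. -/
def AxTX (T : RepTheory) (X : Set S.N) (f : S.N) : Prop :=
  S.AxT T f ∨
  (∃ n t, S.Numeral n t ∧ n ∈ X ∧ f = S.cOracle t) ∨
  (∃ n t, S.Numeral n t ∧ n ∉ X ∧ f = S.cNeg (S.cOracle t)) ∨
  f = S.cNeg (S.cAllS S.zero (S.cNeg (S.cAll S.zero
    (S.cIff (S.cMem (S.cVar S.zero) (S.cSVar S.zero)) (S.cOracle (S.cVar S.zero))))))

/-- `d` codes a derivation of `f` in `T|X`: a finite set of pairs `⟨i, g⟩` (`g` stands on line `i`),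
where each `g` is a formula that is an axiom or follows from earlier lines by modus ponens or
generalization, and where `f` is one of the lines. -/
def ProofTX (T : RepTheory) (X : Set S.N) (d f : S.N) : Prop :=
  (∀ i g, S.inFin (S.pair i g) d →
    S.IsFml False g ∧
    (S.LogAx g ∨ S.AxTX T X g ∨
     (∃ j k a, S.lt j i ∧ S.lt k i ∧ S.inFin (S.pair j a) d ∧ S.inFin (S.pair k (S.cImp a g)) d) ∨
     (∃ j a v, S.lt j i ∧ S.inFin (S.pair j a) d ∧ (g = S.cAll v a ∨ g = S.cAllS v a)))) ∧
  ∃ i, S.inFin (S.pair i f) d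

/-! ### Well-orders and iterated oracle provability -/

/-- `x ∈ |L|`. -/
def inField (L : Set S.N) (x : S.N) : Prop := S.pair S.zero x ∈ L

/-- `x <_L y`. -/
def prec (L : Set S.N) (x y : S.N) : Prop := S.pair S.one (S.pair x y) ∈ L

def IsLinear (L : Set S.N) : Prop :=
  (∀ x y, S.prec L x y → S.inField L x ∧ S.inField L y) ∧
  (∀ x, ¬ S.prec L x x) ∧
  (∀ x y z, S.prec L x y → S.prec L y z → S.prec L x z) ∧
  (∀ x y, S.inField L x → S.inField L y → S.prec L x y ∨ x = y ∨ S.prec L y x)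

/-- `wo(L)`. -/
def IsWO (L : Set S.N) : Prop :=
  S.IsLinear L ∧ ∀ X ∈ S.sets, (∀ x ∈ X, S.inField L x) → (∃ x, x ∈ X) →
    ∃ y ∈ X, ∀ z ∈ X, y = z ∨ S.prec L y z

/-- One application of the `ω`-rule, with side derivation `d`, to the formulas `g(n)`, where `g(n)`
is the result of substituting the numeral of `n` for `v_i` in `g`. -/
def OracleRule (T : RepTheory) (X L : Set S.N) (d x l i g f : S.N) (P : Set S.N) : Prop :=
  S.prec L x l ∧
  (∀ n, ∃ t g', S.Numeral n t ∧ S.Sub i t g g' ∧ S.pair x g' ∈ P) ∧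
  S.ProofTX T X d (S.cImp (S.cAll i g) f)

def OracleProof (T : RepTheory) (X L : Set S.N) (c l f : S.N) (P : Set S.N) : Prop :=
  ∃ d x g, c = S.pair d (S.pair x g) ∧
    (S.ProofTX T X d f ∨ ∃ i, S.OracleRule T X L d x l i g f P)

/-- `P` is an iterated oracle provability class. -/
def IPC (T : RepTheory) (X L P : Set S.N) : Prop :=
  ∀ l, S.inField L l → ∀ f, S.pair l f ∈ P ↔ ∃ c, S.OracleProof T X L c l f P

/-- `[l|X]_T^L f`: `⟨l, f⟩` belongs to all iterated oracle provability classes. -/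
def OmegaProvable (T : RepTheory) (X L : Set S.N) (l f : S.N) : Prop :=
  ∀ P ∈ S.sets, S.IPC T X L P → S.pair l f ∈ P

/-! ### Countable coded `ω`-models -/

/-- `t` is a closed term (possibly with constants `c_n`) and `a` is its value. -/
def Val (t a : S.N) : Prop :=
  ∃ z : S.N, S.inFin (S.pair t a) z ∧ ∀ s b, S.inFin (S.pair s b) z →
    (s = S.cZero ∧ b = S.zero) ∨ (s = S.cOne ∧ b = S.one) ∨ s = S.cConst b ∨
    ∃ s₁ b₁ s₂ b₂, S.inFin (S.pair s₁ b₁) z ∧ S.inFin (S.pair s₂ b₂) z ∧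
      ((s = S.cAdd s₁ s₂ ∧ b = S.add b₁ b₂) ∨ (s = S.cMul s₁ s₂ ∧ b = S.mul b₁ b₂) ∨
       (s = S.cExp s₁ s₂ ∧ b = S.exp b₁ b₂))

/-- `Y` is a full satisfaction definition for the countable coded `ω`-model `M`, whose sets are
`M_n = {i | ⟨n, i⟩ ∈ M}`. The constant `c_n` denotes `n`, the constant `C_n` denotes `M_n`, and the
oracle is interpreted by `M_0`. -/
def IsSat (M Y : Set S.N) : Prop :=
  (∀ f ∈ Y, S.IsSent f) ∧
  (∀ s t a b, S.Val s a → S.Val t b → ((S.cEq s t ∈ Y ↔ a = b) ∧ (S.cLt s t ∈ Y ↔ S.lt a b))) ∧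
  (∀ t a n, S.Val t a → (S.cMem t (S.cSConst n) ∈ Y ↔ S.pair n a ∈ M)) ∧
  (∀ t a, S.Val t a → (S.cOracle t ∈ Y ↔ S.pair S.zero a ∈ M)) ∧
  (∀ f, S.IsSent f → (S.cNeg f ∈ Y ↔ f ∉ Y)) ∧
  (∀ f g, S.IsSent f → S.IsSent g → (S.cAnd f g ∈ Y ↔ f ∈ Y ∧ g ∈ Y)) ∧
  (∀ i f, S.IsSent (S.cAll i f) →
    (S.cAll i f ∈ Y ↔ ∀ n f', S.Sub i (S.cConst n) f f' → f' ∈ Y)) ∧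
  (∀ i f, S.IsSent (S.cAllS i f) →
    (S.cAllS i f ∈ Y ↔ ∀ n f', S.SubS i (S.cSConst n) f f' → f' ∈ Y))

/-- `M` is a full `ω`-model. -/
def IsFull (M : Set S.N) : Prop := ∃ Y ∈ S.sets, S.IsSat M Y

/-- The sentence `g` is a universal closure of `f`: it arises from `f` by successively quantifying
universally over variables that are still free. -/
def UnivClosure (f g : S.N) : Prop :=
  S.IsSent g ∧
  S.Built (fun R y => y = f ∨ ∃ i a, R a ∧
    ((¬ S.NotFree i a ∧ y = S.cAll i a) ∨ (¬ S.NotFreeS i a ∧ y = S.cAllS i a))) g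

/-- `M ⊨ f`: some full satisfaction definition for `M` contains the universal closure of `f`
(which is `f` itself if `f` is a sentence). -/
def Sats (M : Set S.N) (f : S.N) : Prop :=
  ∃ Y ∈ S.sets, S.IsSat M Y ∧ ∃ g, S.UnivClosure f g ∧ g ∈ Y

/-- `M` is a full `ω`-model of `T`. -/
def IsFullModel (T : RepTheory) (M : Set S.N) : Prop :=
  S.IsFull M ∧ ∀ f, S.AxT T f → S.Sats M f

/-- The soundness of iterated oracle provability for full `ω`-models, as a statement about `S`. -/
def OmegaModelSoundness (T : RepTheory) : Prop :=
  ∀ X ∈ S.sets, ∀ L ∈ S.sets, ∀ M ∈ S.sets,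
    S.IsWO L → S.IsFullModel T M → (∀ i, S.pair S.zero i ∈ M ↔ i ∈ X) →
    ∀ l, S.inField L l → ∀ f, S.OmegaProvable T X L l f → S.Sats M f

end Struct

/-- The sentence `q` expresses the property `P` of structures: it is true in exactly the structures
that have the property. -/
def Expresses (q : Fml) (P : Struct → Prop) : Prop :=
  q.IsSentence ∧ ∀ S : Struct, (∀ e E, q.Holds S e E) ↔ P S

end SOA

/-!
The statement is proved semantically. By the completeness theorem for the natural deduction calculus
(`provable_of_valid`, a Henkin construction) it suffices to express the soundness statement by a sentence
and to show that it holds in every structure `S` that satisfies `ATR₀`, standard or not. That the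
arithmetized notions are expressible by formulas (`Ctx.def_soundness`), and that many of them are
arithmetic, is handled by the type class `Ctx.Def`. For a fixed `S` with parameters, the same class provides
the instances of comprehension, induction (`ind`, `strong_ind`) and transfinite recursion (`recursion`)
inside `S`. In this way `S` becomes an ordered semiring with pairing and binary codes of finite sets
(`exists_code`), and the predicates defined by finite constructions satisfy the expected fixed point
equations (`built_iff`).

Fix a well-order `L`, a full `ω`-model `M` of `T` in `S`, and a satisfaction definition `Y` for it. A formula
is called valid if all sentences that arise from it by substituting constants `c_n`, `C_n` for variables
belong to `Y`. Since it is required that `Y` obeys Tarski's clauses for all coded sentences, including those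
of nonstandard length, validity can be treated by induction on codes, with the following outcome.

* Logical axioms are valid, and modus ponens and generalization preserve validity
  (`IsSat.valid_logAx`, `IsSat.valid_mp`, `IsSat.valid_gen`). The main tools are the commutation of
  substitutions (`sb_comm`, `sb_comp`) and the replacement of closed terms of equal value
  (`IsSat.replace`).
* The `ω`-rule preserves validity (`IsSat.valid_omega`): the numeral of `n` and the constant `c_n` have the
  same value, and in `M` the number variables range over all numbers of `S`.
* A formula is valid if and only if it is satisfied by `M` (`IsSat.sats_iff`). This uses that satisfaction
  definitions for `M` agree on sentences (`IsSat.unique`). So the axioms of `T` are valid, and those on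
  the oracle are valid because `M_0 = X`.

Validity is arithmetic in `Y`, so transfinite induction along `L` shows that all members of an iterated
oracle provability class are valid (`IsSat.valid_of_ipc`). Arithmetic transfinite recursion is
needed to see that there is such a class (`exists_ipc`): a formula that is provable in the sense of the
definition belongs to all classes, and this would say nothing if there were none.
-/

-- instances of `Ctx.Def` follow the structure of long formulas
set_option synthInstance.maxHeartbeats 400000
set_option synthInstance.maxSize 2000

namespace SOA

/-! ### Substitution and satisfaction -/

/-- The sequence `a, e 0, e 1, …`. -/
def scons {α : Sort*} (a : α) (e : ℕ → α) : ℕ → α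
  | 0 => a
  | j + 1 => e j

@[simp] theorem scons_zero {α : Sort*} (a : α) (e : ℕ → α) : scons a e 0 = a := rfl
@[simp] theorem scons_succ {α : Sort*} (a : α) (e : ℕ → α) (j : ℕ) : scons a e (j + 1) = e j := rfl

theorem Tm.subst_subst (s s' : ℕ → Tm) (t : Tm) :
    (t.subst s).subst s' = t.subst (fun i => (s i).subst s') := by
  induction t <;> simp_all [Tm.subst]

theorem Tm.subst_var (t : Tm) : t.subst .var = t := by
  induction t <;> simp_all [Tm.subst]

theorem upTm_comp (s s' : ℕ → Tm) :
    (fun i => (upTm s i).subst (upTm s')) = upTm (fun i => (s i).subst s') := by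
  funext i
  cases i with
  | zero => rfl
  | succ i => simp [upTm, Tm.shift, Tm.subst_subst, Tm.subst]

theorem upSet_comp (r r' : ℕ → ℕ) : (fun i => upSet r' (upSet r i)) = upSet (fun i => r' (r i)) := by
  funext i; cases i <;> rfl

theorem upTm_var : upTm .var = .var := by
  funext i; cases i <;> rfl

theorem upSet_id : upSet id = id := by
  funext i; cases i <;> rfl

theorem Fml.subst_subst (p : Fml) : ∀ (s s' : ℕ → Tm) (r r' : ℕ → ℕ),
    (p.subst s r).subst s' r' = p.subst (fun i => (s i).subst s') (fun i => r' (r i)) := by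
  induction p <;> intro s s' r r' <;> simp_all [Fml.subst, Tm.subst_subst, upTm_comp, upSet_comp]

theorem Fml.subst_var (p : Fml) : p.subst .var id = p := by
  induction p <;> simp_all [Fml.subst, Tm.subst_var, upTm_var, upSet_id]

theorem Fml.inst_eq (p : Fml) (t : Tm) : p.inst t = p.subst (scons t .var) id := rfl
theorem Fml.instS_eq (p : Fml) (k : ℕ) : p.instS k = p.subst .var (scons k id) := rfl

theorem Fml.subst_up_inst (p : Fml) (s : ℕ → Tm) (r : ℕ → ℕ) (t : Tm) :
    (p.subst (upTm s) r).inst t = p.subst (scons t s) r := by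
  rw [Fml.inst_eq, Fml.subst_subst]
  congr 1
  funext i
  cases i with
  | zero => rfl
  | succ i =>
    simp only [upTm, Tm.shift, Tm.subst_subst, Tm.subst, scons_succ, Tm.subst_var]

theorem Fml.subst_up_instS (p : Fml) (s : ℕ → Tm) (r : ℕ → ℕ) (k : ℕ) :
    (p.subst s (upSet r)).instS k = p.subst s (scons k r) := by
  rw [Fml.instS_eq, Fml.subst_subst]
  congr 1
  · funext i; exact Tm.subst_var _
  · funext i
    cases i <;> rfl

theorem Fml.inst_subst (p : Fml) (s : ℕ → Tm) (r : ℕ → ℕ) (t : Tm) :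
    (p.inst t).subst s r = (p.subst (upTm s) r).inst (t.subst s) := by
  rw [Fml.subst_up_inst, Fml.inst_eq, Fml.subst_subst]
  congr 1
  funext i; cases i <;> rfl

theorem Fml.instS_subst (p : Fml) (s : ℕ → Tm) (r : ℕ → ℕ) (k : ℕ) :
    (p.instS k).subst s r = (p.subst s (upSet r)).instS (r k) := by
  rw [Fml.subst_up_instS, Fml.instS_eq, Fml.subst_subst]
  congr 1
  funext i; cases i <;> rfl

theorem Fml.shift_subst (p : Fml) (s : ℕ → Tm) (r : ℕ → ℕ) :
    p.shift.subst (upTm s) r = (p.subst s r).shift := by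
  simp only [Fml.shift, Fml.subst_subst]; rfl

theorem Fml.shiftS_subst (p : Fml) (s : ℕ → Tm) (r : ℕ → ℕ) :
    p.shiftS.subst s (upSet r) = (p.subst s r).shiftS := by
  simp only [Fml.shiftS, Fml.subst_subst, Tm.subst_var]; rfl

theorem Tm.ClosedAt.mono {t : Tm} {n n' : ℕ} (h : n ≤ n') (ht : t.ClosedAt n) : t.ClosedAt n' := by
  induction t <;> simp_all [Tm.ClosedAt]
  omega

theorem Fml.ClosedAt.mono {p : Fml} : ∀ {n n' m m' : ℕ}, n ≤ n' → m ≤ m' →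
    p.ClosedAt n m → p.ClosedAt n' m' := by
  induction p with
  | eq a b => exact fun h _ hp => ⟨hp.1.mono h, hp.2.mono h⟩
  | lt a b => exact fun h _ hp => ⟨hp.1.mono h, hp.2.mono h⟩
  | mem a k => exact fun h h' hp => ⟨hp.1.mono h, lt_of_lt_of_le hp.2 h'⟩
  | neg p ih => exact fun h h' hp => ih h h' hp
  | and p q ih ih' => exact fun h h' hp => ⟨ih h h' hp.1, ih' h h' hp.2⟩
  | all p ih => exact fun h h' hp => ih (Nat.succ_le_succ h) h' hp
  | allS p ih => exact fun h h' hp => ih h (Nat.succ_le_succ h') hp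

theorem Tm.exists_closedAt (t : Tm) : ∃ n, t.ClosedAt n := by
  induction t with
  | var i => exact ⟨i + 1, Nat.lt_succ_self i⟩
  | zero => exact ⟨0, trivial⟩
  | one => exact ⟨0, trivial⟩
  | add a b iha ihb | mul a b iha ihb | exp a b iha ihb =>
    obtain ⟨n, hn⟩ := iha
    obtain ⟨m, hm⟩ := ihb
    exact ⟨max n m, hn.mono (le_max_left _ _), hm.mono (le_max_right _ _)⟩

theorem Fml.exists_closedAt (p : Fml) : ∃ n, p.ClosedAt n n := by
  induction p with
  | eq a b | lt a b =>
    obtain ⟨n, hn⟩ := a.exists_closedAt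
    obtain ⟨m, hm⟩ := b.exists_closedAt
    exact ⟨max n m, hn.mono (le_max_left _ _), hm.mono (le_max_right _ _)⟩
  | mem a k =>
    obtain ⟨n, hn⟩ := a.exists_closedAt
    exact ⟨max n (k + 1), hn.mono (le_max_left _ _), lt_of_lt_of_le (Nat.lt_succ_self k) (le_max_right _ _)⟩
  | neg p ih => exact ih
  | and p q ih ih' =>
    obtain ⟨n, hn⟩ := ih
    obtain ⟨m, hm⟩ := ih'
    exact ⟨max n m, hn.mono (le_max_left _ _) (le_max_left _ _),
      hm.mono (le_max_right _ _) (le_max_right _ _)⟩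
  | all p ih =>
    obtain ⟨n, hn⟩ := ih
    exact ⟨n, Fml.ClosedAt.mono (p := p) (Nat.le_succ n) le_rfl hn⟩
  | allS p ih =>
    obtain ⟨n, hn⟩ := ih
    exact ⟨n, Fml.ClosedAt.mono (p := p) le_rfl (Nat.le_succ n) hn⟩

theorem Tm.subst_congr {t : Tm} {n : ℕ} {s s' : ℕ → Tm} (ht : t.ClosedAt n)
    (h : ∀ i < n, s i = s' i) : t.subst s = t.subst s' := by
  induction t <;> simp_all [Tm.ClosedAt, Tm.subst]

theorem Fml.subst_congr {p : Fml} : ∀ {n m : ℕ} {s s' : ℕ → Tm} {r r' : ℕ → ℕ},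
    p.ClosedAt n m → (∀ i < n, s i = s' i) → (∀ k < m, r k = r' k) →
    p.subst s r = p.subst s' r' := by
  induction p with
  | eq a b | lt a b =>
    intro n m s s' r r' hp h _
    simp only [Fml.subst, Tm.subst_congr hp.1 h, Tm.subst_congr hp.2 h]
  | mem a k =>
    intro n m s s' r r' hp h h'
    simp only [Fml.subst, Tm.subst_congr hp.1 h, h' k hp.2]
  | neg p ih => intro n m s s' r r' hp h h'; simp only [Fml.subst, ih hp h h']
  | and p q ih ih' =>
    intro n m s s' r r' hp h h'; simp only [Fml.subst, ih hp.1 h h', ih' hp.2 h h']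
  | all p ih =>
    intro n m s s' r r' hp h h'
    simp only [Fml.subst]
    rw [ih hp (fun i hi => ?_) h']
    cases i with
    | zero => rfl
    | succ i => simp only [upTm, h i (Nat.lt_of_succ_lt_succ hi)]
  | allS p ih =>
    intro n m s s' r r' hp h h'
    simp only [Fml.subst]
    rw [ih hp h (fun i hi => ?_)]
    cases i with
    | zero => rfl
    | succ i => simp only [upSet, h' i (Nat.lt_of_succ_lt_succ hi)]

theorem Tm.closedAt_subst {t : Tm} {n : ℕ} {s : ℕ → Tm} (h : ∀ i, (s i).ClosedAt n) :
    (t.subst s).ClosedAt n := by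
  induction t <;> simp_all [Tm.ClosedAt, Tm.subst]

theorem Fml.closedAt_subst {p : Fml} : ∀ {n m m' : ℕ} {s : ℕ → Tm} {r : ℕ → ℕ}, p.ClosedAt n m →
    ∀ {n'}, (∀ i, (s i).ClosedAt n') → (∀ k < m, r k < m') → (p.subst s r).ClosedAt n' m' := by
  induction p with
  | eq a b | lt a b =>
    intro n m m' s r _ n' h _; exact ⟨Tm.closedAt_subst h, Tm.closedAt_subst h⟩
  | mem a k => intro n m m' s r hp n' h h'; exact ⟨Tm.closedAt_subst h, h' k hp.2⟩
  | neg p ih => intro n m m' s r hp n' h h'; exact ih hp h h'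
  | and p q ih ih' => intro n m m' s r hp n' h h'; exact ⟨ih hp.1 h h', ih' hp.2 h h'⟩
  | all p ih =>
    intro n m m' s r hp n' h h'
    refine ih hp (fun i => ?_) h'
    cases i with
    | zero => exact Nat.succ_pos _
    | succ i =>
      have : ∀ t : Tm, t.ClosedAt n' → t.shift.ClosedAt (n' + 1) := by
        intro t ht
        induction t <;> simp_all [Tm.ClosedAt, Tm.shift, Tm.subst]
      exact this _ (h i)
  | allS p ih =>
    intro n m m' s r hp n' h h'
    refine ih hp h (fun i hi => ?_)
    cases i with
    | zero => exact Nat.succ_pos _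
    | succ i => exact Nat.succ_lt_succ (h' i (Nat.lt_of_succ_lt_succ hi))

theorem Tm.val_subst (S : Struct) (e : ℕ → S.N) (s : ℕ → Tm) (t : Tm) :
    (t.subst s).val S e = t.val S (fun i => (s i).val S e) := by
  induction t <;> simp_all [Tm.subst, Tm.val]

theorem Fml.holds_all {S : Struct} {e : ℕ → S.N} {E : ℕ → S.sets} {p : Fml} :
    (Fml.all p).Holds S e E ↔ ∀ a, p.Holds S (scons a e) E := Iff.rfl

theorem Fml.holds_allS {S : Struct} {e : ℕ → S.N} {E : ℕ → S.sets} {p : Fml} :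
    (Fml.allS p).Holds S e E ↔ ∀ A, p.Holds S e (scons A E) := Iff.rfl

theorem Fml.holds_subst (S : Struct) (p : Fml) : ∀ (e : ℕ → S.N) (E : ℕ → S.sets)
    (s : ℕ → Tm) (r : ℕ → ℕ),
    (p.subst s r).Holds S e E ↔ p.Holds S (fun i => (s i).val S e) (fun k => E (r k)) := by
  induction p with
  | eq a b | lt a b | mem a k => intro e E s r; simp [Fml.subst, Fml.Holds, Tm.val_subst]
  | neg p ih => intro e E s r; simp [Fml.subst, Fml.Holds, ih]
  | and p q ih ih' => intro e E s r; simp [Fml.subst, Fml.Holds, ih, ih']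
  | all p ih =>
    intro e E s r
    simp only [Fml.subst, Fml.holds_all, ih]
    refine forall_congr' fun a => iff_of_eq ?_
    congr 1
    funext i
    cases i with
    | zero => rfl
    | succ i => simp [upTm, Tm.shift, Tm.val_subst, Tm.val]
  | allS p ih =>
    intro e E s r
    simp only [Fml.subst, Fml.holds_allS, ih]
    refine forall_congr' fun a => iff_of_eq ?_
    congr 1
    funext i
    cases i <;> rfl

theorem Fml.holds_shiftS {S : Struct} {p : Fml} {e : ℕ → S.N} {E : ℕ → S.sets} :
    p.shiftS.Holds S e E ↔ p.Holds S e (fun i => E (i + 1)) := by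
  simp only [Fml.shiftS, Fml.holds_subst]; rfl

theorem Tm.val_congr {S : Struct} {t : Tm} {n : ℕ} {e e' : ℕ → S.N} (ht : t.ClosedAt n)
    (h : ∀ i < n, e i = e' i) : t.val S e = t.val S e' := by
  induction t <;> simp_all [Tm.ClosedAt, Tm.val]

theorem Fml.holds_congr {S : Struct} {p : Fml} : ∀ {n m : ℕ} {e e' : ℕ → S.N} {E E' : ℕ → S.sets},
    p.ClosedAt n m → (∀ i < n, e i = e' i) → (∀ k < m, E k = E' k) →
    (p.Holds S e E ↔ p.Holds S e' E') := by
  induction p with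
  | eq a b | lt a b =>
    intro n m e e' E E' hp h _
    simp only [Fml.Holds, Tm.val_congr hp.1 h, Tm.val_congr hp.2 h]
  | mem a k =>
    intro n m e e' E E' hp h h'
    simp only [Fml.Holds, Tm.val_congr hp.1 h, h' k hp.2]
  | neg p ih => intro n m e e' E E' hp h h'; simp only [Fml.Holds, ih hp h h']
  | and p q ih ih' =>
    intro n m e e' E E' hp h h'; simp only [Fml.Holds, ih hp.1 h h', ih' hp.2 h h']
  | all p ih =>
    intro n m e e' E E' hp h h'
    refine forall_congr' fun a => ih hp (fun i hi => ?_) h'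
    cases i with
    | zero => rfl
    | succ i => exact h i (Nat.lt_of_succ_lt_succ hi)
  | allS p ih =>
    intro n m e e' E E' hp h h'
    refine forall_congr' fun a => ih hp h (fun i hi => ?_)
    cases i with
    | zero => rfl
    | succ i => exact h' i (Nat.lt_of_succ_lt_succ hi)

theorem Fml.IsArith.subst {p : Fml} : ∀ {s : ℕ → Tm} {r : ℕ → ℕ}, p.IsArith → (p.subst s r).IsArith := by
  induction p with
  | eq | lt | mem => exact fun _ => trivial
  | neg p ih => exact fun h => ih h
  | and p q ih ih' => exact fun h => ⟨ih h.1, ih' h.2⟩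
  | all p ih => exact fun h => ih h
  | allS p ih => exact fun h => h.elim

theorem Fml.IsDelta0.isArith {p : Fml} (h : p.IsDelta0) : p.IsArith := by
  induction h with
  | eq | lt | mem => trivial
  | neg _ ih => exact ih
  | and _ _ ih ih' => exact ⟨ih, ih'⟩
  | ball t _ ih => exact ⟨trivial, ih⟩

/-- If all universal closures of `p` hold, then `p` holds under every assignment: the outermost
quantifiers may be instantiated with an initial segment of the assignment. -/
theorem Fml.holds_of_closure {S : Struct} {p : Fml} : ∀ (n m : ℕ) {e : ℕ → S.N} {E : ℕ → S.sets},
    (Fml.all^[n] (Fml.allS^[m] p)).Holds S (fun i => e (i + n)) (fun i => E (i + m)) →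
    p.Holds S e E := by
  intro n
  induction n with
  | succ n ih =>
    intro m e E h
    rw [Function.iterate_succ_apply'] at h
    refine ih m (e := e) ?_
    have h1 := Fml.holds_all.1 h (e n)
    convert h1 using 1
    funext i
    cases i with
    | zero => simp
    | succ i => simp only [scons_succ]; congr 1; omega
  | zero =>
    intro m
    induction m with
    | zero => exact fun h => h
    | succ m ih =>
      intro e E h
      rw [Function.iterate_succ_apply'] at h
      refine ih (E := E) ?_
      have h1 := Fml.holds_allS.1 h (E m)
      simp only [Function.iterate_zero, id] at h1 ⊢
      convert h1 using 1
      funext i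
      cases i with
      | zero => simp
      | succ i => simp only [scons_succ]; congr 1; omega

theorem Fml.holds_allS_iterate {S : Struct} {p : Fml} (h : ∀ e (E : ℕ → S.sets), p.Holds S e E) (m : ℕ) :
    ∀ e (E : ℕ → S.sets), (Fml.allS^[m] p).Holds S e E := by
  induction m with
  | zero => exact h
  | succ m ih =>
    intro e E
    rw [Function.iterate_succ_apply']
    exact fun A => ih _ _

theorem Fml.closedAt_closure {p : Fml} (n m : ℕ) : ∀ {n' m'}, p.ClosedAt (n' + n) (m' + m) →
    (Fml.all^[n] (Fml.allS^[m] p)).ClosedAt n' m' := by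
  induction n with
  | succ n ih =>
    intro n' m' h
    rw [Function.iterate_succ_apply']
    exact ih (n' := n' + 1) (by rwa [Nat.add_right_comm, Nat.add_assoc])
  | zero =>
    induction m with
    | zero => exact fun h => h
    | succ m ih =>
      intro n' m' h
      have := ih (n' := n') (m' := m' + 1) (by rwa [Nat.add_right_comm, Nat.add_assoc])
      simp only [Function.iterate_zero, id] at this ⊢
      rw [Function.iterate_succ_apply']
      exact this

end SOA

namespace SOA

/-! ### Completeness of the proof calculus -/

namespace Provable

theorem mono {G G' : Set Fml} {p : Fml} (h : Provable G p) (hG : G ⊆ G') : Provable G' p := by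
  induction h generalizing G' with
  | hyp h => exact hyp (hG h)
  | andI _ _ ih ih' => exact andI (ih hG) (ih' hG)
  | andL _ ih => exact andL (ih hG)
  | andR _ ih => exact andR (ih hG)
  | negI _ _ ih ih' => exact negI (ih (Set.insert_subset_insert hG)) (ih' (Set.insert_subset_insert hG))
  | raa _ _ ih ih' => exact raa (ih (Set.insert_subset_insert hG)) (ih' (Set.insert_subset_insert hG))
  | allI _ ih => exact allI (ih (Set.image_mono hG))
  | allE t _ ih => exact allE t (ih hG)
  | allSI _ ih => exact allSI (ih (Set.image_mono hG))
  | allSE k _ ih => exact allSE k (ih hG)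
  | eqI t => exact eqI t
  | eqE _ _ ih ih' => exact eqE (ih hG) (ih' hG)

theorem subst {G : Set Fml} {p : Fml} (h : Provable G p) (s : ℕ → Tm) (r : ℕ → ℕ) :
    Provable ((Fml.subst s r) '' G) (p.subst s r) := by
  induction h generalizing s r with
  | hyp h => exact hyp ⟨_, h, rfl⟩
  | andI _ _ ih ih' => exact andI (ih s r) (ih' s r)
  | andL _ ih => exact andL (ih s r)
  | andR _ ih => exact andR (ih s r)
  | negI _ _ ih ih' =>
    have h1 := ih s r
    have h2 := ih' s r
    rw [Set.image_insert_eq] at h1 h2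
    exact negI h1 h2
  | raa _ _ ih ih' =>
    have h1 := ih s r
    have h2 := ih' s r
    rw [Set.image_insert_eq] at h1 h2
    exact raa h1 h2
  | allI _ ih =>
    refine allI ((ih (upTm s) r).mono ?_)
    rintro _ ⟨_, ⟨q, hq, rfl⟩, rfl⟩
    exact ⟨_, ⟨q, hq, rfl⟩, (Fml.shift_subst _ _ _).symm⟩
  | allE t _ ih => rw [Fml.inst_subst]; exact allE _ (ih s r)
  | allSI _ ih =>
    refine allSI ((ih s (upSet r)).mono ?_)
    rintro _ ⟨_, ⟨q, hq, rfl⟩, rfl⟩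
    exact ⟨_, ⟨q, hq, rfl⟩, (Fml.shiftS_subst _ _ _).symm⟩
  | allSE k _ ih => rw [Fml.instS_subst]; exact allSE _ (ih s r)
  | eqI t => exact eqI _
  | eqE _ _ ih ih' =>
    have h1 := ih s r
    have h2 := ih' s r
    rw [Fml.inst_subst] at h2 ⊢
    exact eqE h1 h2

theorem exists_finite {G : Set Fml} {p : Fml} (h : Provable G p) :
    ∃ F : Set Fml, F.Finite ∧ F ⊆ G ∧ Provable F p := by
  have key : ∀ {G : Set Fml} {q p : Fml}, (∃ F : Set Fml, F.Finite ∧ F ⊆ insert q G ∧ Provable F p) →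
      ∃ F : Set Fml, F.Finite ∧ F ⊆ G ∧ Provable (insert q F) p := by
    rintro G q p ⟨F, hF, hFG, h⟩
    refine ⟨F \ {q}, hF.sdiff, fun x hx => (hFG hx.1).resolve_left hx.2, h.mono ?_⟩
    rw [Set.insert_sdiff_singleton]
    exact Set.subset_insert _ _
  induction h with
  | hyp h => exact ⟨{_}, Set.finite_singleton _, Set.singleton_subset_iff.2 h, hyp rfl⟩
  | andI _ _ ih ih' =>
    obtain ⟨F, hF, hFG, h⟩ := ih
    obtain ⟨F', hF', hFG', h'⟩ := ih'
    exact ⟨F ∪ F', hF.union hF', Set.union_subset hFG hFG',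
      andI (h.mono Set.subset_union_left) (h'.mono Set.subset_union_right)⟩
  | andL _ ih => obtain ⟨F, hF, hFG, h⟩ := ih; exact ⟨F, hF, hFG, andL h⟩
  | andR _ ih => obtain ⟨F, hF, hFG, h⟩ := ih; exact ⟨F, hF, hFG, andR h⟩
  | negI _ _ ih ih' =>
    obtain ⟨F, hF, hFG, h⟩ := key ih
    obtain ⟨F', hF', hFG', h'⟩ := key ih'
    exact ⟨F ∪ F', hF.union hF', Set.union_subset hFG hFG',
      negI (h.mono (Set.insert_subset_insert Set.subset_union_left))
        (h'.mono (Set.insert_subset_insert Set.subset_union_right))⟩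
  | raa _ _ ih ih' =>
    obtain ⟨F, hF, hFG, h⟩ := key ih
    obtain ⟨F', hF', hFG', h'⟩ := key ih'
    exact ⟨F ∪ F', hF.union hF', Set.union_subset hFG hFG',
      raa (h.mono (Set.insert_subset_insert Set.subset_union_left))
        (h'.mono (Set.insert_subset_insert Set.subset_union_right))⟩
  | allI _ ih =>
    obtain ⟨F, hF, hFG, h⟩ := ih
    obtain ⟨F', hF', hfin, h'⟩ := (Set.exists_subset_image_finite_and
      (p := fun F => Provable F _)).1 ⟨F, hFG, hF, h⟩
    exact ⟨F', hfin, hF', allI h'⟩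
  | allE t _ ih => obtain ⟨F, hF, hFG, h⟩ := ih; exact ⟨F, hF, hFG, allE t h⟩
  | allSI _ ih =>
    obtain ⟨F, hF, hFG, h⟩ := ih
    obtain ⟨F', hF', hfin, h'⟩ := (Set.exists_subset_image_finite_and
      (p := fun F => Provable F _)).1 ⟨F, hFG, hF, h⟩
    exact ⟨F', hfin, hF', allSI h'⟩
  | allSE k _ ih => obtain ⟨F, hF, hFG, h⟩ := ih; exact ⟨F, hF, hFG, allSE k h⟩
  | eqI t => exact ⟨∅, Set.finite_empty, Set.empty_subset _, eqI t⟩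
  | eqE _ _ ih ih' =>
    obtain ⟨F, hF, hFG, h⟩ := ih
    obtain ⟨F', hF', hFG', h'⟩ := ih'
    exact ⟨F ∪ F', hF.union hF', Set.union_subset hFG hFG',
      eqE (h.mono Set.subset_union_left) (h'.mono Set.subset_union_right)⟩

end Provable

/-- A Gödel numbering of terms, used only for countability. -/
def Tm.enc : Tm → ℕ
  | .var i => Nat.pair 0 i
  | .zero => Nat.pair 1 0
  | .one => Nat.pair 2 0
  | .add a b => Nat.pair 3 (Nat.pair a.enc b.enc)
  | .mul a b => Nat.pair 4 (Nat.pair a.enc b.enc)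
  | .exp a b => Nat.pair 5 (Nat.pair a.enc b.enc)

theorem Tm.enc_injective : Function.Injective Tm.enc := by
  intro a
  induction a <;> intro b h <;> cases b <;> simp_all [Tm.enc, Nat.pair_eq_pair]
  all_goals grind

/-- A Gödel numbering of formulas, used only for countability. -/
def Fml.enc : Fml → ℕ
  | .eq a b => Nat.pair 0 (Nat.pair a.enc b.enc)
  | .lt a b => Nat.pair 1 (Nat.pair a.enc b.enc)
  | .mem a k => Nat.pair 2 (Nat.pair a.enc k)
  | .neg p => Nat.pair 3 p.enc
  | .and p q => Nat.pair 4 (Nat.pair p.enc q.enc)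
  | .all p => Nat.pair 5 p.enc
  | .allS p => Nat.pair 6 p.enc

theorem Fml.enc_injective : Function.Injective Fml.enc := by
  intro a
  induction a <;> intro b h <;> cases b <;>
    simp_all [Fml.enc, Nat.pair_eq_pair, Tm.enc_injective.eq_iff]
  all_goals grind

instance : Countable Fml := Fml.enc_injective.countable

/-- `G` proves a contradiction. -/
def Inconsistent (G : Set Fml) : Prop := ∃ q, Provable G q ∧ Provable G (.neg q)

theorem Inconsistent.neg {G : Set Fml} {p : Fml} (h : Inconsistent (insert p G)) :
    Provable G (.neg p) := by
  obtain ⟨q, h1, h2⟩ := h; exact .negI h1 h2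

theorem Inconsistent.pos {G : Set Fml} {p : Fml} (h : Inconsistent (insert (.neg p) G)) :
    Provable G p := by
  obtain ⟨q, h1, h2⟩ := h; exact .raa h1 h2

/-- Generalization over a variable that is fresh for the hypotheses. -/
theorem Provable.all_of_fresh {G : Set Fml} {p : Fml} {n m : ℕ}
    (hG : ∀ q ∈ G, q.ClosedAt n m) (hp : p.ClosedAt (n + 1) m)
    (h : Provable G (p.inst (.var n))) : Provable G (.all p) := by
  -- the renaming that turns the fresh variable `n` into the variable bound by the new quantifier
  let s : ℕ → Tm := fun i => if i = n then .var 0 else .var (i + 1)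
  refine .allI ?_
  have h1 := h.subst s id
  have h2 : (p.inst (.var n)).subst s id = p := by
    rw [Fml.inst_eq, Fml.subst_subst]
    conv_rhs => rw [← p.subst_var]
    refine Fml.subst_congr hp (fun i hi => ?_) (fun _ _ => rfl)
    cases i with
    | zero => simp [Tm.subst, s]
    | succ i =>
      have : i ≠ n := by omega
      simp [Tm.subst, s, this]
  rw [h2] at h1
  refine h1.mono ?_
  rintro _ ⟨q, hq, rfl⟩
  refine ⟨q, hq, Fml.subst_congr (hG q hq) (fun i hi => ?_) (fun _ _ => rfl)⟩
  simp [s, hi.ne]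

/-- Generalization over a set variable that is fresh for the hypotheses. -/
theorem Provable.allS_of_fresh {G : Set Fml} {p : Fml} {n m : ℕ}
    (hG : ∀ q ∈ G, q.ClosedAt n m) (hp : p.ClosedAt n (m + 1))
    (h : Provable G (p.instS m)) : Provable G (.allS p) := by
  let r : ℕ → ℕ := fun i => if i = m then 0 else i + 1
  refine .allSI ?_
  have h1 := h.subst .var r
  have h2 : (p.instS m).subst .var r = p := by
    rw [Fml.instS_eq, Fml.subst_subst]
    conv_rhs => rw [← p.subst_var]
    refine Fml.subst_congr hp (fun i hi => rfl) (fun i hi => ?_)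
    cases i with
    | zero => simp [r]
    | succ i =>
      have : i ≠ m := by omega
      simp [r, this]
  rw [h2] at h1
  refine h1.mono ?_
  rintro _ ⟨q, hq, rfl⟩
  refine ⟨q, hq, Fml.subst_congr (hG q hq) (fun _ _ => rfl) (fun i hi => ?_)⟩
  simp [r, hi.ne]

theorem exists_closedAt_of_finite {A D : Set Fml} (hA : ∀ q ∈ A, q.IsSentence) (hD : D.Finite) :
    ∃ n, ∀ q ∈ A ∪ D, q.ClosedAt n n := by
  induction D, hD using Set.Finite.induction_on with
  | empty => exact ⟨0, fun q hq => hA q (by simpa using hq)⟩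
  | @insert a D _ _ ih =>
    obtain ⟨n, hn⟩ := ih
    obtain ⟨m, hm⟩ := a.exists_closedAt
    refine ⟨max n m, fun q hq => ?_⟩
    rw [Set.union_insert] at hq
    rcases hq with rfl | hq
    · exact hm.mono (le_max_right _ _) (le_max_right _ _)
    · exact (hn q hq).mono (le_max_left _ _) (le_max_left _ _)

/-- One step of the Henkin construction: `p` is decided, and if `p` is a refuted universal formula
then a variable witnesses the refutation. -/
theorem exists_henkin_step {A D : Set Fml} (hA : ∀ q ∈ A, q.IsSentence) (hD : D.Finite)
    (hc : ¬ Inconsistent (A ∪ D)) (p : Fml) :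
    ∃ D', D'.Finite ∧ D ⊆ D' ∧ ¬ Inconsistent (A ∪ D') ∧ (p ∈ D' ∨ .neg p ∈ D') ∧
      (∀ q, p = .all q → p ∈ D' ∨ ∃ k, .neg (q.inst (.var k)) ∈ D') ∧
      (∀ q, p = .allS q → p ∈ D' ∨ ∃ k, .neg (q.instS k) ∈ D') := by
  by_cases hp : Inconsistent (A ∪ insert p D)
  swap
  · exact ⟨insert p D, hD.insert p, Set.subset_insert _ _, hp, .inl (Set.mem_insert _ _),
      fun _ _ => .inl (Set.mem_insert _ _), fun _ _ => .inl (Set.mem_insert _ _)⟩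
  have hn : ¬ Inconsistent (A ∪ insert (.neg p) D) := by
    intro hn
    rw [Set.union_insert] at hp hn
    exact hc ⟨p, hn.pos, hp.neg⟩
  obtain ⟨n, hn'⟩ := exists_closedAt_of_finite hA (hD.insert (.neg p))
  have hpn : p.ClosedAt n n := hn' (.neg p) (.inr (Set.mem_insert _ _))
  have hself : Provable (A ∪ insert (.neg p) D) (.neg p) := .hyp (.inr (Set.mem_insert _ _))
  by_cases hall : ∃ q, p = .all q
  · obtain ⟨q, rfl⟩ := hall
    refine ⟨insert (.neg (q.inst (.var n))) (insert (.neg (.all q)) D), (hD.insert _).insert _,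
      (Set.subset_insert _ _).trans (Set.subset_insert _ _), fun h => ?_,
      .inr (Set.mem_insert_of_mem _ (Set.mem_insert _ _)), ?_, ?_⟩
    · rw [Set.union_insert] at h
      exact hn ⟨_, .all_of_fresh hn' (n := n) (m := n) hpn h.pos, hself⟩
    · rintro _ ⟨⟩; exact .inr ⟨n, Set.mem_insert _ _⟩
    · rintro _ ⟨⟩
  by_cases hallS : ∃ q, p = .allS q
  · obtain ⟨q, rfl⟩ := hallS
    refine ⟨insert (.neg (q.instS n)) (insert (.neg (.allS q)) D), (hD.insert _).insert _,
      (Set.subset_insert _ _).trans (Set.subset_insert _ _), fun h => ?_,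
      .inr (Set.mem_insert_of_mem _ (Set.mem_insert _ _)), ?_, ?_⟩
    · rw [Set.union_insert] at h
      exact hn ⟨_, .allS_of_fresh hn' (n := n) (m := n) hpn h.pos, hself⟩
    · rintro _ ⟨⟩
    · rintro _ ⟨⟩; exact .inr ⟨n, Set.mem_insert _ _⟩
  · exact ⟨insert (.neg p) D, hD.insert _, Set.subset_insert _ _, hn, .inr (Set.mem_insert _ _),
      fun q h => (hall ⟨q, h⟩).elim, fun q h => (hallS ⟨q, h⟩).elim⟩

/-- A complete consistent set of formulas whose refuted universal formulas are refuted by a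
variable. -/
structure IsHenkin (H : Set Fml) : Prop where
  mem_of_provable : ∀ {p}, Provable H p → p ∈ H
  neg_mem : ∀ {p}, Fml.neg p ∈ H ↔ p ∉ H
  all : ∀ {q}, (∀ k, q.inst (.var k) ∈ H) → Fml.all q ∈ H
  allS : ∀ {q}, (∀ k, q.instS k ∈ H) → Fml.allS q ∈ H

theorem exists_isHenkin {A : Set Fml} (hA : ∀ q ∈ A, q.IsSentence) (hc : ¬ Inconsistent A) :
    ∃ H, A ⊆ H ∧ IsHenkin H := by
  have : Nonempty Fml := ⟨.eq .zero .zero⟩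
  obtain ⟨f, hf⟩ := exists_surjective_nat Fml
  choose! g hg using fun (D : Set Fml) (h : D.Finite ∧ ¬ Inconsistent (A ∪ D)) (p : Fml) =>
    exists_henkin_step hA h.1 h.2 p
  let D : ℕ → Set Fml := Nat.rec ∅ fun n D => g D (f n)
  have hD : ∀ n, (D n).Finite ∧ ¬ Inconsistent (A ∪ D n) := by
    intro n
    induction n with
    | zero => exact ⟨Set.finite_empty, by simpa [D] using hc⟩
    | succ n ih => exact ⟨(hg _ ih (f n)).1, (hg _ ih (f n)).2.2.1⟩
  have hmono : Monotone D := monotone_nat_of_le_succ fun n => (hg _ (hD n) (f n)).2.1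
  let H : Set Fml := A ∪ ⋃ n, D n
  have hcons : ¬ Inconsistent H := by
    have key : ∀ q, Provable H q → ∃ n, Provable (A ∪ D n) q := by
      intro q hq
      obtain ⟨F, hF, hFH, h⟩ := hq.exists_finite
      have hdir : ∃ n, F ⊆ A ∪ D n := by
        have : F ⊆ ⋃ n, (A ∪ D n) := hFH.trans (Set.union_iUnion A D).subset
        have hm : Monotone fun n => A ∪ D n := fun a b h => Set.union_subset_union_right _ (hmono h)
        lift F to Finset Fml using hF
        exact hm.directed_le.exists_mem_subset_of_finset_subset_biUnion this
      obtain ⟨n, hn⟩ := hdir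
      exact ⟨n, h.mono hn⟩
    rintro ⟨q, h1, h2⟩
    obtain ⟨n, hn⟩ := key _ h1
    obtain ⟨m, hm⟩ := key _ h2
    refine (hD (max n m)).2 ⟨q, hn.mono ?_, hm.mono ?_⟩
    · exact Set.union_subset_union_right _ (hmono (le_max_left _ _))
    · exact Set.union_subset_union_right _ (hmono (le_max_right _ _))
  have hsub : ∀ n, D n ⊆ H := fun n => (Set.subset_iUnion D n).trans Set.subset_union_right
  have hno : ∀ {p}, p ∈ H → .neg p ∈ H → False := fun h h' => hcons ⟨_, .hyp h, .hyp h'⟩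
  have hdec : ∀ p, p ∈ H ∨ .neg p ∈ H := by
    intro p
    obtain ⟨n, rfl⟩ := hf p
    exact (hg _ (hD n) (f n)).2.2.2.1.imp (fun h => hsub (n + 1) h) (fun h => hsub (n + 1) h)
  refine ⟨H, Set.subset_union_left, ?_, ?_, ?_, ?_⟩
  · exact fun {p} h => (hdec p).resolve_right fun h' => hcons ⟨p, h, .hyp h'⟩
  · exact fun {p} => ⟨fun h h' => hno h' h, fun h => (hdec p).resolve_left h⟩
  · intro q h
    obtain ⟨n, hn⟩ := hf (.all q)
    rcases (hg _ (hD n) (f n)).2.2.2.2.1 q hn with h' | ⟨k, hk⟩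
    · rw [← hn]; exact hsub (n + 1) h'
    · exact (hno (h k) (hsub (n + 1) hk)).elim
  · intro q h
    obtain ⟨n, hn⟩ := hf (.allS q)
    rcases (hg _ (hD n) (f n)).2.2.2.2.2 q hn with h' | ⟨k, hk⟩
    · rw [← hn]; exact hsub (n + 1) h'
    · exact (hno (h k) (hsub (n + 1) hk)).elim

namespace IsHenkin

variable {H : Set Fml}

theorem and_mem (hH : IsHenkin H) {p q : Fml} : Fml.and p q ∈ H ↔ p ∈ H ∧ q ∈ H :=
  ⟨fun h => ⟨hH.mem_of_provable (.andL (.hyp h)), hH.mem_of_provable (.andR (.hyp h))⟩,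
    fun h => hH.mem_of_provable (.andI (.hyp h.1) (.hyp h.2))⟩

theorem rewrite (hH : IsHenkin H) {s t : Tm} (h : Fml.eq s t ∈ H) (p : Fml)
    (hp : p.inst s ∈ H) : p.inst t ∈ H :=
  hH.mem_of_provable (.eqE (.hyp h) (.hyp hp))

theorem shift_subst_scons (t s : Tm) : t.shift.subst (scons s .var) = t := by
  rw [Tm.shift, Tm.subst_subst]; exact t.subst_var

theorem eq_refl (hH : IsHenkin H) (t : Tm) : Fml.eq t t ∈ H := hH.mem_of_provable (.eqI t)

theorem eq_symm (hH : IsHenkin H) {s t : Tm} (h : Fml.eq s t ∈ H) : Fml.eq t s ∈ H := by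
  have := hH.rewrite h (.eq (.var 0) s.shift)
  simp only [Fml.inst_eq, Fml.subst, shift_subst_scons, Tm.subst, scons_zero] at this
  exact this (hH.eq_refl s)

theorem eq_trans (hH : IsHenkin H) {s t u : Tm} (h : Fml.eq s t ∈ H) (h' : Fml.eq t u ∈ H) :
    Fml.eq s u ∈ H := by
  have := hH.rewrite h' (.eq s.shift (.var 0))
  simp only [Fml.inst_eq, Fml.subst, shift_subst_scons, Tm.subst, scons_zero] at this
  exact this h

theorem eq_congr (hH : IsHenkin H) {f : Tm → Tm → Tm}
    (hf : ∀ a b s, (f a b).subst s = f (a.subst s) (b.subst s)) {a b a' b' : Tm}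
    (h : Fml.eq a a' ∈ H) (h' : Fml.eq b b' ∈ H) : Fml.eq (f a b) (f a' b') ∈ H := by
  have h1 := hH.rewrite h (.eq (f a.shift b.shift) (f (.var 0) b.shift))
  have h2 := hH.rewrite h' (.eq (f a'.shift b.shift) (f a'.shift (.var 0)))
  simp only [Fml.inst_eq, Fml.subst, hf, shift_subst_scons, Tm.subst, scons_zero] at h1 h2
  exact hH.eq_trans (h1 (hH.eq_refl _)) (h2 (hH.eq_refl _))

/-- Provable equality of terms. -/
def setoid (hH : IsHenkin H) : Setoid Tm where
  r s t := Fml.eq s t ∈ H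
  iseqv := ⟨hH.eq_refl, hH.eq_symm, hH.eq_trans⟩

/-- The term model of a Henkin set: numbers are terms up to provable equality, and sets are the
extensions of the set variables. -/
def model (hH : IsHenkin H) : Struct where
  N := Quotient hH.setoid
  zero := Quotient.mk _ .zero
  one := Quotient.mk _ .one
  add := Quotient.map₂ .add fun _ _ h _ _ h' => hH.eq_congr (fun _ _ _ => rfl) h h'
  mul := Quotient.map₂ .mul fun _ _ h _ _ h' => hH.eq_congr (fun _ _ _ => rfl) h h'
  exp := Quotient.map₂ .exp fun _ _ h _ _ h' => hH.eq_congr (fun _ _ _ => rfl) h h'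
  lt x y := ∃ s t, Quotient.mk _ s = x ∧ Quotient.mk _ t = y ∧ Fml.lt s t ∈ H
  sets := Set.range fun k => {x | ∃ t, Quotient.mk _ t = x ∧ Fml.mem t k ∈ H}
  nonempty := Set.range_nonempty _

/-- The element of the term model denoted by a term. -/
def cls (hH : IsHenkin H) (t : Tm) : hH.model.N := Quotient.mk hH.setoid t

theorem val_model (hH : IsHenkin H) (s : ℕ → Tm) (t : Tm) :
    t.val hH.model (fun i => hH.cls (s i)) = hH.cls (t.subst s) := by
  induction t with
  | var i => rfl
  | zero => rfl
  | one => rfl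
  | add a b iha ihb | mul a b iha ihb | exp a b iha ihb =>
    simp only [Tm.val, iha, ihb, Tm.subst]; rfl

/-- The set of the term model that is named by the set variable `k`. -/
def modelSet (hH : IsHenkin H) (k : ℕ) : hH.model.sets := ⟨_, k, rfl⟩

theorem holds_model (hH : IsHenkin H) (p : Fml) : ∀ (s : ℕ → Tm) (r : ℕ → ℕ),
    p.Holds hH.model (fun i => hH.cls (s i)) (fun k => hH.modelSet (r k)) ↔
      p.subst s r ∈ H := by
  induction p with
  | eq a b =>
    intro s r
    simp only [Fml.Holds, val_model, Fml.subst]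
    exact Quotient.eq
  | lt a b =>
    intro s r
    simp only [Fml.Holds, val_model, Fml.subst]
    constructor
    · rintro ⟨u, v, hu, hv, h⟩
      have hu' : Fml.eq u (a.subst s) ∈ H := Quotient.eq.1 hu
      have hv' : Fml.eq v (b.subst s) ∈ H := Quotient.eq.1 hv
      have h1 := hH.rewrite hu' (.lt (.var 0) v.shift)
      have h2 := hH.rewrite hv' (.lt (a.subst s).shift (.var 0))
      simp only [Fml.inst_eq, Fml.subst, shift_subst_scons, Tm.subst, scons_zero] at h1 h2
      exact h2 (h1 h)
    · exact fun h => ⟨_, _, rfl, rfl, h⟩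
  | mem a k =>
    intro s r
    simp only [Fml.Holds, val_model, Fml.subst]
    constructor
    · rintro ⟨u, hu, h⟩
      have h1 := hH.rewrite (Quotient.eq.1 hu : Fml.eq u (a.subst s) ∈ H) (.mem (.var 0) (r k))
      simp only [Fml.inst_eq, Fml.subst, Tm.subst, scons_zero] at h1
      exact h1 h
    · exact fun h => ⟨_, rfl, h⟩
  | neg p ih =>
    intro s r
    simp only [Fml.Holds, ih, Fml.subst, hH.neg_mem]
  | and p q ih ih' =>
    intro s r
    simp only [Fml.Holds, ih, ih', Fml.subst, hH.and_mem]
  | all p ih =>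
    intro s r
    have key : ∀ t : Tm, p.Holds hH.model
        (scons (hH.cls t) fun i => hH.cls (s i))
        (fun k => hH.modelSet (r k)) ↔ (p.subst (upTm s) r).inst t ∈ H := by
      intro t
      rw [Fml.subst_up_inst, ← ih]
      apply iff_of_eq
      congr 1
      funext i; cases i <;> rfl
    rw [Fml.holds_all]
    constructor
    · exact fun h => hH.all fun k => (key _).1 (h _)
    · intro h a
      induction a using Quotient.inductionOn with
      | _ t => exact (key t).2 (hH.mem_of_provable (.allE t (.hyp h)))
  | allS p ih =>
    intro s r
    have key : ∀ k : ℕ, p.Holds hH.model (fun i => hH.cls (s i))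
        (scons (hH.modelSet k) fun k => hH.modelSet (r k)) ↔
          (p.subst s (upSet r)).instS k ∈ H := by
      intro k
      rw [Fml.subst_up_instS, ← ih]
      apply iff_of_eq
      congr 1
      funext i; cases i <;> rfl
    rw [Fml.holds_allS]
    constructor
    · exact fun h => hH.allS fun k => (key _).1 (h _)
    · rintro h ⟨_, k, rfl⟩
      exact (key k).2 (hH.mem_of_provable (.allSE k (.hyp h)))

end IsHenkin

/-- Completeness: a sentence that is true in all models of a set of sentences is provable from it. -/
theorem provable_of_valid {A : Set Fml} (hA : ∀ q ∈ A, q.IsSentence) {q : Fml} (hq : q.IsSentence)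
    (h : ∀ S : Struct, (∀ p ∈ A, ∀ e E, p.Holds S e E) → ∀ e E, q.Holds S e E) : Provable A q := by
  by_contra hn
  obtain ⟨H, hAH, hH⟩ := exists_isHenkin (A := insert (.neg q) A)
    (fun p hp => hp.elim (fun h => h ▸ hq) (hA p)) fun hi => hn hi.pos
  have key : ∀ {p : Fml}, p.IsSentence → ∀ e E, p.Holds hH.model e E ↔ p ∈ H := by
    intro p hp e E
    rw [← p.subst_var, ← hH.holds_model, p.subst_var]
    exact Fml.holds_congr hp (fun _ h => absurd h (Nat.not_lt_zero _))
      (fun _ h => absurd h (Nat.not_lt_zero _))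
  have h1 := h hH.model (fun p hp e E => (key (hA p hp) e E).2 (hAH (.inr hp)))
    (fun _ => hH.cls .zero) (fun _ => hH.modelSet 0)
  exact hH.neg_mem.1 (hAH (.inl rfl)) ((key hq _ _).1 h1)

end SOA

namespace SOA

/-! ### Definability -/

/-- A context for definability: a family of structures, together with the numbers and the sets
that may be used as parameters. With one structure and all its elements as parameters, definability
in a context is definability with parameters in that structure; with all structures and essentially
no parameters, it is uniform definability by a formula. If `arith` holds, only arithmetic formulas
are allowed. -/
structure Ctx where
  I : Type 1
  st : I → Struct
  parN : Set (∀ i, (st i).N)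
  parS : Set (∀ i, (st i).sets)
  arith : Prop

namespace Ctx

variable {K : Ctx}

/-- A term with values in the structures of `K`, depending on the values `e` of the number variables
and the values `E` of the set variables. -/
abbrev TmFun (K : Ctx) : Type 1 :=
  ∀ i : K.I, (ℕ → (K.st i).N) → (ℕ → (K.st i).sets) → (K.st i).N

/-- A set in each structure of `K`, depending on the values of the variables. -/
abbrev SetFun (K : Ctx) : Type 1 :=
  ∀ i : K.I, (ℕ → (K.st i).N) → (ℕ → (K.st i).sets) → Set (K.st i).N

/-- A predicate on the values of the variables in the structures of `K`. -/
abbrev Pred (K : Ctx) : Type 1 :=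
  ∀ i : K.I, (ℕ → (K.st i).N) → (ℕ → (K.st i).sets) → Prop

/-- The assignment of numbers that reads variables and parameters as prescribed by `s`. -/
def numEnv (K : Ctx) (s : ℕ → ℕ ⊕ K.parN) (i : K.I) (e : ℕ → (K.st i).N) : ℕ → (K.st i).N :=
  fun n => Sum.elim e (fun c => c.1 i) (s n)

/-- The assignment of sets that reads variables and parameters as prescribed by `s`. -/
def setEnv (K : Ctx) (s : ℕ → ℕ ⊕ K.parS) (i : K.I) (E : ℕ → (K.st i).sets) :
    ℕ → (K.st i).sets :=
  fun n => Sum.elim E (fun c => c.1 i) (s n)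

/-- The function is given by a term with parameters. -/
class DefT (K : Ctx) (t : K.TmFun) : Prop where
  out : ∃ (a : Tm) (s : ℕ → ℕ ⊕ K.parN), ∀ i e E, a.val (K.st i) (K.numEnv s i e) = t i e E

/-- The set is a set variable or a parameter. -/
class DefS (K : Ctx) (X : K.SetFun) : Prop where
  out : ∃ k : ℕ ⊕ K.parS, ∀ i e E, X i e E = (Sum.elim E (fun c => c.1 i) k : (K.st i).sets)

/-- The predicate is given by a formula with parameters. -/
class Def (K : Ctx) (P : K.Pred) : Prop where
  out : ∃ (p : Fml) (s : ℕ → ℕ ⊕ K.parN) (s' : ℕ → ℕ ⊕ K.parS), (K.arith → p.IsArith) ∧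
    ∀ i e E, p.Holds (K.st i) (K.numEnv s i e) (K.setEnv s' i E) ↔ P i e E

/-- Interleaves two sequences. -/
def merge {α : Type*} (s s' : ℕ → α) (n : ℕ) : α := if n % 2 = 0 then s (n / 2) else s' (n / 2)

theorem merge_even {α : Type*} (s s' : ℕ → α) (n : ℕ) : merge s s' (2 * n) = s n := by
  simp [merge]

theorem merge_odd {α : Type*} (s s' : ℕ → α) (n : ℕ) : merge s s' (2 * n + 1) = s' n := by
  have : (2 * n + 1) / 2 = n := by omega
  simp [merge, this]

/-- Two term functions are given by terms over the same choice of parameters. -/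
theorem DefT.common {t u : K.TmFun} (ht : K.DefT t) (hu : K.DefT u) :
    ∃ (a b : Tm) (s : ℕ → ℕ ⊕ K.parN), ∀ i e E, a.val (K.st i) (K.numEnv s i e) = t i e E ∧
      b.val (K.st i) (K.numEnv s i e) = u i e E := by
  obtain ⟨a, s, h⟩ := ht
  obtain ⟨b, s', h'⟩ := hu
  refine ⟨a.subst fun n => .var (2 * n), b.subst fun n => .var (2 * n + 1), merge s s', fun i e E => ?_⟩
  rw [Tm.val_subst, Tm.val_subst, ← h, ← h']
  simp only [Tm.val, numEnv, merge_even, merge_odd]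
  exact ⟨rfl, rfl⟩

/-- Two predicates are given by formulas over the same choice of parameters. -/
theorem Def.common {P Q : K.Pred} (hP : K.Def P) (hQ : K.Def Q) :
    ∃ (p q : Fml) (s : ℕ → ℕ ⊕ K.parN) (s' : ℕ → ℕ ⊕ K.parS),
      (K.arith → p.IsArith ∧ q.IsArith) ∧ ∀ i e E,
      (p.Holds (K.st i) (K.numEnv s i e) (K.setEnv s' i E) ↔ P i e E) ∧
      (q.Holds (K.st i) (K.numEnv s i e) (K.setEnv s' i E) ↔ Q i e E) := by
  obtain ⟨p, s, s', ha, h⟩ := hP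
  obtain ⟨q, r, r', ha', h'⟩ := hQ
  refine ⟨p.subst (fun n => .var (2 * n)) (fun n => 2 * n),
    q.subst (fun n => .var (2 * n + 1)) (fun n => 2 * n + 1), merge s r, merge s' r',
    fun hK => ⟨(ha hK).subst, (ha' hK).subst⟩, fun i e E => ?_⟩
  rw [Fml.holds_subst, Fml.holds_subst, ← h, ← h']
  simp only [Tm.val, numEnv, setEnv, merge_even, merge_odd]
  exact ⟨Iff.rfl, Iff.rfl⟩

open Classical in
/-- Turns references to the innermost variable into references to `0`, in preparation for
quantifying over it. -/
noncomputable def bindIdx {α : Type*} (s : ℕ → ℕ ⊕ α) (n : ℕ) : ℕ := if s n = .inl 0 then 0 else n + 1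

/-- The references of the remaining variables after quantifying over the innermost one. -/
def bindEnv {α : Type*} (s : ℕ → ℕ ⊕ α) (n : ℕ) : ℕ ⊕ α := Sum.map Nat.pred id (s n)

theorem scons_bindIdx {α β : Type*} (s : ℕ → ℕ ⊕ α) (x : β) (e : ℕ → β) (g : α → β) (n : ℕ) :
    scons x (fun n => Sum.elim e g (bindEnv s n)) (bindIdx s n) = Sum.elim (scons x e) g (s n) := by
  rcases h : s n with k | c
  · cases k with
    | zero => simp [bindIdx, h]
    | succ k => simp [bindIdx, bindEnv, h]
  · simp [bindIdx, bindEnv, h]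

instance DefT.var (k : ℕ) : K.DefT fun _ e _ => e k :=
  ⟨.var 0, fun _ => .inl k, fun _ _ _ => rfl⟩

theorem DefT.of_par {c : ∀ i, (K.st i).N} (h : c ∈ K.parN) : K.DefT fun i _ _ => c i :=
  ⟨.var 0, fun _ => .inr ⟨c, h⟩, fun _ _ _ => rfl⟩

/-- Renaming of variables. -/
instance DefT.reindex {t : K.TmFun} {r r' : ℕ → ℕ} [ht : K.DefT t] :
    K.DefT fun i e E => t i (fun k => e (r k)) (fun k => E (r' k)) := by
  obtain ⟨a, s, h⟩ := ht
  refine ⟨a, fun n => (s n).map r id, fun i e E => ?_⟩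
  rw [← h]
  congr 1
  funext n
  simp only [numEnv]
  rcases s n with k | c <;> rfl

instance DefT.zero : K.DefT fun i _ _ => (K.st i).zero :=
  ⟨.zero, fun _ => .inl 0, fun _ _ _ => rfl⟩

instance DefT.one : K.DefT fun i _ _ => (K.st i).one :=
  ⟨.one, fun _ => .inl 0, fun _ _ _ => rfl⟩

instance DefT.add {t u : K.TmFun} [ht : K.DefT t] [hu : K.DefT u] :
    K.DefT fun i e E => (K.st i).add (t i e E) (u i e E) := by
  obtain ⟨a, b, s, h⟩ := ht.common hu
  exact ⟨.add a b, s, fun i e E => by simp only [Tm.val, h i e E]⟩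

instance DefT.mul {t u : K.TmFun} [ht : K.DefT t] [hu : K.DefT u] :
    K.DefT fun i e E => (K.st i).mul (t i e E) (u i e E) := by
  obtain ⟨a, b, s, h⟩ := ht.common hu
  exact ⟨.mul a b, s, fun i e E => by simp only [Tm.val, h i e E]⟩

instance DefT.exp {t u : K.TmFun} [ht : K.DefT t] [hu : K.DefT u] :
    K.DefT fun i e E => (K.st i).exp (t i e E) (u i e E) := by
  obtain ⟨a, b, s, h⟩ := ht.common hu
  exact ⟨.exp a b, s, fun i e E => by simp only [Tm.val, h i e E]⟩

instance DefS.var (k : ℕ) : K.DefS fun _ _ E => (E k : Set _) :=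
  ⟨.inl k, fun _ _ _ => rfl⟩

theorem DefS.of_par {c : ∀ i, (K.st i).sets} (h : c ∈ K.parS) : K.DefS fun i _ _ => (c i : Set _) :=
  ⟨.inr ⟨c, h⟩, fun _ _ _ => rfl⟩

/-- Renaming of variables. -/
instance DefS.reindex {X : K.SetFun} {r r' : ℕ → ℕ} [hX : K.DefS X] :
    K.DefS fun i e E => X i (fun k => e (r k)) (fun k => E (r' k)) := by
  obtain ⟨k, h⟩ := hX
  refine ⟨k.map r' id, fun i e E => ?_⟩
  rw [h]
  rcases k with k | c <;> rfl

instance Def.eq {t u : K.TmFun} [ht : K.DefT t] [hu : K.DefT u] :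
    K.Def fun i e E => t i e E = u i e E := by
  obtain ⟨a, b, s, h⟩ := ht.common hu
  exact ⟨.eq a b, s, fun _ => .inl 0, fun _ => trivial, fun i e E => by simp only [Fml.Holds, h i e E]⟩

instance Def.lt {t u : K.TmFun} [ht : K.DefT t] [hu : K.DefT u] :
    K.Def fun i e E => (K.st i).lt (t i e E) (u i e E) := by
  obtain ⟨a, b, s, h⟩ := ht.common hu
  exact ⟨.lt a b, s, fun _ => .inl 0, fun _ => trivial, fun i e E => by simp only [Fml.Holds, h i e E]⟩

instance Def.mem {t : K.TmFun} {X : K.SetFun} [ht : K.DefT t] [hX : K.DefS X] :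
    K.Def fun i e E => t i e E ∈ X i e E := by
  obtain ⟨a, s, h⟩ := ht
  obtain ⟨k, hk⟩ := hX
  exact ⟨.mem a 0, s, fun _ => k, fun _ => trivial, fun i e E => by
    simp only [Fml.Holds, h i e E, setEnv, hk]⟩

instance Def.not {P : K.Pred} [hP : K.Def P] : K.Def fun i e E => ¬ P i e E := by
  obtain ⟨p, s, s', ha, h⟩ := hP
  exact ⟨.neg p, s, s', ha, fun i e E => not_congr (h i e E)⟩

instance Def.ne {t u : K.TmFun} [ht : K.DefT t] [hu : K.DefT u] :
    K.Def fun i e E => t i e E ≠ u i e E := Def.not (hP := Def.eq)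

instance Def.and {P Q : K.Pred} [hP : K.Def P] [hQ : K.Def Q] :
    K.Def fun i e E => P i e E ∧ Q i e E := by
  obtain ⟨p, q, s, s', ha, h⟩ := hP.common hQ
  exact ⟨.and p q, s, s', ha, fun i e E => and_congr (h i e E).1 (h i e E).2⟩

theorem Def.congr {P Q : K.Pred} (hP : K.Def P) (h : ∀ i e E, P i e E ↔ Q i e E) : K.Def Q := by
  have : P = Q := by funext i e E; exact propext (h i e E)
  exact this ▸ hP

instance Def.imp {P Q : K.Pred} [hP : K.Def P] [hQ : K.Def Q] :
    K.Def fun i e E => P i e E → Q i e E :=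
  (inferInstance : K.Def fun i e E => ¬ (P i e E ∧ ¬ Q i e E)).congr fun i e E => by tauto

instance Def.or {P Q : K.Pred} [hP : K.Def P] [hQ : K.Def Q] :
    K.Def fun i e E => P i e E ∨ Q i e E :=
  (inferInstance : K.Def fun i e E => ¬ P i e E → Q i e E).congr fun i e E => by tauto

instance Def.iff {P Q : K.Pred} [hP : K.Def P] [hQ : K.Def Q] :
    K.Def fun i e E => P i e E ↔ Q i e E :=
  (inferInstance : K.Def fun i e E => (P i e E → Q i e E) ∧ (Q i e E → P i e E)).congr
    fun i e E => by tauto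

instance Def.const (p : Prop) : K.Def fun _ _ _ => p := by
  by_cases hp : p
  · exact (inferInstance : K.Def fun i _ _ => (K.st i).zero = (K.st i).zero).congr
      fun i e E => by simp [hp]
  · exact (inferInstance : K.Def fun i _ _ => ¬ (K.st i).zero = (K.st i).zero).congr
      fun i e E => by simp [hp]

instance Def.all {P : ∀ i : K.I, (ℕ → (K.st i).N) → (ℕ → (K.st i).sets) → (K.st i).N → Prop}
    [hP : K.Def fun i e E => P i (fun k => e (k + 1)) E (e 0)] :
    K.Def fun i e E => ∀ a : (K.st i).N, P i e E a := by
  obtain ⟨p, s, s', ha, h⟩ := hP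
  refine ⟨.all (p.subst (fun n => .var (bindIdx s n)) id), bindEnv s, s', fun hK => (ha hK).subst,
    fun i e E => forall_congr' fun a => ?_⟩
  rw [show P i e E a ↔ P i (fun k => scons a e (k + 1)) E (scons a e 0) from Iff.rfl, ← h i (scons a e) E,
    Fml.holds_subst]
  apply iff_of_eq
  congr 1
  funext n
  exact scons_bindIdx s a e (fun c => c.1 i) n

instance Def.ex {P : ∀ i : K.I, (ℕ → (K.st i).N) → (ℕ → (K.st i).sets) → (K.st i).N → Prop}
    [hP : K.Def fun i e E => P i (fun k => e (k + 1)) E (e 0)] :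
    K.Def fun i e E => ∃ a : (K.st i).N, P i e E a :=
  (inferInstance : K.Def fun i e E => ¬ ∀ a : (K.st i).N, ¬ P i e E a).congr
    fun i e E => by push Not; rfl

theorem Def.allS (hK : ¬ K.arith)
    {P : ∀ i : K.I, (ℕ → (K.st i).N) → (ℕ → (K.st i).sets) → Set (K.st i).N → Prop}
    (hP : K.Def fun i e E => P i e (fun k => E (k + 1)) (E 0)) :
    K.Def fun i e E => ∀ A ∈ (K.st i).sets, P i e E A := by
  obtain ⟨p, s, s', ha, h⟩ := hP
  refine ⟨.allS (p.subst .var (bindIdx s')), s, bindEnv s', fun h => absurd h hK,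
    fun i e E => ?_⟩
  rw [Fml.holds_allS, Subtype.forall]
  refine forall_congr' fun A => forall_congr' fun hA => ?_
  rw [show P i e E A ↔ P i e (fun k => scons ⟨A, hA⟩ E (k + 1))
    (scons (⟨A, hA⟩ : (K.st i).sets) E 0 : (K.st i).sets) from Iff.rfl,
    ← h i e (scons ⟨A, hA⟩ E), Fml.holds_subst]
  apply iff_of_eq
  congr 1
  funext n
  exact scons_bindIdx s' _ E (fun c => c.1 i) n

theorem Def.exS (hK : ¬ K.arith)
    {P : ∀ i : K.I, (ℕ → (K.st i).N) → (ℕ → (K.st i).sets) → Set (K.st i).N → Prop}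
    (hP : K.Def fun i e E => P i e (fun k => E (k + 1)) (E 0)) :
    K.Def fun i e E => ∃ A ∈ (K.st i).sets, P i e E A := by
  have h : K.Def fun i e E => ¬ ∀ A ∈ (K.st i).sets, ¬ P i e E A :=
    @Def.not _ _ (Def.allS hK (P := fun i e E A => ¬ P i e E A) (@Def.not _ _ hP))
  exact h.congr fun i e E => by push Not; rfl

end Ctx

/-! ### Definability of the arithmetized notions -/

namespace Ctx
variable {K : Ctx}

section Terms
variable {t u : K.TmFun} [K.DefT t] [K.DefT u]

instance defT_std (k : ℕ) : K.DefT fun i _ _ => (K.st i).std k := by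
  induction k with
  | zero => exact DefT.zero
  | succ k ih => exact @DefT.add _ _ _ ih DefT.one

instance defT_pair : K.DefT fun i e E => (K.st i).pair (t i e E) (u i e E) := by
  unfold Struct.pair; infer_instance
instance defT_tag (k : ℕ) : K.DefT fun i e E => (K.st i).tag k (t i e E) (u i e E) := by
  unfold Struct.tag; infer_instance
instance defT_cZero : K.DefT fun i _ _ => (K.st i).cZero := by unfold Struct.cZero; infer_instance
instance defT_cOne : K.DefT fun i _ _ => (K.st i).cOne := by unfold Struct.cOne; infer_instance
instance defT_cVar : K.DefT fun i e E => (K.st i).cVar (t i e E) := by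
  unfold Struct.cVar; infer_instance
instance defT_cConst : K.DefT fun i e E => (K.st i).cConst (t i e E) := by
  unfold Struct.cConst; infer_instance
instance defT_cAdd : K.DefT fun i e E => (K.st i).cAdd (t i e E) (u i e E) := by
  unfold Struct.cAdd; infer_instance
instance defT_cMul : K.DefT fun i e E => (K.st i).cMul (t i e E) (u i e E) := by
  unfold Struct.cMul; infer_instance
instance defT_cExp : K.DefT fun i e E => (K.st i).cExp (t i e E) (u i e E) := by
  unfold Struct.cExp; infer_instance
instance defT_cSVar : K.DefT fun i e E => (K.st i).cSVar (t i e E) := by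
  unfold Struct.cSVar; infer_instance
instance defT_cSConst : K.DefT fun i e E => (K.st i).cSConst (t i e E) := by
  unfold Struct.cSConst; infer_instance
instance defT_cEq : K.DefT fun i e E => (K.st i).cEq (t i e E) (u i e E) := by
  unfold Struct.cEq; infer_instance
instance defT_cLt : K.DefT fun i e E => (K.st i).cLt (t i e E) (u i e E) := by
  unfold Struct.cLt; infer_instance
instance defT_cMem : K.DefT fun i e E => (K.st i).cMem (t i e E) (u i e E) := by
  unfold Struct.cMem; infer_instance
instance defT_cOracle : K.DefT fun i e E => (K.st i).cOracle (t i e E) := by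
  unfold Struct.cOracle; infer_instance
instance defT_cNeg : K.DefT fun i e E => (K.st i).cNeg (t i e E) := by
  unfold Struct.cNeg; infer_instance
instance defT_cAnd : K.DefT fun i e E => (K.st i).cAnd (t i e E) (u i e E) := by
  unfold Struct.cAnd; infer_instance
instance defT_cAll : K.DefT fun i e E => (K.st i).cAll (t i e E) (u i e E) := by
  unfold Struct.cAll; infer_instance
instance defT_cAllS : K.DefT fun i e E => (K.st i).cAllS (t i e E) (u i e E) := by
  unfold Struct.cAllS; infer_instance
instance defT_cImp : K.DefT fun i e E => (K.st i).cImp (t i e E) (u i e E) := by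
  unfold Struct.cImp; infer_instance
instance defT_cIff : K.DefT fun i e E => (K.st i).cIff (t i e E) (u i e E) := by
  unfold Struct.cIff; infer_instance

end Terms

section Codes
variable {t u v w : K.TmFun} [K.DefT t] [K.DefT u] [K.DefT v] [K.DefT w]

instance def_inFin : K.Def fun i e E => (K.st i).inFin (t i e E) (u i e E) := by
  unfold Struct.inFin; infer_instance

instance def_isTm (p : Prop) : K.Def fun i e E => (K.st i).IsTm p (t i e E) := by
  unfold Struct.IsTm Struct.Built; infer_instance

instance def_isSTm (p : Prop) : K.Def fun i e E => (K.st i).IsSTm p (t i e E) := by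
  unfold Struct.IsSTm; infer_instance

instance def_isFml (p : Prop) : K.Def fun i e E => (K.st i).IsFml p (t i e E) := by
  unfold Struct.IsFml Struct.Built; infer_instance

instance def_tmSub : K.Def fun i e E => (K.st i).TmSub (t i e E) (u i e E) (v i e E) (w i e E) := by
  unfold Struct.TmSub Struct.Built; infer_instance

instance def_sub : K.Def fun i e E => (K.st i).Sub (t i e E) (u i e E) (v i e E) (w i e E) := by
  unfold Struct.Sub Struct.Built; infer_instance

instance def_subS : K.Def fun i e E => (K.st i).SubS (t i e E) (u i e E) (v i e E) (w i e E) := by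
  unfold Struct.SubS Struct.Built; infer_instance

instance def_notFree : K.Def fun i e E => (K.st i).NotFree (t i e E) (u i e E) := by
  unfold Struct.NotFree; infer_instance

instance def_notFreeS : K.Def fun i e E => (K.st i).NotFreeS (t i e E) (u i e E) := by
  unfold Struct.NotFreeS; infer_instance

instance def_isSent : K.Def fun i e E => (K.st i).IsSent (t i e E) := by
  unfold Struct.IsSent; infer_instance

instance def_numeral : K.Def fun i e E => (K.st i).Numeral (t i e E) (u i e E) := by
  unfold Struct.Numeral Struct.Built; infer_instance

instance def_logAx : K.Def fun i e E => (K.st i).LogAx (t i e E) := by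
  unfold Struct.LogAx; infer_instance

instance def_val : K.Def fun i e E => (K.st i).Val (t i e E) (u i e E) := by
  unfold Struct.Val; infer_instance

instance def_univClosure : K.Def fun i e E => (K.st i).UnivClosure (t i e E) (u i e E) := by
  unfold Struct.UnivClosure Struct.Built; infer_instance

/-- The instance `T.ax(t)` of the formula that defines the axioms of `T` contains no set variables,
so that the quantifier over assignments of sets is idle. -/
instance def_ax (T : RepTheory) :
    K.Def fun i e E => ∀ E' : ℕ → (K.st i).sets, T.ax.Holds (K.st i) (fun _ => t i e E) E' := by
  obtain ⟨a, s, h⟩ := (inferInstance : K.DefT t)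
  refine ⟨T.ax.subst (fun _ => a) id, s, fun _ => .inl 0, fun _ => T.delta0.isArith.subst,
    fun i e E => ?_⟩
  simp only [Fml.holds_subst]
  rw [← h i e E]
  exact ⟨fun hE E' => (Fml.holds_congr T.closed (fun _ _ => rfl)
    fun _ h => absurd h (Nat.not_lt_zero _)).1 hE, fun hE => hE _⟩

instance def_axT (T : RepTheory) : K.Def fun i e E => (K.st i).AxT T (t i e E) := by
  unfold Struct.AxT; infer_instance

variable {X L M P : K.SetFun} [K.DefS X] [K.DefS L] [K.DefS M] [K.DefS P]

instance def_axTX (T : RepTheory) : K.Def fun i e E => (K.st i).AxTX T (X i e E) (t i e E) := by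
  unfold Struct.AxTX; infer_instance

instance def_proofTX (T : RepTheory) :
    K.Def fun i e E => (K.st i).ProofTX T (X i e E) (t i e E) (u i e E) := by
  unfold Struct.ProofTX; infer_instance

instance def_inField : K.Def fun i e E => (K.st i).inField (L i e E) (t i e E) := by
  unfold Struct.inField; infer_instance

instance def_prec : K.Def fun i e E => (K.st i).prec (L i e E) (t i e E) (u i e E) := by
  unfold Struct.prec; infer_instance

instance def_isLinear : K.Def fun i e E => (K.st i).IsLinear (L i e E) := by
  unfold Struct.IsLinear; infer_instance

instance def_oracleRule (T : RepTheory) {t1 t2 : K.TmFun} [K.DefT t1] [K.DefT t2] :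
    K.Def fun i e E => (K.st i).OracleRule T (X i e E) (L i e E) (t i e E) (u i e E) (v i e E)
      (w i e E) (t1 i e E) (t2 i e E) (P i e E) := by
  unfold Struct.OracleRule; infer_instance

instance def_oracleProof (T : RepTheory) :
    K.Def fun i e E => (K.st i).OracleProof T (X i e E) (L i e E) (t i e E) (u i e E) (v i e E)
      (P i e E) := by
  unfold Struct.OracleProof; infer_instance

instance def_ipc (T : RepTheory) :
    K.Def fun i e E => (K.st i).IPC T (X i e E) (L i e E) (P i e E) := by
  unfold Struct.IPC; infer_instance

instance def_isSat : K.Def fun i e E => (K.st i).IsSat (M i e E) (P i e E) := by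
  unfold Struct.IsSat; infer_instance

end Codes

/-! ### The formula that expresses soundness -/

/-- The context of all structures; its only set parameter is an arbitrary set of the structure. -/
@[reducible] def uniform : Ctx where
  I := Σ S : Struct, S.sets
  st i := i.1
  parN := {fun i => i.1.zero}
  parS := {fun i => i.2}
  arith := False

instance {P : ∀ i : uniform.I, (ℕ → (uniform.st i).N) → (ℕ → (uniform.st i).sets) →
      Set (uniform.st i).N → Prop}
    [hP : uniform.Def fun i e E => P i e (fun k => E (k + 1)) (E 0)] :
    uniform.Def fun i e E => ∀ A ∈ (uniform.st i).sets, P i e E A := Def.allS id hP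

instance {P : ∀ i : uniform.I, (ℕ → (uniform.st i).N) → (ℕ → (uniform.st i).sets) →
      Set (uniform.st i).N → Prop}
    [hP : uniform.Def fun i e E => P i e (fun k => E (k + 1)) (E 0)] :
    uniform.Def fun i e E => ∃ A ∈ (uniform.st i).sets, P i e E A := Def.exS id hP

instance def_soundness (T : RepTheory) :
    uniform.Def fun i _ _ => (uniform.st i).OmegaModelSoundness T := by
  unfold Struct.OmegaModelSoundness Struct.IsWO Struct.IsFullModel Struct.IsFull Struct.Sats
    Struct.OmegaProvable
  infer_instance

end Ctx

/-- A property of structures that is uniformly definable is expressed by a sentence. -/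
theorem exists_expresses {P : Struct → Prop} (h : Ctx.uniform.Def fun i _ _ => P i.1) :
    ∃ q : Fml, Expresses q P := by
  obtain ⟨p, s, s', -, h⟩ := h
  obtain ⟨n, hn⟩ := p.exists_closedAt
  -- number variables are replaced by `0`, and set variables are quantified universally, the
  -- parameter being represented by the variable `0`
  let r : ℕ → ℕ := fun k => Sum.elim (· + 1) (fun _ => 0) (s' k)
  let p' := p.subst (fun _ => .zero) r
  obtain ⟨m, hm⟩ : ∃ m, ∀ k < n, r k < m := by
    refine ⟨(Finset.range n).sup r + 1, fun k hk => Nat.lt_succ_of_le ?_⟩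
    exact Finset.le_sup (f := r) (Finset.mem_range.2 hk)
  have hp' : p'.ClosedAt 0 m := Fml.closedAt_subst hn (fun _ => trivial) hm
  have hP : ∀ (S : Struct) e (E : ℕ → S.sets), p'.Holds S e E ↔ P S := by
    intro S e E
    rw [Fml.holds_subst, ← h ⟨S, E 0⟩ (fun _ => S.zero) (fun k => E (k + 1))]
    apply iff_of_eq
    congr 1
    · funext k
      simp only [Ctx.numEnv, Tm.val]
      rcases s k with j | ⟨_, rfl⟩ <;> rfl
    · funext k
      simp only [Ctx.setEnv, r]
      rcases s' k with j | ⟨_, rfl⟩ <;> rfl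
  refine ⟨Fml.allS^[m] p', Fml.closedAt_closure 0 m (n' := 0) (m' := 0) (by simpa using hp'),
    fun S => ⟨fun hS => ?_, fun hS => Fml.holds_allS_iterate (fun e E => (hP S e E).2 hS) m⟩⟩
  obtain ⟨A, hA⟩ := S.nonempty
  exact (hP S (fun _ => S.zero) fun _ => ⟨A, hA⟩).1
    (Fml.holds_of_closure 0 m (e := fun _ => S.zero) (E := fun _ => ⟨A, hA⟩) (hS _ _))

end SOA

namespace SOA

/-! ### Models of `ATR₀` -/

section Holds
variable {S : Struct} {e : ℕ → S.N} {E : ℕ → S.sets} {p q : Fml}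

theorem Fml.holds_eq {a b : Tm} : (Fml.eq a b).Holds S e E ↔ a.val S e = b.val S e := Iff.rfl
theorem Fml.holds_mem {a : Tm} {k : ℕ} : (Fml.mem a k).Holds S e E ↔ a.val S e ∈ (E k : Set S.N) :=
  Iff.rfl
theorem Fml.holds_neg : (Fml.neg p).Holds S e E ↔ ¬ p.Holds S e E := Iff.rfl
theorem Fml.holds_and : (Fml.and p q).Holds S e E ↔ p.Holds S e E ∧ q.Holds S e E := Iff.rfl
theorem Fml.holds_imp : (Fml.imp p q).Holds S e E ↔ (p.Holds S e E → q.Holds S e E) := by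
  simp only [Fml.imp, holds_neg, holds_and]; tauto
theorem Fml.holds_or : (Fml.or p q).Holds S e E ↔ (p.Holds S e E ∨ q.Holds S e E) := by
  simp only [Fml.or, holds_neg, holds_and]; tauto
theorem Fml.holds_iff : (Fml.iff p q).Holds S e E ↔ (p.Holds S e E ↔ q.Holds S e E) := by
  simp only [Fml.iff, holds_imp, holds_and]; tauto
theorem Fml.holds_ex : (Fml.ex p).Holds S e E ↔ ∃ a, p.Holds S (scons a e) E := by
  simp only [Fml.ex, holds_neg, holds_all]; push Not; rfl
theorem Fml.holds_exS : (Fml.exS p).Holds S e E ↔ ∃ A, p.Holds S e (scons A E) := by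
  simp only [Fml.exS, holds_neg, holds_allS]; push Not; rfl
theorem Fml.holds_field {L : ℕ} {x : Tm} :
    (fieldFml L x).Holds S e E ↔ S.inField (E L) (x.val S e) := Iff.rfl
theorem Fml.holds_prec {L : ℕ} {x y : Tm} :
    (precFml L x y).Holds S e E ↔ S.prec (E L) (x.val S e) (y.val S e) := Iff.rfl

theorem Tm.val_zero : Tm.zero.val S e = S.zero := rfl
theorem Tm.val_one : Tm.one.val S e = S.one := rfl
theorem Tm.val_var {i : ℕ} : (Tm.var i).val S e = e i := rfl
theorem Tm.val_add {a b : Tm} : (Tm.add a b).val S e = S.add (a.val S e) (b.val S e) := rfl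
theorem Tm.val_mul {a b : Tm} : (Tm.mul a b).val S e = S.mul (a.val S e) (b.val S e) := rfl
theorem Tm.val_exp {a b : Tm} : (Tm.exp a b).val S e = S.exp (a.val S e) (b.val S e) := rfl
theorem Tm.val_pair {a b : Tm} : (Tm.pair a b).val S e = S.pair (a.val S e) (b.val S e) := rfl
theorem Tm.val_shift {a : Tm} : a.shift.val S e = a.val S fun i => e (i + 1) := by
  rw [Tm.shift, Tm.val_subst]; rfl

theorem holds_linear {L : ℕ} : (linearFml L).Holds S e E ↔ S.IsLinear (E L) := by
  simp only [linearFml, Struct.IsLinear, Fml.holds_and, Fml.holds_all, Fml.holds_imp, Fml.holds_neg,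
    Fml.holds_or, Fml.holds_eq, Fml.holds_field, Fml.holds_prec, Tm.val_var, scons_succ, scons_zero,
    and_imp]

theorem holds_wo {L : ℕ} : (woFml L).Holds S e E ↔ S.IsWO (E L) := by
  simp only [woFml, Struct.IsWO, Fml.holds_and, Fml.holds_all, Fml.holds_allS, Fml.holds_ex, Fml.holds_imp,
    Fml.holds_or, Fml.holds_eq, Fml.holds_field, Fml.holds_prec, Fml.holds_mem, Tm.val_var, scons_succ,
    scons_zero, and_imp, holds_linear, Subtype.forall]

end Holds

/-- Restricting occurrences of a set variable to the part below `ξ` has the same effect as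
interpreting the variable by the restricted set. -/
theorem Fml.holds_restrictBelow {S : Struct} (p : Fml) : ∀ (k l : ℕ) (e : ℕ → S.N) (E : ℕ → S.sets)
    (R : S.sets), (∀ x, x ∈ (R : Set S.N) ↔ x ∈ (E l : Set S.N) ∧
      ∃ a b, x = S.pair a b ∧ S.prec (E (l + 1)) a (e (k + 1))) →
    ((p.restrictBelow k l).Holds S e E ↔ p.Holds S e (Function.update E l R)) := by
  induction p with
  | eq a b => intro k l e E R _; rfl
  | lt a b => intro k l e E R _; rfl
  | mem t i =>
    intro k l e E R hR
    rw [Fml.restrictBelow]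
    split_ifs with h
    · subst h
      rw [Fml.holds_mem, Function.update_self, hR]
      simp only [Fml.holds_and, Fml.holds_ex, Fml.holds_eq, Fml.holds_prec, Fml.holds_mem, Tm.val_shift,
        Tm.val_pair, Tm.val_var, scons_succ, scons_zero,
        show k + 3 = k + 2 + 1 from rfl, show k + 2 = k + 1 + 1 from rfl]
    · rw [Fml.holds_mem, Fml.holds_mem, Function.update_of_ne h]
  | neg p ih => intro k l e E R hR; exact not_congr (ih k l e E R hR)
  | and p q ih ih' => intro k l e E R hR; exact and_congr (ih k l e E R hR) (ih' k l e E R hR)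
  | all p ih => intro k l e E R hR; exact forall_congr' fun a => ih (k + 1) l (scons a e) E R hR
  | allS p ih =>
    intro k l e E R hR
    refine forall_congr' fun A => (ih k (l + 1) e (scons A E) R hR).trans (iff_of_eq ?_)
    congr 1
    funext i
    cases i with
    | zero => simp [Function.update]
    | succ i => simp [Function.update]

namespace Struct

/-- `S` is a model of `ATR₀`. -/
class IsModel (S : Struct) : Prop where
  holds : ∀ {p : Fml}, ATR0Basic p → ∀ e E, p.Holds S e E

theorem isModel_of_ATR0 {S : Struct} (h : ∀ p ∈ ATR0, ∀ e E, p.Holds S e E) : S.IsModel := by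
  refine ⟨fun {p} hp e E => ?_⟩
  obtain ⟨n, hn⟩ := p.exists_closedAt
  exact Fml.holds_of_closure n n (h (Fml.all^[n] (Fml.allS^[n] p))
    ⟨Fml.closedAt_closure n n (by simpa using hn), p, n, n, hp, rfl⟩ _ _)

variable (S : Struct)

/-- The context of arithmetic definability with parameters in `S`. -/
@[reducible] def ctx : Ctx where
  I := PUnit
  st _ := S
  parN := Set.univ
  parS := Set.univ
  arith := True

/-- The set `A` belongs to the structure `S`. -/
class IsSet {S : Struct} (A : Set S.N) : Prop where
  mem : A ∈ S.sets

variable {S}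

instance defT_par (a : S.N) : S.ctx.DefT fun _ _ _ => a := Ctx.DefT.of_par (K := S.ctx) (Set.mem_univ fun _ => a)

instance defS_par (A : Set S.N) [h : IsSet A] : S.ctx.DefS fun _ _ _ => A :=
  Ctx.DefS.of_par (K := S.ctx) (c := fun _ => ⟨A, h.mem⟩) trivial

/-- A property of elements of `S` that is arithmetically definable with parameters. -/
abbrev Ar (P : S.N → Prop) : Prop := S.ctx.Def fun _ e _ => P (e 0)

variable [hS : S.IsModel]

theorem comprehension (P : S.N → Prop) [hP : Ar P] : {x | P x} ∈ S.sets := by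
  obtain ⟨p, s, s', ha, h⟩ := hP
  obtain ⟨A, hA⟩ := S.nonempty
  have h1 := hS.holds (.comprehension (p.subst (fun n => .var (Ctx.bindIdx s n)) id) (ha trivial).subst)
    (S.ctx.numEnv (Ctx.bindEnv s) ⟨⟩ fun _ => S.zero) (S.ctx.setEnv s' ⟨⟩ fun _ => ⟨A, hA⟩)
  simp only [Fml.holds_exS, Fml.holds_all, Fml.holds_iff, Fml.holds_mem, Fml.holds_shiftS,
    Fml.holds_subst, scons_succ, scons_zero, Tm.val_var] at h1
  obtain ⟨Y, hY⟩ := h1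
  convert Y.2
  ext x
  rw [hY, Set.mem_ofPred, show P x ↔ P (scons x (fun _ => S.zero) 0) from Iff.rfl,
    ← h ⟨⟩ (scons x fun _ => S.zero) fun _ => ⟨A, hA⟩]
  apply iff_of_eq
  congr 1
  funext n
  exact (Ctx.scons_bindIdx s x (fun _ => S.zero) (fun c => c.1 ⟨⟩) n).symm

theorem isSet_setOf (P : S.N → Prop) [Ar P] : IsSet {x | P x} := ⟨comprehension P⟩

theorem set_induction {A : Set S.N} (hA : A ∈ S.sets) (h0 : S.zero ∈ A)
    (hs : ∀ x ∈ A, S.add x S.one ∈ A) (x : S.N) : x ∈ A := by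
  have h1 := hS.holds .induction (fun _ => S.zero) fun _ => ⟨A, hA⟩
  simp only [Fml.holds_imp, Fml.holds_and, Fml.holds_all, Fml.holds_mem, Tm.val_var, Tm.val_add,
    Tm.val_zero, Tm.val_one, scons_zero] at h1
  exact h1 ⟨h0, hs⟩ x

/-- Arithmetic transfinite recursion. -/
theorem recursion {L : Set S.N} (hL : L ∈ S.sets) (hwo : S.IsWO L) (P : S.N → Set S.N → Prop)
    [hP : S.ctx.Def fun _ e E => P (e 0) (E 0)] :
    ∃ Y ∈ S.sets, ∀ l, S.inField L l → ∀ x, S.pair l x ∈ Y ↔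
      P x {y | y ∈ Y ∧ ∃ a b, y = S.pair a b ∧ S.prec L a l} := by
  obtain ⟨p, s, s', ha, h⟩ := hP
  -- the recursion variable is the set variable `0`, and `L` becomes the set variable `1`
  let r : ℕ → ℕ := fun n => scons 0 (fun m => m + 2) (Ctx.bindIdx s' n)
  let p' := p.subst (fun n => .var (Ctx.bindIdx s n)) r
  have h1 := hS.holds (.recursion p' (ha trivial).subst)
    (S.ctx.numEnv (Ctx.bindEnv s) ⟨⟩ fun _ => S.zero) (S.ctx.setEnv (Ctx.bindEnv s') ⟨⟩ fun _ => ⟨L, hL⟩)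
  simp only [recursionFml, Fml.holds_exS, Fml.holds_allS, Fml.holds_all, Fml.holds_imp, Fml.holds_iff,
    Fml.holds_mem, Fml.holds_field, scons_succ, scons_zero, Tm.val_var, Tm.val_pair, holds_wo] at h1
  obtain ⟨Y, hY⟩ := h1 ⟨L, hL⟩ hwo
  refine ⟨Y, Y.2, fun l hl x => (hY l hl x).trans ?_⟩
  have : IsSet L := ⟨hL⟩
  have : IsSet (Y : Set S.N) := ⟨Y.2⟩
  let R : S.sets := ⟨_, comprehension fun y => y ∈ (Y : Set S.N) ∧ ∃ a b, y = S.pair a b ∧ S.prec L a l⟩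
  rw [Fml.holds_restrictBelow _ 0 0 _ _ R (fun x => Iff.rfl), Fml.holds_subst, Fml.holds_subst]
  have h2 := h ⟨⟩ (scons x fun _ => S.zero) (scons R fun _ => ⟨L, hL⟩)
  refine Iff.trans (iff_of_eq ?_) h2
  congr 1
  · funext n
    rw [Ctx.numEnv, ← Ctx.scons_bindIdx]
    simp only [Tm.val_var]
    rcases Ctx.bindIdx s n with - | m <;> rfl
  · funext n
    rw [Ctx.setEnv, ← Ctx.scons_bindIdx]
    simp only [r, id]
    rcases Ctx.bindIdx s' n with - | m <;> rfl

end Struct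
end SOA

namespace SOA
namespace Struct

/-! ### Arithmetic in models of `ATR₀` -/

variable {S : Struct}

instance : Zero S.N := ⟨S.zero⟩
instance : One S.N := ⟨S.one⟩
instance : Add S.N := ⟨S.add⟩
instance : Mul S.N := ⟨S.mul⟩
instance : LT S.N := ⟨S.lt⟩

instance defT_zero' : S.ctx.DefT fun _ _ _ => (0 : S.N) := Ctx.DefT.zero (K := S.ctx)
instance defT_one' : S.ctx.DefT fun _ _ _ => (1 : S.N) := Ctx.DefT.one (K := S.ctx)

section
variable {t u : S.ctx.TmFun} [S.ctx.DefT t] [S.ctx.DefT u]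
instance defT_add' : S.ctx.DefT fun i e E => (t i e E + u i e E : S.N) :=
  Ctx.DefT.add (K := S.ctx) (t := t) (u := u)
instance defT_mul' : S.ctx.DefT fun i e E => (t i e E * u i e E : S.N) :=
  Ctx.DefT.mul (K := S.ctx) (t := t) (u := u)
instance def_lt' : S.ctx.Def fun i e E => (t i e E : S.N) < u i e E :=
  Ctx.Def.lt (K := S.ctx) (t := t) (u := u)
end

theorem pair_def (x y : S.N) : S.pair x y = (x + y) * (x + y) + x := rfl

variable [hS : S.IsModel]

theorem ind (P : S.N → Prop) [Ar P] (h0 : P 0) (hs : ∀ x, P x → P (x + 1)) (x : S.N) : P x :=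
  set_induction (comprehension P) h0 hs x

namespace Arith

theorem ax {p : Fml} (h : ATR0Basic p) (x y : S.N) :
    ∃ E : ℕ → S.sets, p.Holds S (scons x fun _ => y) E := by
  obtain ⟨A, hA⟩ := S.nonempty
  exact ⟨fun _ => ⟨A, hA⟩, hS.holds h _ _⟩

theorem succ_ne (x : S.N) : x + 1 ≠ 0 := (ax .succ_ne x 0).elim fun _ h => h
theorem succ_inj {x y : S.N} (h : x + 1 = y + 1) : x = y :=
  (ax .succ_inj x y).elim fun _ h' => (Fml.holds_imp.1 h') h
theorem eq_zero_or (x : S.N) : x = 0 ∨ ∃ y, x = y + 1 :=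
  (ax .pred x 0).elim fun _ h => (Fml.holds_or.1 h).imp id fun h => Fml.holds_ex.1 h
theorem add_zero (x : S.N) : x + 0 = x := (ax .add_zero x 0).elim fun _ h => h
theorem add_succ (x y : S.N) : x + (y + 1) = (x + y) + 1 := (ax .add_succ x y).elim fun _ h => h
theorem mul_zero (x : S.N) : x * 0 = 0 := (ax .mul_zero x 0).elim fun _ h => h
theorem mul_succ (x y : S.N) : x * (y + 1) = x * y + x := (ax .mul_succ x y).elim fun _ h => h
theorem exp_zero (x : S.N) : S.exp x 0 = 1 := (ax .exp_zero x 0).elim fun _ h => h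
theorem exp_succ (x y : S.N) : S.exp x (y + 1) = S.exp x y * x := (ax .exp_succ x y).elim fun _ h => h
theorem not_lt_zero (x : S.N) : ¬ x < 0 := (ax .lt_zero x 0).elim fun _ h => h
theorem lt_succ {x y : S.N} : x < y + 1 ↔ x < y ∨ x = y := (ax .lt_succ x y).elim fun _ h =>
  (Fml.holds_iff.1 h).trans Fml.holds_or

theorem zero_add (x : S.N) : 0 + x = x := by
  apply ind (fun x => 0 + x = x)
  · exact add_zero _
  · intro x h; rw [add_succ, h]

theorem succ_add (x y : S.N) : (x + 1) + y = (x + y) + 1 := by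
  apply ind (fun y => (x + 1) + y = (x + y) + 1)
  · rw [add_zero, add_zero]
  · intro y h; rw [add_succ, h, add_succ]

theorem add_comm (x y : S.N) : x + y = y + x := by
  apply ind (fun y => x + y = y + x)
  · rw [add_zero, zero_add]
  · intro y h; rw [add_succ, h, succ_add]

theorem add_assoc (x y z : S.N) : (x + y) + z = x + (y + z) := by
  apply ind (fun z => (x + y) + z = x + (y + z))
  · rw [add_zero, add_zero]
  · intro z h; rw [add_succ, h, add_succ, add_succ]

theorem zero_mul (x : S.N) : 0 * x = 0 := by
  apply ind (fun x => 0 * x = 0)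
  · exact mul_zero _
  · intro x h; rw [mul_succ, h, add_zero]

theorem succ_mul (x y : S.N) : (x + 1) * y = x * y + y := by
  apply ind (fun y => (x + 1) * y = x * y + y)
  · rw [mul_zero, mul_zero, add_zero]
  · intro y h
    rw [mul_succ, h, mul_succ, add_succ (x * y + y), add_succ (x * y + x), add_assoc (x * y) y,
      add_assoc (x * y) x, add_comm y x]

theorem mul_comm (x y : S.N) : x * y = y * x := by
  apply ind (fun y => x * y = y * x)
  · rw [mul_zero, zero_mul]
  · intro y h; rw [mul_succ, h, succ_mul]

theorem left_distrib (x y z : S.N) : x * (y + z) = x * y + x * z := by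
  apply ind (fun z => x * (y + z) = x * y + x * z)
  · rw [mul_zero, add_zero, add_zero]
  · intro z h; rw [add_succ, mul_succ, h, mul_succ, add_assoc]

theorem mul_assoc (x y z : S.N) : (x * y) * z = x * (y * z) := by
  apply ind (fun z => (x * y) * z = x * (y * z))
  · rw [mul_zero, mul_zero, mul_zero]
  · intro z h; rw [mul_succ, h, mul_succ, left_distrib]

theorem mul_one (x : S.N) : x * 1 = x := by
  rw [← zero_add (1 : S.N), mul_succ, mul_zero, zero_add]

end Arith

instance : CommSemiring S.N where
  add_assoc := Arith.add_assoc
  zero_add := Arith.zero_add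
  add_zero := Arith.add_zero
  add_comm := Arith.add_comm
  mul_assoc := Arith.mul_assoc
  mul_comm := Arith.mul_comm
  one_mul x := by rw [Arith.mul_comm, Arith.mul_one]
  mul_one := Arith.mul_one
  left_distrib := Arith.left_distrib
  right_distrib x y z := by
    rw [Arith.mul_comm, Arith.left_distrib, Arith.mul_comm z, Arith.mul_comm z]
  zero_mul := Arith.zero_mul
  mul_zero := Arith.mul_zero
  nsmul := nsmulRec

theorem lt_iff {x y : S.N} : x < y ↔ ∃ z, x + (z + 1) = y := by
  apply ind (fun y => x < y ↔ ∃ z, x + (z + 1) = y)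
  · refine ⟨fun h => (Arith.not_lt_zero x h).elim, fun ⟨z, hz⟩ => (Arith.succ_ne (x + z) ?_).elim⟩
    rw [← hz]; ring
  · intro y h
    rw [Arith.lt_succ, h]
    constructor
    · rintro (⟨z, rfl⟩ | rfl)
      · exact ⟨z + 1, by ring⟩
      · exact ⟨0, by ring⟩
    · rintro ⟨z, hz⟩
      have h1 : x + z = y := Arith.succ_inj (by rw [← hz]; ring)
      rcases Arith.eq_zero_or z with rfl | ⟨z, rfl⟩
      · exact .inr (by rw [← h1]; ring)
      · exact .inl ⟨z, h1⟩

theorem add_right_cancel' {x y z : S.N} (h : x + z = y + z) : x = y := by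
  revert h
  apply ind (fun z => x + z = y + z → x = y)
  · simp
  · intro z ih h
    exact ih (Arith.succ_inj (by rw [add_assoc, add_assoc]; exact h))

instance : LE S.N := ⟨fun x y => x < y ∨ x = y⟩

theorem le_iff {x y : S.N} : x ≤ y ↔ ∃ z, x + z = y := by
  change x < y ∨ x = y ↔ _
  rw [lt_iff]
  constructor
  · rintro (⟨z, rfl⟩ | rfl)
    · exact ⟨_, rfl⟩
    · exact ⟨0, by simp⟩
  · rintro ⟨z, rfl⟩
    rcases Arith.eq_zero_or z with rfl | ⟨z, rfl⟩
    · simp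
    · exact .inl ⟨z, rfl⟩

theorem lt_irrefl' (x : S.N) : ¬ x < x := by
  rw [lt_iff]
  rintro ⟨z, hz⟩
  refine Arith.succ_ne z (add_right_cancel' (z := x) ?_)
  rw [zero_add, add_comm, hz]

open Classical in
noncomputable instance : LinearOrder S.N where
  le_refl x := .inr rfl
  le_trans x y z := by
    simp only [le_iff]
    rintro ⟨a, rfl⟩ ⟨b, rfl⟩
    exact ⟨a + b, by ring⟩
  lt_iff_le_not_ge x y := by
    constructor
    · refine fun h => ⟨.inl h, fun h' => ?_⟩
      obtain ⟨a, rfl⟩ := lt_iff.1 h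
      obtain ⟨b, hb⟩ := le_iff.1 h'
      exact lt_irrefl' x (lt_iff.2 ⟨a + b, Eq.trans (by ring) hb⟩)
    · rintro ⟨h | rfl, h'⟩
      · exact h
      · exact (h' (.inr rfl)).elim
  le_antisymm x y h h' := by
    rcases h with h | rfl
    · obtain ⟨a, rfl⟩ := lt_iff.1 h
      obtain ⟨b, hb⟩ := le_iff.1 h'
      exact (lt_irrefl' x (lt_iff.2 ⟨a + b, Eq.trans (by ring) hb⟩)).elim
    · rfl
  le_total x y := by
    apply ind (fun y => (x < y ∨ x = y) ∨ (y < x ∨ y = x))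
    · exact .inr (le_iff.2 ⟨x, zero_add x⟩)
    · rintro y (h | h | rfl)
      · exact .inl (.inl (Arith.lt_succ.2 h))
      · obtain ⟨z, rfl⟩ := lt_iff.1 h
        exact .inr (le_iff.2 ⟨z, by ring⟩)
      · exact .inl (.inl (Arith.lt_succ.2 (.inr rfl)))
  toDecidableLE := inferInstance

instance defT_le' {t u : S.ctx.TmFun} [S.ctx.DefT t] [S.ctx.DefT u] :
    S.ctx.Def fun i e E => (t i e E : S.N) ≤ u i e E :=
  (inferInstance : S.ctx.Def fun i e E => (t i e E : S.N) < u i e E ∨ (t i e E : S.N) = u i e E)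

theorem pos_iff {x : S.N} : 0 < x ↔ ∃ y, x = y + 1 := by
  rw [lt_iff]
  exact exists_congr fun y => by rw [zero_add, eq_comm]

instance : IsStrictOrderedRing S.N := by
  have hadd : ∀ a b : S.N, a ≤ b → ∀ c, a + c ≤ b + c := by
    intro a b h c
    obtain ⟨d, rfl⟩ := le_iff.1 h
    exact le_iff.2 ⟨d, by ring⟩
  have hmul : ∀ a : S.N, 0 < a → ∀ b c, b < c → a * b < a * c := by
    intro a ha b c h
    obtain ⟨a, rfl⟩ := pos_iff.1 ha
    obtain ⟨d, rfl⟩ := lt_iff.1 h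
    exact lt_iff.2 ⟨a * d + a + d, by ring⟩
  exact {
    add_le_add_left := hadd
    le_of_add_le_add_left := fun a _ _ h => by
      obtain ⟨d, hd⟩ := le_iff.1 h
      exact le_iff.2 ⟨d, add_right_cancel' (z := a) (by rw [add_comm _ a, add_comm _ a, ← hd]; ring)⟩
    zero_le_one := le_iff.2 ⟨1, by simp⟩
    exists_pair_ne := ⟨0, 1, fun h => Arith.succ_ne (S := S) 0 (by rw [zero_add, ← h])⟩
    mul_lt_mul_of_pos_left := hmul
    mul_lt_mul_of_pos_right := fun c hc _ _ h => by
      simpa only [mul_comm _ c] using hmul c hc _ _ h }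

instance : CanonicallyOrderedAdd S.N where
  exists_add_of_le h := (le_iff.1 h).imp fun _ => Eq.symm
  le_add_self _ b := le_iff.2 ⟨b, add_comm _ _⟩
  le_self_add _ b := le_iff.2 ⟨b, rfl⟩

theorem lt_succ_iff {x y : S.N} : x < y + 1 ↔ x ≤ y := Arith.lt_succ

theorem succ_le_iff {x y : S.N} : x + 1 ≤ y ↔ x < y := by
  rw [lt_iff, le_iff]
  exact exists_congr fun z => by rw [add_assoc, add_comm 1 z]

/-- Strong induction for arithmetic properties. -/
theorem strong_ind (P : S.N → Prop) [Ar P] (h : ∀ x, (∀ y, y < x → P y) → P x) (x : S.N) : P x := by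
  have := isSet_setOf P
  have key : ∀ x, ∀ y, y < x → y ∈ {x | P x} := by
    apply ind (fun x => ∀ y, y < x → y ∈ {x | P x})
    · exact fun y hy => (Arith.not_lt_zero y hy).elim
    · intro x ih y hy
      exact h y fun z hz => ih z (lt_of_lt_of_le hz (lt_succ_iff.1 hy))
  exact key (x + 1) x (lt_succ_iff.2 le_rfl)

/-! ### Pairs and tags -/

theorem pair_inj {x y x' y' : S.N} : S.pair x y = S.pair x' y' ↔ x = x' ∧ y = y' := by
  refine ⟨fun h => ?_, fun h => by rw [h.1, h.2]⟩
  have key : ∀ {x y x' y' : S.N}, x + y < x' + y' → S.pair x y ≠ S.pair x' y' := by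
    intro x y x' y' h
    refine ne_of_lt ?_
    have h1 : (x + y + 1) * (x + y + 1) ≤ (x' + y') * (x' + y') :=
      mul_le_mul' (succ_le_iff.2 h) (succ_le_iff.2 h)
    calc S.pair x y = (x + y) * (x + y) + x := rfl
      _ < (x + y) * (x + y) + x + (x + y + y + 1) := by
        have : (0 : S.N) < x + y + y + 1 := pos_iff.2 ⟨_, rfl⟩
        exact lt_add_of_pos_right _ this
      _ = (x + y + 1) * (x + y + 1) := by ring
      _ ≤ (x' + y') * (x' + y') := h1
      _ ≤ S.pair x' y' := le_self_add
  have hs : x + y = x' + y' := by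
    rcases lt_trichotomy (x + y) (x' + y') with h1 | h1 | h1
    · exact (key h1 h).elim
    · exact h1
    · exact (key h1 h.symm).elim
  rw [pair_def, pair_def, hs] at h
  have hx := add_left_cancel h
  subst hx
  exact ⟨rfl, add_left_cancel hs⟩

theorem le_mul_self' (x : S.N) : x ≤ x * x := by
  rcases Arith.eq_zero_or x with rfl | ⟨y, rfl⟩
  · simp
  · exact le_mul_of_one_le_left' (le_add_self)

theorem le_pair_left (x y : S.N) : x ≤ S.pair x y := le_add_self

theorem le_pair_right (x y : S.N) : y ≤ S.pair x y :=
  le_add_self.trans ((le_mul_self' (x + y)).trans le_self_add)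

theorem pair_lt_pair {x y x' y' : S.N} (h : x < x') (h' : y ≤ y') : S.pair x y < S.pair x' y' := by
  rw [pair_def, pair_def]
  refine add_lt_add_of_le_of_lt ?_ h
  gcongr

theorem std_eq (k : ℕ) : S.std k = (k : S.N) := by
  induction k with
  | zero => exact Nat.cast_zero.symm
  | succ k ih => rw [Nat.cast_succ, ← ih]; rfl

theorem std_two : S.std 2 = (2 : S.N) := std_eq 2

theorem tag_inj {k k' : ℕ} {x y x' y' : S.N} :
    S.tag k x y = S.tag k' x' y' ↔ k = k' ∧ x = x' ∧ y = y' := by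
  rw [tag, tag, pair_inj, pair_inj, std_eq, std_eq, Nat.cast_inj]

theorem pair_lt_tag {k : ℕ} (hk : 0 < k) (x y : S.N) : S.pair x y < S.tag k x y := by
  rw [tag, std_eq, pair_def (k : S.N)]
  have hk' : (0 : S.N) < k := Nat.cast_pos.2 hk
  calc S.pair x y ≤ (k + S.pair x y) * (k + S.pair x y) := le_add_self.trans (le_mul_self' _)
    _ < _ := lt_add_of_pos_right _ hk'

theorem lt_tag_left {k : ℕ} (hk : 0 < k) (x y : S.N) : x < S.tag k x y :=
  (le_pair_left x y).trans_lt (pair_lt_tag hk x y)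

theorem lt_tag_right {k : ℕ} (hk : 0 < k) (x y : S.N) : y < S.tag k x y :=
  (le_pair_right x y).trans_lt (pair_lt_tag hk x y)

/-! ### Binary codes of finite sets -/

/-- The power `2 ^ x`. -/
def pow2 (x : S.N) : S.N := S.exp (S.std 2) x

theorem pow2_zero : pow2 (0 : S.N) = 1 := Arith.exp_zero _
theorem pow2_succ (x : S.N) : pow2 (x + 1) = pow2 x * 2 := by
  rw [pow2, Arith.exp_succ, std_two, pow2, std_two]

instance defT_pow2 {t : S.ctx.TmFun} [S.ctx.DefT t] : S.ctx.DefT fun i e E => pow2 (S := S) (t i e E) :=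
  Ctx.DefT.exp (K := S.ctx) (t := fun _ _ _ => S.std 2) (u := t)

theorem pow2_add (x y : S.N) : pow2 (x + y) = pow2 x * pow2 y := by
  apply ind (fun y => pow2 (x + y) = pow2 x * pow2 y)
  · rw [add_zero, pow2_zero, mul_one]
  · intro y h; rw [← add_assoc, pow2_succ, h, pow2_succ, mul_assoc]

theorem lt_pow2 (x : S.N) : x < pow2 x := by
  apply ind (fun x => x < pow2 x)
  · rw [pow2_zero]; exact one_pos
  · intro x h
    rw [pow2_succ, mul_two]
    exact add_lt_add_of_lt_of_le h (succ_le_iff.2 (pos_of_gt h) |>.trans' (by simp))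

theorem pow2_pos (x : S.N) : 0 < pow2 x := pos_of_gt (lt_pow2 x)

theorem pow2_lt_pow2 {x y : S.N} (h : x < y) : pow2 x < pow2 y := by
  obtain ⟨z, rfl⟩ := lt_iff.1 h
  rw [pow2_add]
  refine lt_mul_of_one_lt_right (pow2_pos x) ?_
  exact lt_of_le_of_lt (le_add_self : (1 : S.N) ≤ z + 1) (lt_pow2 _)

theorem div_unique {m w w' r r' : S.N} (hr : r < m) (hr' : r' < m) (h : w * m + r = w' * m + r') : w = w' := by
  have key : ∀ {w w' r r' : S.N}, r < m → w < w' → w * m + r < w' * m + r' := by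
    intro w w' r r' hr h
    calc w * m + r < w * m + m := by gcongr
      _ = (w + 1) * m := by ring
      _ ≤ w' * m := by gcongr; exact succ_le_iff.2 h
      _ ≤ _ := le_self_add
  rcases lt_trichotomy w w' with h1 | h1 | h1
  · exact ((key hr h1).ne h).elim
  · exact h1
  · exact ((key hr' h1).ne h.symm).elim

theorem exists_div {m : S.N} (hm : 0 < m) (z : S.N) : ∃ w r, r < m ∧ z = w * m + r := by
  apply ind (fun z => ∃ w r, r < m ∧ z = w * m + r)
  · exact ⟨0, 0, hm, by simp⟩
  · rintro _ ⟨w, r, hr, rfl⟩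
    rcases (succ_le_iff.2 hr).lt_or_eq with h | h
    · exact ⟨w, r + 1, h, by ring⟩
    · exact ⟨w + 1, 0, hm, by rw [add_assoc, h]; ring⟩

theorem even_or_odd' (w : S.N) : ∃ q, w = 2 * q ∨ w = 2 * q + 1 := by
  apply ind (fun w => ∃ q, w = 2 * q ∨ w = 2 * q + 1)
  · exact ⟨0, by simp⟩
  · rintro _ ⟨q, rfl | rfl⟩
    · exact ⟨q, .inr rfl⟩
    · exact ⟨q + 1, .inl (by ring)⟩

theorem even_ne_odd (q q' : S.N) : 2 * q ≠ 2 * q' + 1 := by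
  intro h
  have h1 : q * 2 + 0 = q' * 2 + 1 := by rw [add_zero, mul_comm, h, mul_comm]
  have h2 := div_unique (by simp) one_lt_two h1
  rw [h2] at h1
  exact zero_ne_one (add_left_cancel h1)

theorem inFin_iff {x z : S.N} : S.inFin x z ↔ ∃ q r, r < pow2 x ∧ z = (2 * q + 1) * pow2 x + r := by
  simp only [← std_two]; rfl

theorem pow2_le_of_inFin {x z : S.N} (h : S.inFin x z) : pow2 x ≤ z := by
  obtain ⟨q, r, -, rfl⟩ := inFin_iff.1 h
  exact (le_mul_of_one_le_left' le_add_self).trans le_self_add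

theorem lt_of_inFin {x z : S.N} (h : S.inFin x z) : x < z :=
  (lt_pow2 x).trans_le (pow2_le_of_inFin h)

theorem inFin_add_pow2 {b z : S.N} (hz : z < pow2 b) (x : S.N) :
    S.inFin x (z + pow2 b) ↔ S.inFin x z ∨ x = b := by
  rcases lt_trichotomy x b with h | rfl | h
  · have hb : ∃ c, pow2 b = 2 * c * pow2 x := by
      obtain ⟨c, rfl⟩ := lt_iff.1 h
      exact ⟨pow2 c, by rw [pow2_add, pow2_succ]; ring⟩
    obtain ⟨c, hc⟩ := hb
    simp only [h.ne, or_false]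
    constructor
    · intro h1
      obtain ⟨q, r, hr, hq⟩ := inFin_iff.1 h1
      obtain ⟨w, r', hr', rfl⟩ := exists_div (pow2_pos x) z
      obtain ⟨v, rfl | rfl⟩ := even_or_odd' w
      · refine (even_ne_odd (v + c) q (div_unique hr' hr ?_)).elim
        rw [← hq, hc]; ring
      · exact inFin_iff.2 ⟨v, r', hr', rfl⟩
    · intro h1
      obtain ⟨q, r, hr, rfl⟩ := inFin_iff.1 h1
      exact inFin_iff.2 ⟨q + c, r, hr, by rw [hc]; ring⟩
  · exact iff_of_true (inFin_iff.2 ⟨0, z, hz, by ring⟩) (.inr rfl)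
  · refine iff_of_false (fun h1 => ?_) (fun h1 => h1.elim (fun h1 => ?_) h.ne')
    · have h2 : z + pow2 b < pow2 x := by
        refine lt_of_lt_of_le ?_ (show pow2 (b + 1) ≤ pow2 x from ?_)
        · rw [pow2_succ, mul_two]; gcongr
        · rcases (succ_le_iff.2 h).eq_or_lt with h2 | h2
          · rw [h2]
          · exact (pow2_lt_pow2 h2).le
      exact absurd (pow2_le_of_inFin h1) h2.not_ge
    · exact absurd ((pow2_le_of_inFin h1).trans_lt hz) (pow2_lt_pow2 h).not_gt

/-- Bounded parts of arithmetic sets have binary codes. -/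
theorem exists_code (P : S.N → Prop) [Ar P] (b : S.N) :
    ∃ z, z < pow2 b ∧ ∀ x, S.inFin x z ↔ x < b ∧ P x := by
  have := isSet_setOf P
  apply ind (fun b => ∃ z, z < pow2 b ∧ ∀ x, S.inFin x z ↔ x < b ∧ x ∈ {x | P x})
  · refine ⟨0, pow2_pos 0, fun x => iff_of_false (fun h => Arith.not_lt_zero x (lt_of_inFin h)) ?_⟩
    exact fun h => Arith.not_lt_zero x h.1
  · rintro b ⟨z, hz, hb⟩
    by_cases h : P b
    · refine ⟨z + pow2 b, ?_, fun x => ?_⟩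
      · rw [pow2_succ, mul_two]; gcongr
      · rw [inFin_add_pow2 hz, hb, lt_succ_iff, le_iff_lt_or_eq]
        constructor
        · rintro (⟨h1, h2⟩ | rfl)
          · exact ⟨.inl h1, h2⟩
          · exact ⟨.inr rfl, h⟩
        · rintro ⟨h1 | rfl, h2⟩
          · exact .inl ⟨h1, h2⟩
          · exact .inr rfl
    · refine ⟨z, hz.trans ?_, fun x => ?_⟩
      · rw [pow2_succ]; exact lt_mul_of_one_lt_right (pow2_pos b) one_lt_two
      · rw [hb, lt_succ_iff, le_iff_lt_or_eq]
        refine and_congr_left fun h2 => ⟨.inl, fun h1 => h1.resolve_right ?_⟩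
        rintro rfl
        exact h h2

/-! ### Finite constructions -/

/-- Unfolding of a finite construction. The assumptions say that `step` is monotone and that it
requires only objects with smaller codes. -/
theorem built_iff {step : (S.N → Prop) → S.N → Prop}
    (hmono : ∀ R R' : S.N → Prop, ∀ y, (∀ a, a < y → R a → R' a) → step R y → step R' y)
    [hdef : Ar (S.Built step)] {x : S.N} : S.Built step x ↔ step (S.Built step) x := by
  have hsub : ∀ {z : S.N}, (∀ y, S.inFin y z → step (fun a => S.inFin a z) y) →
      ∀ y, S.inFin y z → S.Built step y := by
    intro z hz y hy
    obtain ⟨w, hw, hwz⟩ := exists_code (fun x => S.inFin x z) (y + 1)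
    refine ⟨w, hw, (hwz y).2 ⟨lt_succ_iff.2 le_rfl, hy⟩, fun a ha => ?_⟩
    obtain ⟨ha1, ha2⟩ := (hwz a).1 ha
    exact hmono _ _ a (fun b hb h => (hwz b).2 ⟨hb.trans ha1, h⟩) (hz a ha2)
  constructor
  · rintro ⟨z, hz, hx, h⟩
    exact hmono _ _ x (fun a _ ha => hsub h a ha) (h x hx)
  · intro h
    obtain ⟨w, hw, hwz⟩ := exists_code (fun y => S.Built step y ∨ y = x) (x + 1)
    have hxw : S.inFin x w := (hwz x).2 ⟨lt_succ_iff.2 le_rfl, .inr rfl⟩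
    refine ⟨w, hw, hxw, fun y hy => ?_⟩
    obtain ⟨h1, h2⟩ := (hwz y).1 hy
    rcases h2 with ⟨z, hz, hyz, h2⟩ | rfl
    · exact hmono _ _ y (fun a ha h3 => (hwz a).2 ⟨ha.trans h1, .inl (hsub h2 a h3)⟩) (h2 y hyz)
    · exact hmono _ _ y (fun a ha h3 => (hwz a).2 ⟨ha.trans h1, .inl h3⟩) h

end Struct
end SOA

namespace SOA
namespace Struct

/-! ### Coded terms and formulas -/

variable {S : Struct}

/-- The quantifier code for numbers (`true`) or for sets (`false`). -/
def cQ (S : Struct) (k : Bool) (i f : S.N) : S.N := if k then S.cAll i f else S.cAllS i f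

/-- The code of a number variable (`true`) or of a set variable (`false`). -/
def cV (S : Struct) (k : Bool) (i : S.N) : S.N := if k then S.cVar i else S.cSVar i

/-- The code of a number constant (`true`) or of a set constant (`false`). -/
def cC (S : Struct) (k : Bool) (n : S.N) : S.N := if k then S.cConst n else S.cSConst n

/-- Substitution in formulas for a number variable (`true`) or for a set variable (`false`). -/
def SB (S : Struct) (k : Bool) (i t f f' : S.N) : Prop := if k then S.Sub i t f f' else S.SubS i t f f'

/-- The effect on number terms of a substitution of kind `k`. -/
def TS (S : Struct) (k : Bool) (i t s s' : S.N) : Prop := if k then S.TmSub i t s s' else s' = s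

/-- The effect on set terms of a substitution of kind `k`. -/
def XS (S : Struct) (k : Bool) (i t X X' : S.N) : Prop :=
  if k then X' = X else (X = S.cSVar i ∧ X' = t) ∨ (X ≠ S.cSVar i ∧ X' = X)

/-- The effect on terms of kind `k` of a substitution of kind `k'`. -/
def AS (S : Struct) (k k' : Bool) (i t s s' : S.N) : Prop :=
  if k then S.TS k' i t s s' else S.XS k' i t s s'

/-- The variable of kind `k` and index `j` does not occur in the term `t` of the same kind. -/
def NO (S : Struct) (k : Bool) (j t : S.N) : Prop :=
  if k then S.TmSub j S.cZero t t else t ≠ S.cSVar j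

/-- Terms of the two kinds. -/
def IsArg (S : Struct) (k : Bool) (t : S.N) : Prop := if k then S.IsTm True t else S.IsSTm True t

/-- Closed terms without proper subterms. -/
def IsAtom (S : Struct) (s : S.N) : Prop := s = S.cZero ∨ s = S.cOne ∨ ∃ n, s = S.cConst n

/-- Closed terms of kind `k` without proper subterms. -/
def IsCst (S : Struct) (k : Bool) (s : S.N) : Prop := if k then S.IsAtom s else ∃ n, s = S.cSConst n

/-- Tags of the binary operations on terms. -/
def IsOp (o : ℕ) : Prop := o = 5 ∨ o = 6 ∨ o = 7

/-- Tags of the binary relations between terms. -/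
def IsRel (r : ℕ) : Prop := r = 10 ∨ r = 11

section
variable {K : Ctx} {t u v w : K.TmFun} [K.DefT t] [K.DefT u] [K.DefT v] [K.DefT w] (k k' : Bool)
instance defT_cQ : K.DefT fun i e E => (K.st i).cQ k (t i e E) (u i e E) := by
  cases k <;> simp only [cQ, reduceIte, Bool.false_eq_true] <;> infer_instance
instance defT_cC : K.DefT fun i e E => (K.st i).cC k (t i e E) := by
  cases k <;> simp only [cC, reduceIte, Bool.false_eq_true] <;> infer_instance
instance def_SB : K.Def fun i e E => (K.st i).SB k (t i e E) (u i e E) (v i e E) (w i e E) := by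
  cases k <;> simp only [SB, reduceIte, Bool.false_eq_true] <;> infer_instance
instance def_isArg : K.Def fun i e E => (K.st i).IsArg k (t i e E) := by
  cases k <;> simp only [IsArg, reduceIte, Bool.false_eq_true] <;> infer_instance
end

variable [hS : S.IsModel]

theorem isTm_iff {K : Prop} {x : S.N} : S.IsTm K x ↔ x = S.cZero ∨ x = S.cOne ∨ (∃ i, x = S.cVar i) ∨
    (K ∧ ∃ n, x = S.cConst n) ∨
    ∃ a b, S.IsTm K a ∧ S.IsTm K b ∧ (x = S.cAdd a b ∨ x = S.cMul a b ∨ x = S.cExp a b) := by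
  refine built_iff (hdef := (inferInstance : Ar (S.IsTm K))) fun R R' y hR => ?_
  refine Or.imp_right (Or.imp_right (Or.imp_right (Or.imp_right ?_)))
  rintro ⟨a, b, ha, hb, h⟩
  refine ⟨a, b, hR _ ?_ ha, hR _ ?_ hb, h⟩
  · rcases h with rfl | rfl | rfl <;> exact lt_tag_left (by decide) _ _
  · rcases h with rfl | rfl | rfl <;> exact lt_tag_right (by decide) _ _

theorem isTm_op {K : Prop} {o : ℕ} (ho : IsOp o) {a b : S.N} :
    S.IsTm K (S.tag o a b) ↔ S.IsTm K a ∧ S.IsTm K b := by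
  rw [isTm_iff]
  rcases ho with rfl | rfl | rfl <;>
  simp [cZero, cOne, cVar, cConst, cAdd, cMul, cExp, tag_inj]

theorem tm_ind {K : Prop} (P : S.N → Prop) [Ar P] (atom : ∀ s, S.IsAtom s → P s)
    (var : ∀ i, P (S.cVar i))
    (op : ∀ o, IsOp o → ∀ a b, S.IsTm K a → S.IsTm K b → P a → P b → P (S.tag o a b))
    {x : S.N} (hx : S.IsTm K x) : P x := by
  revert hx
  refine strong_ind (fun x => S.IsTm K x → P x) (fun x ih hx => ?_) x
  rcases isTm_iff.1 hx with rfl | rfl | ⟨i, rfl⟩ | ⟨-, n, rfl⟩ | ⟨a, b, ha, hb, h⟩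
  · exact atom _ (.inl rfl)
  · exact atom _ (.inr (.inl rfl))
  · exact var i
  · exact atom _ (.inr (.inr ⟨n, rfl⟩))
  · have : ∃ o, IsOp o ∧ x = S.tag o a b := by
      rcases h with rfl | rfl | rfl
      · exact ⟨5, .inl rfl, rfl⟩
      · exact ⟨6, .inr (.inl rfl), rfl⟩
      · exact ⟨7, .inr (.inr rfl), rfl⟩
    obtain ⟨o, ho, rfl⟩ := this
    have h0 : 0 < o := by rcases ho with rfl | rfl | rfl <;> decide
    exact op o ho a b ha hb (ih a (lt_tag_left h0 _ _) ha) (ih b (lt_tag_right h0 _ _) hb)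

theorem tmSub_iff {i t s s' : S.N} : S.TmSub i t s s' ↔ ∃ a a', S.pair s s' = S.pair a a' ∧
    ((a = S.cVar i ∧ a' = t) ∨
     (∃ j, j ≠ i ∧ a = S.cVar j ∧ a' = a) ∨
     ((a = S.cZero ∨ a = S.cOne ∨ ∃ n, a = S.cConst n) ∧ a' = a) ∨
     (∃ b b' c c', S.TmSub i t b b' ∧ S.TmSub i t c c' ∧
       ((a = S.cAdd b c ∧ a' = S.cAdd b' c') ∨ (a = S.cMul b c ∧ a' = S.cMul b' c') ∨
        (a = S.cExp b c ∧ a' = S.cExp b' c')))) := by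
  refine built_iff (hdef := by unfold Built; infer_instance) ?_
  rintro R R' y hR ⟨a, a', rfl, h⟩
  refine ⟨a, a', rfl, h.imp_right (Or.imp_right (Or.imp_right ?_))⟩
  rintro ⟨b, b', c, c', hb, hc, h⟩
  refine ⟨b, b', c, c', hR _ ?_ hb, hR _ ?_ hc, h⟩
  · rcases h with ⟨rfl, rfl⟩ | ⟨rfl, rfl⟩ | ⟨rfl, rfl⟩ <;>
    exact pair_lt_pair (lt_tag_left (by decide) _ _) (lt_tag_left (by decide) _ _).le
  · rcases h with ⟨rfl, rfl⟩ | ⟨rfl, rfl⟩ | ⟨rfl, rfl⟩ <;>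
    exact pair_lt_pair (lt_tag_right (by decide) _ _) (lt_tag_right (by decide) _ _).le

theorem tmSub_atom {i t s s' : S.N} (hs : S.IsAtom s) : S.TmSub i t s s' ↔ s' = s := by
  rw [tmSub_iff]
  rcases hs with rfl | rfl | ⟨n, rfl⟩ <;>
  simp [cZero, cOne, cVar, cConst, cAdd, cMul, cExp, tag_inj, pair_inj]

theorem tmSub_var_self {i t s' : S.N} : S.TmSub i t (S.cVar i) s' ↔ s' = t := by
  rw [tmSub_iff]
  simp [cZero, cOne, cVar, cConst, cAdd, cMul, cExp, tag_inj, pair_inj]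

theorem tmSub_var_ne {i j t s' : S.N} (h : j ≠ i) : S.TmSub i t (S.cVar j) s' ↔ s' = S.cVar j := by
  rw [tmSub_iff]
  simp [cZero, cOne, cVar, cConst, cAdd, cMul, cExp, tag_inj, pair_inj, h]

theorem tmSub_op {o : ℕ} (ho : IsOp o) {i t a b s' : S.N} : S.TmSub i t (S.tag o a b) s' ↔
    ∃ a' b', S.TmSub i t a a' ∧ S.TmSub i t b b' ∧ s' = S.tag o a' b' := by
  rw [tmSub_iff]
  rcases ho with rfl | rfl | rfl <;>
  simp [cZero, cOne, cVar, cConst, cAdd, cMul, cExp, tag_inj, pair_inj]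

end Struct
end SOA

namespace SOA
namespace Struct

variable {S : Struct} [hS : S.IsModel]

theorem isFml_iff {K : Prop} {x : S.N} : S.IsFml K x ↔
    (∃ s t, S.IsTm K s ∧ S.IsTm K t ∧ (x = S.cEq s t ∨ x = S.cLt s t)) ∨
    (∃ t X, S.IsTm K t ∧ S.IsSTm K X ∧ x = S.cMem t X) ∨
    (∃ t, S.IsTm K t ∧ x = S.cOracle t) ∨
    (∃ a, S.IsFml K a ∧ x = S.cNeg a) ∨
    (∃ a b, S.IsFml K a ∧ S.IsFml K b ∧ x = S.cAnd a b) ∨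
    (∃ i a, S.IsFml K a ∧ (x = S.cAll i a ∨ x = S.cAllS i a)) := by
  refine built_iff (hdef := (inferInstance : Ar (S.IsFml K))) fun R R' y hR => ?_
  refine Or.imp_right (Or.imp_right (Or.imp_right (Or.imp ?_ (Or.imp ?_ ?_))))
  · rintro ⟨a, ha, rfl⟩
    exact ⟨a, hR _ (lt_tag_left (by decide) _ _) ha, rfl⟩
  · rintro ⟨a, b, ha, hb, rfl⟩
    exact ⟨a, b, hR _ (lt_tag_left (by decide) _ _) ha, hR _ (lt_tag_right (by decide) _ _) hb, rfl⟩
  · rintro ⟨i, a, ha, h⟩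
    refine ⟨i, a, hR _ ?_ ha, h⟩
    rcases h with rfl | rfl <;> exact lt_tag_right (by decide) _ _

theorem isFml_rel {K : Prop} {r : ℕ} (hr : IsRel r) {s t : S.N} :
    S.IsFml K (S.tag r s t) ↔ S.IsTm K s ∧ S.IsTm K t := by
  rw [isFml_iff]
  rcases hr with rfl | rfl <;>
  simp [cEq, cLt, cMem, cOracle, cNeg, cAnd, cAll, cAllS, tag_inj]

theorem isFml_mem {K : Prop} {t X : S.N} : S.IsFml K (S.cMem t X) ↔ S.IsTm K t ∧ S.IsSTm K X := by
  rw [isFml_iff]; simp [cEq, cLt, cMem, cOracle, cNeg, cAnd, cAll, cAllS, tag_inj]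

theorem isFml_oracle {K : Prop} {t : S.N} : S.IsFml K (S.cOracle t) ↔ S.IsTm K t := by
  rw [isFml_iff]; simp [cEq, cLt, cMem, cOracle, cNeg, cAnd, cAll, cAllS, tag_inj]

theorem isFml_neg {K : Prop} {a : S.N} : S.IsFml K (S.cNeg a) ↔ S.IsFml K a := by
  rw [isFml_iff]; simp [cEq, cLt, cMem, cOracle, cNeg, cAnd, cAll, cAllS, tag_inj]

theorem isFml_and {K : Prop} {a b : S.N} : S.IsFml K (S.cAnd a b) ↔ S.IsFml K a ∧ S.IsFml K b := by
  rw [isFml_iff]; simp [cEq, cLt, cMem, cOracle, cNeg, cAnd, cAll, cAllS, tag_inj]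

theorem isFml_q {K : Prop} {k : Bool} {i a : S.N} : S.IsFml K (S.cQ k i a) ↔ S.IsFml K a := by
  rw [isFml_iff]
  cases k <;> simp [cQ, cEq, cLt, cMem, cOracle, cNeg, cAnd, cAll, cAllS, tag_inj]

theorem isFml_imp {K : Prop} {a b : S.N} : S.IsFml K (S.cImp a b) ↔ S.IsFml K a ∧ S.IsFml K b := by
  rw [cImp, isFml_neg, isFml_and, isFml_neg]

theorem lt_cQ (k : Bool) (i a : S.N) : a < S.cQ k i a := by
  cases k <;> exact lt_tag_right (by decide) _ _

theorem index_lt_cQ (k : Bool) (i a : S.N) : i < S.cQ k i a := by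
  cases k <;> exact lt_tag_left (by decide) _ _

theorem lt_cNeg (a : S.N) : a < S.cNeg a := lt_tag_left (by decide) _ _
theorem lt_cAnd_left (a b : S.N) : a < S.cAnd a b := lt_tag_left (by decide) _ _
theorem lt_cAnd_right (a b : S.N) : b < S.cAnd a b := lt_tag_right (by decide) _ _

theorem fml_ind {K : Prop} (P : S.N → Prop) [Ar P]
    (rel : ∀ r, IsRel r → ∀ s t, S.IsTm K s → S.IsTm K t → P (S.tag r s t))
    (mem : ∀ t X, S.IsTm K t → S.IsSTm K X → P (S.cMem t X))
    (oracle : ∀ t, S.IsTm K t → P (S.cOracle t))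
    (neg : ∀ a, S.IsFml K a → P a → P (S.cNeg a))
    (and : ∀ a b, S.IsFml K a → S.IsFml K b → P a → P b → P (S.cAnd a b))
    (q : ∀ k i a, S.IsFml K a → P a → P (S.cQ k i a))
    {x : S.N} (hx : S.IsFml K x) : P x := by
  revert hx
  refine strong_ind (fun x => S.IsFml K x → P x) (fun x ih hx => ?_) x
  rcases isFml_iff.1 hx with ⟨s, t, hs, ht, rfl | rfl⟩ | ⟨t, X, ht, hX, rfl⟩ | ⟨t, ht, rfl⟩ |
    ⟨a, ha, rfl⟩ | ⟨a, b, ha, hb, rfl⟩ | ⟨i, a, ha, rfl | rfl⟩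
  · exact rel 10 (.inl rfl) s t hs ht
  · exact rel 11 (.inr rfl) s t hs ht
  · exact mem t X ht hX
  · exact oracle t ht
  · exact neg a ha (ih a (lt_cNeg a) ha)
  · exact and a b ha hb (ih a (lt_cAnd_left a b) ha) (ih b (lt_cAnd_right a b) hb)
  · exact q true i a ha (ih a (lt_cQ true i a) ha)
  · exact q false i a ha (ih a (lt_cQ false i a) ha)

theorem sub_iff {i t f f' : S.N} : S.Sub i t f f' ↔ ∃ a a', S.pair f f' = S.pair a a' ∧
    ((∃ s s' u u', S.TmSub i t s s' ∧ S.TmSub i t u u' ∧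
       ((a = S.cEq s u ∧ a' = S.cEq s' u') ∨ (a = S.cLt s u ∧ a' = S.cLt s' u'))) ∨
     (∃ s s' X, S.TmSub i t s s' ∧ a = S.cMem s X ∧ a' = S.cMem s' X) ∨
     (∃ s s', S.TmSub i t s s' ∧ a = S.cOracle s ∧ a' = S.cOracle s') ∨
     (∃ b b', S.Sub i t b b' ∧ a = S.cNeg b ∧ a' = S.cNeg b') ∨
     (∃ b b' c c', S.Sub i t b b' ∧ S.Sub i t c c' ∧ a = S.cAnd b c ∧ a' = S.cAnd b' c') ∨
     (∃ b, a = S.cAll i b ∧ a' = a) ∨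
     (∃ j b b', j ≠ i ∧ S.Sub i t b b' ∧ a = S.cAll j b ∧ a' = S.cAll j b' ∧
       (b' = b ∨ S.TmSub j S.cZero t t)) ∨
     (∃ j b b', S.Sub i t b b' ∧ a = S.cAllS j b ∧ a' = S.cAllS j b')) := by
  refine built_iff (hdef := by unfold Built; infer_instance) ?_
  rintro R R' y hR ⟨a, a', rfl, h⟩
  refine ⟨a, a', rfl, h.imp_right (Or.imp_right (Or.imp_right (Or.imp ?_ (Or.imp ?_
    (Or.imp_right (Or.imp ?_ ?_))))))⟩
  · rintro ⟨b, b', hb, rfl, rfl⟩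
    exact ⟨b, b', hR _ (pair_lt_pair (lt_tag_left (by decide) _ _) (lt_tag_left (by decide) _ _).le) hb,
      rfl, rfl⟩
  · rintro ⟨b, b', c, c', hb, hc, rfl, rfl⟩
    exact ⟨b, b', c, c',
      hR _ (pair_lt_pair (lt_tag_left (by decide) _ _) (lt_tag_left (by decide) _ _).le) hb,
      hR _ (pair_lt_pair (lt_tag_right (by decide) _ _) (lt_tag_right (by decide) _ _).le) hc, rfl, rfl⟩
  · rintro ⟨j, b, b', hj, hb, rfl, rfl, h'⟩
    exact ⟨j, b, b', hj,
      hR _ (pair_lt_pair (lt_tag_right (by decide) _ _) (lt_tag_right (by decide) _ _).le) hb, rfl, rfl, h'⟩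
  · rintro ⟨j, b, b', hb, rfl, rfl⟩
    exact ⟨j, b, b',
      hR _ (pair_lt_pair (lt_tag_right (by decide) _ _) (lt_tag_right (by decide) _ _).le) hb, rfl, rfl⟩

theorem subS_iff {i T f f' : S.N} : S.SubS i T f f' ↔ ∃ a a', S.pair f f' = S.pair a a' ∧
    ((∃ s u, (a = S.cEq s u ∨ a = S.cLt s u ∨ a = S.cOracle s) ∧ a' = a) ∨
     (∃ s, a = S.cMem s (S.cSVar i) ∧ a' = S.cMem s T) ∨
     (∃ s X, X ≠ S.cSVar i ∧ a = S.cMem s X ∧ a' = a) ∨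
     (∃ b b', S.SubS i T b b' ∧ a = S.cNeg b ∧ a' = S.cNeg b') ∨
     (∃ b b' c c', S.SubS i T b b' ∧ S.SubS i T c c' ∧ a = S.cAnd b c ∧ a' = S.cAnd b' c') ∨
     (∃ j b b', S.SubS i T b b' ∧ a = S.cAll j b ∧ a' = S.cAll j b') ∨
     (∃ b, a = S.cAllS i b ∧ a' = a) ∨
     (∃ j b b', j ≠ i ∧ S.SubS i T b b' ∧ a = S.cAllS j b ∧ a' = S.cAllS j b' ∧
       (b' = b ∨ T ≠ S.cSVar j))) := by
  refine built_iff (hdef := by unfold Built; infer_instance) ?_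
  rintro R R' y hR ⟨a, a', rfl, h⟩
  refine ⟨a, a', rfl, h.imp_right (Or.imp_right (Or.imp_right (Or.imp ?_ (Or.imp ?_
    (Or.imp ?_ (Or.imp_right ?_))))))⟩
  · rintro ⟨b, b', hb, rfl, rfl⟩
    exact ⟨b, b', hR _ (pair_lt_pair (lt_tag_left (by decide) _ _) (lt_tag_left (by decide) _ _).le) hb,
      rfl, rfl⟩
  · rintro ⟨b, b', c, c', hb, hc, rfl, rfl⟩
    exact ⟨b, b', c, c',
      hR _ (pair_lt_pair (lt_tag_left (by decide) _ _) (lt_tag_left (by decide) _ _).le) hb,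
      hR _ (pair_lt_pair (lt_tag_right (by decide) _ _) (lt_tag_right (by decide) _ _).le) hc, rfl, rfl⟩
  · rintro ⟨j, b, b', hb, rfl, rfl⟩
    exact ⟨j, b, b',
      hR _ (pair_lt_pair (lt_tag_right (by decide) _ _) (lt_tag_right (by decide) _ _).le) hb, rfl, rfl⟩
  · rintro ⟨j, b, b', hj, hb, rfl, rfl, h'⟩
    exact ⟨j, b, b', hj,
      hR _ (pair_lt_pair (lt_tag_right (by decide) _ _) (lt_tag_right (by decide) _ _).le) hb, rfl, rfl, h'⟩

/-! #### Substitution at the outermost symbol of a formula -/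

theorem sb_rel {k : Bool} {r : ℕ} (hr : IsRel r) {i t s u f' : S.N} :
    S.SB k i t (S.tag r s u) f' ↔ ∃ s' u', S.TS k i t s s' ∧ S.TS k i t u u' ∧ f' = S.tag r s' u' := by
  cases k
  · simp only [SB, TS, reduceIte, Bool.false_eq_true]; rw [subS_iff]
    rcases hr with rfl | rfl <;>
    simp [cEq, cLt, cMem, cOracle, cNeg, cAnd, cAll, cAllS, tag_inj, pair_inj]
  · simp only [SB, TS, reduceIte]; rw [sub_iff]
    rcases hr with rfl | rfl <;>
    simp [cEq, cLt, cMem, cOracle, cNeg, cAnd, cAll, cAllS, tag_inj, pair_inj]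

theorem sb_mem {k : Bool} {i t s X f' : S.N} : S.SB k i t (S.cMem s X) f' ↔
    ∃ s' X', S.TS k i t s s' ∧ S.XS k i t X X' ∧ f' = S.cMem s' X' := by
  cases k
  · simp only [SB, TS, XS, reduceIte, Bool.false_eq_true]; rw [subS_iff]
    simp [cEq, cLt, cMem, cOracle, cNeg, cAnd, cAll, cAllS, tag_inj, pair_inj]
    constructor
    · rintro (⟨rfl, rfl⟩ | ⟨h, rfl⟩)
      · exact ⟨_, .inl ⟨rfl, rfl⟩, rfl⟩
      · exact ⟨_, .inr ⟨h, rfl⟩, rfl⟩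
    · rintro ⟨X', ⟨rfl, rfl⟩ | ⟨h, rfl⟩, rfl⟩
      · exact .inl ⟨rfl, rfl⟩
      · exact .inr ⟨h, rfl⟩
  · simp only [SB, TS, XS, reduceIte]; rw [sub_iff]
    simp [cEq, cLt, cMem, cOracle, cNeg, cAnd, cAll, cAllS, tag_inj, pair_inj]

theorem sb_oracle {k : Bool} {i t s f' : S.N} : S.SB k i t (S.cOracle s) f' ↔
    ∃ s', S.TS k i t s s' ∧ f' = S.cOracle s' := by
  cases k
  · simp only [SB, TS, reduceIte, Bool.false_eq_true]; rw [subS_iff]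
    simp [cEq, cLt, cMem, cOracle, cNeg, cAnd, cAll, cAllS, tag_inj, pair_inj]
  · simp only [SB, TS, reduceIte]; rw [sub_iff]
    simp [cEq, cLt, cMem, cOracle, cNeg, cAnd, cAll, cAllS, tag_inj, pair_inj]

theorem sb_neg {k : Bool} {i t a f' : S.N} : S.SB k i t (S.cNeg a) f' ↔
    ∃ a', S.SB k i t a a' ∧ f' = S.cNeg a' := by
  cases k
  · simp only [SB, reduceIte, Bool.false_eq_true]; rw [subS_iff]
    simp [cEq, cLt, cMem, cOracle, cNeg, cAnd, cAll, cAllS, tag_inj, pair_inj]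
  · simp only [SB, reduceIte]; rw [sub_iff]
    simp [cEq, cLt, cMem, cOracle, cNeg, cAnd, cAll, cAllS, tag_inj, pair_inj]

theorem sb_and {k : Bool} {i t a b f' : S.N} : S.SB k i t (S.cAnd a b) f' ↔
    ∃ a' b', S.SB k i t a a' ∧ S.SB k i t b b' ∧ f' = S.cAnd a' b' := by
  cases k
  · simp only [SB, reduceIte, Bool.false_eq_true]; rw [subS_iff]
    simp [cEq, cLt, cMem, cOracle, cNeg, cAnd, cAll, cAllS, tag_inj, pair_inj]
  · simp only [SB, reduceIte]; rw [sub_iff]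
    simp [cEq, cLt, cMem, cOracle, cNeg, cAnd, cAll, cAllS, tag_inj, pair_inj]

theorem sb_imp {k : Bool} {i t a b f' : S.N} : S.SB k i t (S.cImp a b) f' ↔
    ∃ a' b', S.SB k i t a a' ∧ S.SB k i t b b' ∧ f' = S.cImp a' b' := by
  simp only [cImp, sb_neg, sb_and]
  constructor
  · rintro ⟨_, ⟨a', _, ha, ⟨b', hb, rfl⟩, rfl⟩, rfl⟩; exact ⟨a', b', ha, hb, rfl⟩
  · rintro ⟨a', b', ha, hb, rfl⟩; exact ⟨_, ⟨a', _, ha, ⟨b', hb, rfl⟩, rfl⟩, rfl⟩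

theorem sb_q {k k' : Bool} {i t j b f' : S.N} : S.SB k i t (S.cQ k' j b) f' ↔
    ((k' = k ∧ j = i) ∧ f' = S.cQ k' j b) ∨ (¬ (k' = k ∧ j = i) ∧ ∃ b', S.SB k i t b b' ∧
      f' = S.cQ k' j b' ∧ (k' = k → b' = b ∨ S.NO k j t)) := by
  cases k
  · simp only [SB, NO, reduceIte, Bool.false_eq_true]; rw [subS_iff]
    cases k'
    · simp [cQ, cEq, cLt, cMem, cOracle, cNeg, cAnd, cAll, cAllS, tag_inj, pair_inj]
    · simp [cQ, cEq, cLt, cMem, cOracle, cNeg, cAnd, cAll, cAllS, tag_inj, pair_inj]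
  · simp only [SB, NO, reduceIte]; rw [sub_iff]
    cases k'
    · simp [cQ, cEq, cLt, cMem, cOracle, cNeg, cAnd, cAll, cAllS, tag_inj, pair_inj]
    · simp [cQ, cEq, cLt, cMem, cOracle, cNeg, cAnd, cAll, cAllS, tag_inj, pair_inj]

end Struct
end SOA

namespace SOA
namespace Struct

variable {S : Struct}

theorem isAtom_zero : S.IsAtom S.cZero := .inl rfl
theorem isAtom_const (n : S.N) : S.IsAtom (S.cConst n) := .inr (.inr ⟨n, rfl⟩)

theorem isSTm_const (n : S.N) : S.IsSTm True (S.cSConst n) := .inr ⟨trivial, n, rfl⟩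

theorem isCst_cC (k : Bool) (n : S.N) : S.IsCst k (S.cC k n) := by
  cases k
  · exact ⟨n, rfl⟩
  · exact isAtom_const n

variable [hS : S.IsModel]

/-! ### Substitution in terms -/

theorem isAtom_ne_var {c i : S.N} (hc : S.IsAtom c) : c ≠ S.cVar i := by
  rcases hc with rfl | rfl | ⟨n, rfl⟩ <;> simp [cZero, cOne, cConst, cVar, tag_inj]

theorem isTm_atom {c : S.N} (hc : S.IsAtom c) : S.IsTm True c :=
  isTm_iff.2 (hc.imp_right (Or.imp_right fun h => .inr (.inl ⟨trivial, h⟩)))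

theorem isTm_var {K : Prop} (i : S.N) : S.IsTm K (S.cVar i) := isTm_iff.2 (.inr (.inr (.inl ⟨i, rfl⟩)))

theorem cSVar_inj {i j : S.N} : S.cSVar i = S.cSVar j ↔ i = j := by simp [cSVar, tag_inj]

theorem tmSub_func {i t s s' s'' : S.N} (hs : S.IsTm True s) (h : S.TmSub i t s s') (h' : S.TmSub i t s s'') :
    s' = s'' := by
  refine tm_ind (fun s => ∀ s', S.TmSub i t s s' → ∀ s'', S.TmSub i t s s'' → s' = s'')
    ?_ ?_ ?_ hs _ h _ h'
  · intro s hs s' h s'' h'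
    rw [tmSub_atom hs] at h h'; rw [h, h']
  · intro j s' h s'' h'
    by_cases hj : j = i
    · subst hj; rw [tmSub_var_self] at h h'; rw [h, h']
    · rw [tmSub_var_ne hj] at h h'; rw [h, h']
  · intro o ho a b _ _ iha ihb s' h s'' h'
    rw [tmSub_op ho] at h h'
    obtain ⟨a', b', ha, hb, rfl⟩ := h
    obtain ⟨a'', b'', ha', hb', rfl⟩ := h'
    rw [iha _ ha _ ha', ihb _ hb _ hb']

theorem tmSub_total {i t s : S.N} (hs : S.IsTm True s) (ht : S.IsTm True t) :
    ∃ s', S.TmSub i t s s' ∧ S.IsTm True s' := by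
  refine tm_ind (fun s => ∃ s', S.TmSub i t s s' ∧ S.IsTm True s') ?_ ?_ ?_ hs
  · exact fun s hs => ⟨s, (tmSub_atom hs).2 rfl, isTm_atom hs⟩
  · intro j
    by_cases hj : j = i
    · subst hj; exact ⟨t, tmSub_var_self.2 rfl, ht⟩
    · exact ⟨_, (tmSub_var_ne hj).2 rfl, isTm_var j⟩
  · rintro o ho a b _ _ ⟨a', ha, ha'⟩ ⟨b', hb, hb'⟩
    exact ⟨_, (tmSub_op ho).2 ⟨a', b', ha, hb, rfl⟩, (isTm_op ho).2 ⟨ha', hb'⟩⟩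

theorem tmSub_comm {i j c t t' s a b : S.N} (hij : i ≠ j) (hc : S.IsAtom c) (hs : S.IsTm True s)
    (ht : S.TmSub j c t t') (h1 : S.TmSub i t s a) (h2 : S.TmSub j c s b) :
    ∃ d, S.TmSub j c a d ∧ S.TmSub i t' b d := by
  refine tm_ind (fun s => ∀ a, S.TmSub i t s a → ∀ b, S.TmSub j c s b →
    ∃ d, S.TmSub j c a d ∧ S.TmSub i t' b d) ?_ ?_ ?_ hs _ h1 _ h2
  · intro s hs a h1 b h2
    rw [tmSub_atom hs] at h1 h2
    subst h1 h2
    exact ⟨_, (tmSub_atom hs).2 rfl, (tmSub_atom hs).2 rfl⟩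
  · intro l a h1 b h2
    by_cases hl : l = i
    · subst hl
      rw [tmSub_var_self] at h1
      rw [tmSub_var_ne hij] at h2
      subst h1 h2
      exact ⟨t', ht, tmSub_var_self.2 rfl⟩
    · rw [tmSub_var_ne hl] at h1
      subst h1
      refine ⟨b, h2, ?_⟩
      by_cases hl' : l = j
      · subst hl'
        rw [tmSub_var_self] at h2
        subst h2
        exact (tmSub_atom hc).2 rfl
      · rw [tmSub_var_ne hl'] at h2
        subst h2
        exact (tmSub_var_ne hl).2 rfl
  · intro o ho a b _ _ iha ihb f h1 g h2
    rw [tmSub_op ho] at h1 h2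
    obtain ⟨a1, b1, ha1, hb1, rfl⟩ := h1
    obtain ⟨a2, b2, ha2, hb2, rfl⟩ := h2
    obtain ⟨d, hd, hd'⟩ := iha _ ha1 _ ha2
    obtain ⟨e, he, he'⟩ := ihb _ hb1 _ hb2
    exact ⟨_, (tmSub_op ho).2 ⟨d, e, hd, he, rfl⟩, (tmSub_op ho).2 ⟨d, e, hd', he', rfl⟩⟩

theorem tmSub_comp {i c t t' s a b : S.N} (hs : S.IsTm True s) (ht0 : S.IsTm True t)
    (ht : S.TmSub i c t t') (h1 : S.TmSub i t s a) (h2 : S.TmSub i c a b) : S.TmSub i t' s b := by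
  refine tm_ind (fun s => ∀ a, S.TmSub i t s a → ∀ b, S.TmSub i c a b → S.TmSub i t' s b)
    ?_ ?_ ?_ hs _ h1 _ h2
  · intro s hs a h1 b h2
    rw [tmSub_atom hs] at h1
    subst h1
    rwa [tmSub_atom hs] at h2 ⊢
  · intro l a h1 b h2
    by_cases hl : l = i
    · subst hl
      rw [tmSub_var_self] at h1
      subst h1
      rw [tmSub_var_self, tmSub_func ht0 h2 ht]
    · rw [tmSub_var_ne hl] at h1
      subst h1
      rwa [tmSub_var_ne hl] at h2 ⊢
  · intro o ho a b _ _ iha ihb f h1 g h2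
    obtain ⟨a1, b1, ha1, hb1, rfl⟩ := (tmSub_op ho).1 h1
    obtain ⟨a2, b2, ha2, hb2, rfl⟩ := (tmSub_op ho).1 h2
    exact (tmSub_op ho).2 ⟨a2, b2, iha _ ha1 _ ha2, ihb _ hb1 _ hb2, rfl⟩

theorem tmSub_fix {i t s : S.N} (hs : S.IsTm True s) (h : S.TmSub i t s s) (ht : t ≠ S.cVar i) (t' : S.N) :
    S.TmSub i t' s s := by
  revert h
  refine tm_ind (fun s => S.TmSub i t s s → S.TmSub i t' s s) ?_ ?_ ?_ hs
  · exact fun s hs _ => (tmSub_atom hs).2 rfl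
  · intro j h
    by_cases hj : j = i
    · subst hj; rw [tmSub_var_self] at h; exact (ht h.symm).elim
    · exact (tmSub_var_ne hj).2 rfl
  · intro o ho a b _ _ iha ihb h
    obtain ⟨a', b', ha, hb, h'⟩ := (tmSub_op ho).1 h
    obtain ⟨-, rfl, rfl⟩ := tag_inj.1 h'
    exact (tmSub_op ho).2 ⟨a, b, iha ha, ihb hb, rfl⟩

theorem tmSub_fresh {i s : S.N} (hs : S.IsTm True s) (hi : s ≤ i) (t : S.N) : S.TmSub i t s s := by
  revert hi
  refine tm_ind (fun s => s ≤ i → S.TmSub i t s s) ?_ ?_ ?_ hs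
  · exact fun s hs _ => (tmSub_atom hs).2 rfl
  · intro j h
    exact (tmSub_var_ne ((lt_tag_left (by decide) _ _).trans_le h).ne).2 rfl
  · intro o ho a b _ _ iha ihb h
    have h0 : 0 < o := by rcases ho with rfl | rfl | rfl <;> decide
    exact (tmSub_op ho).2 ⟨a, b, iha ((lt_tag_left h0 _ _).le.trans h),
      ihb ((lt_tag_right h0 _ _).le.trans h), rfl⟩

theorem tmSub_ident {i s : S.N} (hs : S.IsTm True s) : S.TmSub i (S.cVar i) s s := by
  refine tm_ind (fun s => S.TmSub i (S.cVar i) s s) ?_ ?_ ?_ hs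
  · exact fun s hs => (tmSub_atom hs).2 rfl
  · intro j
    by_cases hj : j = i
    · subst hj; exact tmSub_var_self.2 rfl
    · exact (tmSub_var_ne hj).2 rfl
  · exact fun o ho a b _ _ iha ihb => (tmSub_op ho).2 ⟨a, b, iha, ihb, rfl⟩

/-! #### The two kinds of substitution -/

theorem cSConst_ne {n i : S.N} : S.cSConst n ≠ S.cSVar i := by simp [cSConst, cSVar, tag_inj]

theorem IsCst.isArg {k : Bool} {c : S.N} (hc : S.IsCst k c) : S.IsArg k c := by
  cases k
  · obtain ⟨n, rfl⟩ := hc; exact isSTm_const n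
  · exact isTm_atom hc

theorem IsCst.no {k : Bool} {c : S.N} (hc : S.IsCst k c) (j : S.N) : S.NO k j c := by
  cases k
  · obtain ⟨n, rfl⟩ := hc; exact cSConst_ne
  · exact (tmSub_atom hc).2 rfl

theorem as_func {k k' : Bool} {i t s s' s'' : S.N} (hs : S.IsArg k s) (h : S.AS k k' i t s s')
    (h' : S.AS k k' i t s s'') : s' = s'' := by
  cases k <;> cases k' <;> simp only [AS, TS, XS, IsArg, reduceIte, Bool.false_eq_true] at *
  · rcases h with ⟨rfl, rfl⟩ | ⟨h, rfl⟩ <;> rcases h' with ⟨h', rfl⟩ | ⟨h', rfl⟩ <;> simp_all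
  · rw [h, h']
  · rw [h, h']
  · exact tmSub_func hs h h'

theorem as_total {k k' : Bool} {i t s : S.N} (hs : S.IsArg k s) (ht : S.IsArg k' t) :
    ∃ s', S.AS k k' i t s s' ∧ S.IsArg k s' := by
  cases k <;> cases k' <;> simp only [AS, TS, XS, IsArg, reduceIte, Bool.false_eq_true] at *
  · by_cases h : s = S.cSVar i
    · exact ⟨t, .inl ⟨h, rfl⟩, ht⟩
    · exact ⟨s, .inr ⟨h, rfl⟩, hs⟩
  · exact ⟨s, rfl, hs⟩
  · exact ⟨s, rfl, hs⟩
  · exact tmSub_total hs ht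

theorem as_comm {k k1 k2 : Bool} {i j c t t' s a b : S.N} (hij : ¬ (k1 = k2 ∧ i = j)) (hc : S.IsCst k2 c)
    (hs : S.IsArg k s) (ht : S.AS k1 k2 j c t t') (h1 : S.AS k k1 i t s a) (h2 : S.AS k k2 j c s b) :
    ∃ d, S.AS k k2 j c a d ∧ S.AS k k1 i t' b d := by
  cases k <;> cases k1 <;> cases k2 <;>
    simp only [AS, TS, XS, IsArg, IsCst, reduceIte, Bool.false_eq_true] at *
  · simp only [true_and] at hij
    obtain ⟨n, rfl⟩ := hc
    have := @cSConst_ne S _ n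
    rcases h1 with ⟨rfl, rfl⟩ | ⟨h1, rfl⟩
    · rcases h2 with ⟨h2, rfl⟩ | ⟨h2, rfl⟩
      · exact (hij (cSVar_inj.1 h2)).elim
      · exact ⟨t', ht, .inl ⟨rfl, rfl⟩⟩
    · rcases h2 with ⟨rfl, rfl⟩ | ⟨h2, rfl⟩
      · exact ⟨_, .inl ⟨rfl, rfl⟩, .inr ⟨this, rfl⟩⟩
      · exact ⟨_, .inr ⟨h2, rfl⟩, .inr ⟨h1, rfl⟩⟩
  · subst h2 ht; exact ⟨a, rfl, h1⟩
  · subst h1; exact ⟨b, h2, rfl⟩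
  · subst h1 h2; exact ⟨_, rfl, rfl⟩
  · subst h1 h2; exact ⟨_, rfl, rfl⟩
  · subst h1; exact ⟨b, h2, rfl⟩
  · subst h2 ht; exact ⟨a, rfl, h1⟩
  · exact tmSub_comm (fun h => hij ⟨trivial, h⟩) hc hs ht h1 h2

theorem as_comp {k k1 : Bool} {i c t t' s a b : S.N} (hs : S.IsArg k s) (ht0 : S.IsArg k1 t)
    (ht : S.AS k1 k1 i c t t') (h1 : S.AS k k1 i t s a) (h2 : S.AS k k1 i c a b) : S.AS k k1 i t' s b := by
  cases k <;> cases k1 <;> simp only [AS, TS, XS, IsArg, reduceIte, Bool.false_eq_true] at *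
  · rcases h1 with ⟨rfl, rfl⟩ | ⟨h1, rfl⟩
    · left
      refine ⟨rfl, ?_⟩
      rcases ht with ⟨rfl, rfl⟩ | ⟨ht, rfl⟩ <;> rcases h2 with ⟨h2, rfl⟩ | ⟨h2, rfl⟩ <;> simp_all
    · rcases h2 with ⟨h2, rfl⟩ | ⟨h2, rfl⟩
      · exact (h1 h2).elim
      · exact .inr ⟨h1, rfl⟩
  · rw [h2, h1]
  · rw [h2, h1]
  · exact tmSub_comp hs ht0 ht h1 h2

theorem as_fix {k k1 : Bool} {i t s : S.N} (hs : S.IsArg k s) (h : S.AS k k1 i t s s) (ht : t ≠ S.cV k1 i)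
    (t' : S.N) : S.AS k k1 i t' s s := by
  cases k <;> cases k1 <;> simp only [AS, TS, XS, IsArg, cV, reduceIte, Bool.false_eq_true] at *
  · rcases h with ⟨rfl, rfl⟩ | h
    · exact (ht rfl).elim
    · exact .inr h
  · exact tmSub_fix hs h ht t'

theorem as_fresh {k k1 : Bool} {i s : S.N} (hs : S.IsArg k s) (hi : s ≤ i) (t : S.N) :
    S.AS k k1 i t s s := by
  cases k <;> cases k1 <;> simp only [AS, TS, XS, IsArg, reduceIte, Bool.false_eq_true] at *
  · refine .inr ⟨?_, trivial⟩
    rintro rfl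
    exact hi.not_gt (lt_tag_left (by decide) _ _)
  · exact tmSub_fresh hs hi t

theorem as_ident {k k1 : Bool} {i s : S.N} (hs : S.IsArg k s) : S.AS k k1 i (S.cV k1 i) s s := by
  cases k <;> cases k1 <;> simp only [AS, TS, XS, IsArg, cV, reduceIte, Bool.false_eq_true] at *
  · by_cases h : s = S.cSVar i
    · exact .inl ⟨h, h⟩
    · exact .inr ⟨h, trivial⟩
  · exact tmSub_ident hs

theorem isArg_cV (k : Bool) (i : S.N) : S.IsArg k (S.cV k i) := by
  cases k
  · exact .inl ⟨i, rfl⟩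
  · exact isTm_var i

theorem IsCst.ne_cV {k : Bool} {c i : S.N} (hc : S.IsCst k c) : c ≠ S.cV k i := by
  cases k
  · obtain ⟨n, rfl⟩ := hc; exact cSConst_ne
  · exact isAtom_ne_var hc

theorem no_cV {k : Bool} {i j : S.N} (h : i ≠ j) : S.NO k j (S.cV k i) := by
  cases k
  · exact fun h' => h (cSVar_inj.1 h')
  · exact (tmSub_var_ne h).2 rfl

/-- A variable that does not occur in a term is not affected by substitution. -/
theorem NO.as {k : Bool} {j t : S.N} (ht : S.IsArg k t) (h : S.NO k j t) (c : S.N) : S.AS k k j c t t := by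
  cases k
  · exact .inr ⟨h, rfl⟩
  · exact tmSub_fix ht h (isAtom_ne_var isAtom_zero) c

/-- Substituting a constant does not create occurrences of variables. -/
theorem NO.of_as {k k2 : Bool} {l j c t t' : S.N} (ht : S.IsArg k t) (hc : S.IsCst k2 c) (h : S.NO k l t)
    (h' : S.AS k k2 j c t t') : S.NO k l t' := by
  cases k
  · cases k2
    · rcases h' with ⟨rfl, rfl⟩ | ⟨h', rfl⟩
      · obtain ⟨n, rfl⟩ := hc; exact cSConst_ne
      · exact h
    · rw [show t' = t from h']; exact h
  · cases k2
    · rw [show t' = t from h']; exact h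
    · by_cases hlj : l = j
      · subst hlj
        rwa [tmSub_func ht h' (NO.as (k := true) ht h c)]
      · obtain ⟨d, hd, hd'⟩ := tmSub_comm hlj hc ht ((tmSub_atom isAtom_zero).2 rfl) h h'
        rwa [tmSub_func ht hd h'] at hd'

end Struct
end SOA

namespace SOA
namespace Struct

variable {S : Struct} [hS : S.IsModel]

/-! ### Substitution in formulas -/

theorem cNeg_inj {a b : S.N} : S.cNeg a = S.cNeg b ↔ a = b := by simp [cNeg, tag_inj]
theorem cAnd_inj {a b a' b' : S.N} : S.cAnd a b = S.cAnd a' b' ↔ a = a' ∧ b = b' := by simp [cAnd, tag_inj]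
theorem cImp_inj {a b a' b' : S.N} : S.cImp a b = S.cImp a' b' ↔ a = a' ∧ b = b' := by
  simp [cImp, cNeg_inj, cAnd_inj]
theorem cMem_inj {a b a' b' : S.N} : S.cMem a b = S.cMem a' b' ↔ a = a' ∧ b = b' := by simp [cMem, tag_inj]
theorem cOracle_inj {a b : S.N} : S.cOracle a = S.cOracle b ↔ a = b := by simp [cOracle, tag_inj]
theorem cQ_inj {k k' : Bool} {i a i' a' : S.N} :
    S.cQ k i a = S.cQ k' i' a' ↔ k = k' ∧ i = i' ∧ a = a' := by
  cases k <;> cases k' <;> simp [cQ, cAll, cAllS, tag_inj]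

theorem sb_func {k : Bool} {i t f f' f'' : S.N} (hf : S.IsFml True f) (h : S.SB k i t f f')
    (h' : S.SB k i t f f'') : f' = f'' := by
  refine fml_ind (fun f => ∀ f', S.SB k i t f f' → ∀ f'', S.SB k i t f f'' → f' = f'')
    ?_ ?_ ?_ ?_ ?_ ?_ hf _ h _ h'
  · intro r hr s u hs hu f' h f'' h'
    obtain ⟨s', u', hs', hu', rfl⟩ := (sb_rel hr).1 h
    obtain ⟨s'', u'', hs'', hu'', rfl⟩ := (sb_rel hr).1 h'
    rw [as_func (k := true) hs hs' hs'', as_func (k := true) hu hu' hu'']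
  · intro s X hs hX f' h f'' h'
    obtain ⟨s', u', hs', hu', rfl⟩ := sb_mem.1 h
    obtain ⟨s'', u'', hs'', hu'', rfl⟩ := sb_mem.1 h'
    rw [as_func (k := true) hs hs' hs'', as_func (k := false) hX hu' hu'']
  · intro s hs f' h f'' h'
    obtain ⟨s', hs', rfl⟩ := sb_oracle.1 h
    obtain ⟨s'', hs'', rfl⟩ := sb_oracle.1 h'
    rw [as_func (k := true) hs hs' hs'']
  · intro a _ ih f' h f'' h'
    obtain ⟨a', ha, rfl⟩ := sb_neg.1 h
    obtain ⟨a'', ha', rfl⟩ := sb_neg.1 h'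
    rw [ih _ ha _ ha']
  · intro a b _ _ iha ihb f' h f'' h'
    obtain ⟨a', b', ha, hb, rfl⟩ := sb_and.1 h
    obtain ⟨a'', b'', ha', hb', rfl⟩ := sb_and.1 h'
    rw [iha _ ha _ ha', ihb _ hb _ hb']
  · intro k' j a _ ih f' h f'' h'
    rcases sb_q.1 h with ⟨h1, rfl⟩ | ⟨h1, a', ha, rfl, -⟩ <;>
    rcases sb_q.1 h' with ⟨h2, rfl⟩ | ⟨h2, a'', ha', rfl, -⟩
    · rfl
    · exact (h2 h1).elim
    · exact (h1 h2).elim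
    · rw [ih _ ha _ ha']

theorem sb_total {k : Bool} {i c f : S.N} (hc : S.IsCst k c) (hf : S.IsFml True f) :
    ∃ f', S.SB k i c f f' ∧ S.IsFml True f' := by
  refine fml_ind (fun f => ∃ f', S.SB k i c f f' ∧ S.IsFml True f') ?_ ?_ ?_ ?_ ?_ ?_ hf
  · intro r hr s u hs hu
    obtain ⟨s', hs1, hs2⟩ := as_total (k := true) (i := i) hs hc.isArg
    obtain ⟨u', hu1, hu2⟩ := as_total (k := true) (i := i) hu hc.isArg
    exact ⟨_, (sb_rel hr).2 ⟨s', u', hs1, hu1, rfl⟩, (isFml_rel hr).2 ⟨hs2, hu2⟩⟩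
  · intro s X hs hX
    obtain ⟨s', hs1, hs2⟩ := as_total (k := true) (i := i) hs hc.isArg
    obtain ⟨u', hu1, hu2⟩ := as_total (k := false) (i := i) hX hc.isArg
    exact ⟨_, sb_mem.2 ⟨s', u', hs1, hu1, rfl⟩, isFml_mem.2 ⟨hs2, hu2⟩⟩
  · intro s hs
    obtain ⟨s', hs1, hs2⟩ := as_total (k := true) (i := i) hs hc.isArg
    exact ⟨_, sb_oracle.2 ⟨s', hs1, rfl⟩, isFml_oracle.2 hs2⟩
  · rintro a - ⟨a', h, h'⟩
    exact ⟨_, sb_neg.2 ⟨a', h, rfl⟩, isFml_neg.2 h'⟩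
  · rintro a b - - ⟨a', ha, ha'⟩ ⟨b', hb, hb'⟩
    exact ⟨_, sb_and.2 ⟨a', b', ha, hb, rfl⟩, isFml_and.2 ⟨ha', hb'⟩⟩
  · rintro k' j a ha ⟨a', h, h'⟩
    by_cases hj : k' = k ∧ j = i
    · exact ⟨_, sb_q.2 (.inl ⟨hj, rfl⟩), isFml_q.2 ha⟩
    · exact ⟨_, sb_q.2 (.inr ⟨hj, a', h, rfl, fun _ => .inr (hc.no j)⟩), isFml_q.2 h'⟩

theorem sb_isFml {k : Bool} {i c f f' : S.N} (hc : S.IsCst k c) (hf : S.IsFml True f)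
    (h : S.SB k i c f f') : S.IsFml True f' := by
  obtain ⟨f'', h1, h2⟩ := sb_total (i := i) hc hf
  rwa [sb_func hf h h1]

/-- If a substitution does not change `f`, then it substitutes the variable for itself, or the
variable is not free in `f` and no substitution for it changes `f`. -/
theorem sb_fix {k : Bool} {i t f : S.N} (hf : S.IsFml True f) (h : S.SB k i t f f) (ht : t ≠ S.cV k i)
    (t' : S.N) : S.SB k i t' f f := by
  revert h
  refine fml_ind (fun f => S.SB k i t f f → S.SB k i t' f f) ?_ ?_ ?_ ?_ ?_ ?_ hf
  · intro r hr s u hs hu h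
    obtain ⟨s', u', hs', hu', he⟩ := (sb_rel hr).1 h
    obtain ⟨-, rfl, rfl⟩ := tag_inj.1 he
    exact (sb_rel hr).2 ⟨_, _, as_fix (k := true) hs hs' ht t', as_fix (k := true) hu hu' ht t', rfl⟩
  · intro s X hs hX h
    obtain ⟨s', u', hs', hu', he⟩ := sb_mem.1 h
    obtain ⟨rfl, rfl⟩ := cMem_inj.1 he
    exact sb_mem.2 ⟨_, _, as_fix (k := true) hs hs' ht t', as_fix (k := false) hX hu' ht t', rfl⟩
  · intro s hs h
    obtain ⟨s', hs', he⟩ := sb_oracle.1 h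
    obtain rfl := cOracle_inj.1 he
    exact sb_oracle.2 ⟨_, as_fix (k := true) hs hs' ht t', rfl⟩
  · intro a _ ih h
    obtain ⟨a', ha, he⟩ := sb_neg.1 h
    obtain rfl := cNeg_inj.1 he
    exact sb_neg.2 ⟨_, ih ha, rfl⟩
  · intro a b _ _ iha ihb h
    obtain ⟨a', b', ha, hb, he⟩ := sb_and.1 h
    obtain ⟨rfl, rfl⟩ := cAnd_inj.1 he
    exact sb_and.2 ⟨_, _, iha ha, ihb hb, rfl⟩
  · intro k' j a _ ih h
    rcases sb_q.1 h with ⟨h1, -⟩ | ⟨h1, a', ha, he, -⟩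
    · exact sb_q.2 (.inl ⟨h1, rfl⟩)
    · obtain ⟨-, -, rfl⟩ := cQ_inj.1 he
      exact sb_q.2 (.inr ⟨h1, _, ih ha, rfl, fun _ => .inl rfl⟩)

theorem sb_fresh {k : Bool} {i f : S.N} (hf : S.IsFml True f) (hi : f ≤ i) (t : S.N) : S.SB k i t f f := by
  revert hi
  refine fml_ind (fun f => f ≤ i → S.SB k i t f f) ?_ ?_ ?_ ?_ ?_ ?_ hf
  · intro r hr s u hs hu h
    have h0 : 0 < r := by rcases hr with rfl | rfl <;> decide
    exact (sb_rel hr).2 ⟨_, _, as_fresh (k := true) hs ((lt_tag_left h0 _ _).le.trans h) t,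
      as_fresh (k := true) hu ((lt_tag_right h0 _ _).le.trans h) t, rfl⟩
  · intro s X hs hX h
    exact sb_mem.2 ⟨_, _, as_fresh (k := true) hs ((lt_tag_left (by decide) _ _).le.trans h) t,
      as_fresh (k := false) hX ((lt_tag_right (by decide) _ _).le.trans h) t, rfl⟩
  · intro s hs h
    exact sb_oracle.2 ⟨_, as_fresh (k := true) hs ((lt_tag_left (by decide) _ _).le.trans h) t, rfl⟩
  · intro a _ ih h
    exact sb_neg.2 ⟨_, ih ((lt_cNeg a).le.trans h), rfl⟩
  · intro a b _ _ iha ihb h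
    exact sb_and.2 ⟨_, _, iha ((lt_cAnd_left a b).le.trans h), ihb ((lt_cAnd_right a b).le.trans h), rfl⟩
  · intro k' j a _ ih h
    refine sb_q.2 (.inr ⟨fun h' => ?_, _, ih ((lt_cQ k' j a).le.trans h), rfl, fun _ => .inl rfl⟩)
    rw [← h'.2] at h
    exact h.not_gt (index_lt_cQ k' j a)

theorem sb_ident {k : Bool} {i f : S.N} (hf : S.IsFml True f) : S.SB k i (S.cV k i) f f := by
  refine fml_ind (fun f => S.SB k i (S.cV k i) f f) ?_ ?_ ?_ ?_ ?_ ?_ hf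
  · intro r hr s u hs hu
    exact (sb_rel hr).2 ⟨_, _, as_ident (k := true) hs, as_ident (k := true) hu, rfl⟩
  · intro s X hs hX
    exact sb_mem.2 ⟨_, _, as_ident (k := true) hs, as_ident (k := false) hX, rfl⟩
  · intro s hs
    exact sb_oracle.2 ⟨_, as_ident (k := true) hs, rfl⟩
  · intro a _ ih
    exact sb_neg.2 ⟨_, ih, rfl⟩
  · intro a b _ _ iha ihb
    exact sb_and.2 ⟨_, _, iha, ihb, rfl⟩
  · intro k' j a _ ih
    by_cases hj : k' = k ∧ j = i
    · exact sb_q.2 (.inl ⟨hj, rfl⟩)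
    · exact sb_q.2 (.inr ⟨hj, _, ih, rfl, fun _ => .inl rfl⟩)

/-- Substitutions for different variables commute, if one of them substitutes a constant. -/
theorem sb_comm {k1 k2 : Bool} {i j c t t' f a b : S.N} (hij : ¬ (k1 = k2 ∧ i = j)) (hc : S.IsCst k2 c)
    (hf : S.IsFml True f) (ht0 : S.IsArg k1 t) (ht : S.AS k1 k2 j c t t') (h1 : S.SB k1 i t f a)
    (h2 : S.SB k2 j c f b) : ∃ d, S.SB k2 j c a d ∧ S.SB k1 i t' b d := by
  refine fml_ind (fun f => ∀ a, S.SB k1 i t f a → ∀ b, S.SB k2 j c f b →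
    ∃ d, S.SB k2 j c a d ∧ S.SB k1 i t' b d) ?_ ?_ ?_ ?_ ?_ ?_ hf _ h1 _ h2
  · intro r hr s u hs hu a h1 b h2
    obtain ⟨s1, u1, hs1, hu1, rfl⟩ := (sb_rel hr).1 h1
    obtain ⟨s2, u2, hs2, hu2, rfl⟩ := (sb_rel hr).1 h2
    obtain ⟨s3, hs3, hs4⟩ := as_comm (k := true) hij hc hs ht hs1 hs2
    obtain ⟨u3, hu3, hu4⟩ := as_comm (k := true) hij hc hu ht hu1 hu2
    exact ⟨_, (sb_rel hr).2 ⟨_, _, hs3, hu3, rfl⟩, (sb_rel hr).2 ⟨_, _, hs4, hu4, rfl⟩⟩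
  · intro s X hs hX a h1 b h2
    obtain ⟨s1, u1, hs1, hu1, rfl⟩ := sb_mem.1 h1
    obtain ⟨s2, u2, hs2, hu2, rfl⟩ := sb_mem.1 h2
    obtain ⟨s3, hs3, hs4⟩ := as_comm (k := true) hij hc hs ht hs1 hs2
    obtain ⟨u3, hu3, hu4⟩ := as_comm (k := false) hij hc hX ht hu1 hu2
    exact ⟨_, sb_mem.2 ⟨_, _, hs3, hu3, rfl⟩, sb_mem.2 ⟨_, _, hs4, hu4, rfl⟩⟩
  · intro s hs a h1 b h2
    obtain ⟨s1, hs1, rfl⟩ := sb_oracle.1 h1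
    obtain ⟨s2, hs2, rfl⟩ := sb_oracle.1 h2
    obtain ⟨s3, hs3, hs4⟩ := as_comm (k := true) hij hc hs ht hs1 hs2
    exact ⟨_, sb_oracle.2 ⟨_, hs3, rfl⟩, sb_oracle.2 ⟨_, hs4, rfl⟩⟩
  · intro g _ ih a h1 b h2
    obtain ⟨a, ha, rfl⟩ := sb_neg.1 h1
    obtain ⟨b, hb, rfl⟩ := sb_neg.1 h2
    obtain ⟨d, hd, hd'⟩ := ih _ ha _ hb
    exact ⟨_, sb_neg.2 ⟨_, hd, rfl⟩, sb_neg.2 ⟨_, hd', rfl⟩⟩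
  · intro g g' _ _ ih ih' a h1 b h2
    obtain ⟨a, a', ha, ha', rfl⟩ := sb_and.1 h1
    obtain ⟨b, b', hb, hb', rfl⟩ := sb_and.1 h2
    obtain ⟨d, hd, hd'⟩ := ih _ ha _ hb
    obtain ⟨e, he, he'⟩ := ih' _ ha' _ hb'
    exact ⟨_, sb_and.2 ⟨_, _, hd, he, rfl⟩, sb_and.2 ⟨_, _, hd', he', rfl⟩⟩
  · intro k l g hg ih a h1 b h2
    rcases sb_q.1 h1 with ⟨e1, rfl⟩ | ⟨e1, d1, hd1, rfl, side⟩
    · -- the first substitution stops at this quantifier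
      rcases sb_q.1 h2 with ⟨e2, rfl⟩ | ⟨e2, d2, hd2, rfl, -⟩
      · exact (hij ⟨e1.1.symm.trans e2.1, e1.2.symm.trans e2.2⟩).elim
      · exact ⟨_, h2, sb_q.2 (.inl ⟨e1, rfl⟩)⟩
    · rcases sb_q.1 h2 with ⟨e2, rfl⟩ | ⟨e2, d2, hd2, rfl, -⟩
      · -- the second substitution stops at this quantifier
        refine ⟨_, sb_q.2 (.inl ⟨e2, rfl⟩), sb_q.2 (.inr ⟨e1, d1, ?_, rfl, fun hk => ?_⟩)⟩
        · by_cases hk : k = k1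
          · rcases side hk with rfl | hno
            · by_cases hti : t = S.cV k1 i
              · have hno : S.NO k2 j t := by
                  subst hti
                  obtain ⟨rfl, rfl⟩ := e2
                  subst hk
                  exact no_cV fun h => hij ⟨rfl, h⟩
                obtain ⟨rfl, rfl⟩ := e2
                subst hk
                rwa [as_func ht0 ht (hno.as ht0 c)]
              · exact sb_fix hg hd1 hti t'
            · obtain ⟨rfl, rfl⟩ := e2
              subst hk
              rwa [as_func ht0 ht (hno.as ht0 c)]
          · have : t' = t := by
              obtain ⟨rfl, rfl⟩ := e2
              cases k <;> cases k1
              · exact (hk rfl).elim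
              · exact ht
              · exact ht
              · exact (hk rfl).elim
            rwa [this]
        · rcases side hk with rfl | hno
          · exact .inl rfl
          · exact .inr (hno.of_as ht0 hc ht)
      · obtain ⟨d, hd, hd'⟩ := ih _ hd1 _ hd2
        refine ⟨_, sb_q.2 (.inr ⟨e2, d, hd, rfl, fun _ => .inr (hc.no l)⟩),
          sb_q.2 (.inr ⟨e1, d, hd', rfl, fun hk => ?_⟩)⟩
        rcases side hk with rfl | hno
        · exact .inl (sb_func hg hd hd2)
        · exact .inr (hno.of_as ht0 hc ht)

/-- Two successive substitutions for the same variable. -/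
theorem sb_comp {k : Bool} {i c t t' f a b : S.N} (hc : S.IsCst k c) (hf : S.IsFml True f) (ht0 : S.IsArg k t)
    (ht : S.AS k k i c t t') (h1 : S.SB k i t f a) (h2 : S.SB k i c a b) : S.SB k i t' f b := by
  refine fml_ind (fun f => ∀ a, S.SB k i t f a → ∀ b, S.SB k i c a b → S.SB k i t' f b)
    ?_ ?_ ?_ ?_ ?_ ?_ hf _ h1 _ h2
  · intro r hr s u hs hu a h1 b h2
    obtain ⟨s1, u1, hs1, hu1, rfl⟩ := (sb_rel hr).1 h1
    obtain ⟨s2, u2, hs2, hu2, rfl⟩ := (sb_rel hr).1 h2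
    exact (sb_rel hr).2 ⟨_, _, as_comp (k := true) hs ht0 ht hs1 hs2, as_comp (k := true) hu ht0 ht hu1 hu2, rfl⟩
  · intro s X hs hX a h1 b h2
    obtain ⟨s1, u1, hs1, hu1, rfl⟩ := sb_mem.1 h1
    obtain ⟨s2, u2, hs2, hu2, rfl⟩ := sb_mem.1 h2
    exact sb_mem.2 ⟨_, _, as_comp (k := true) hs ht0 ht hs1 hs2, as_comp (k := false) hX ht0 ht hu1 hu2, rfl⟩
  · intro s hs a h1 b h2
    obtain ⟨s1, hs1, rfl⟩ := sb_oracle.1 h1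
    obtain ⟨s2, hs2, rfl⟩ := sb_oracle.1 h2
    exact sb_oracle.2 ⟨_, as_comp (k := true) hs ht0 ht hs1 hs2, rfl⟩
  · intro g _ ih a h1 b h2
    obtain ⟨a, ha, rfl⟩ := sb_neg.1 h1
    obtain ⟨b, hb, rfl⟩ := sb_neg.1 h2
    exact sb_neg.2 ⟨_, ih _ ha _ hb, rfl⟩
  · intro g g' _ _ ih ih' a h1 b h2
    obtain ⟨a, a', ha, ha', rfl⟩ := sb_and.1 h1
    obtain ⟨b, b', hb, hb', rfl⟩ := sb_and.1 h2
    exact sb_and.2 ⟨_, _, ih _ ha _ hb, ih' _ ha' _ hb', rfl⟩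
  · intro k' l g hg ih a h1 b h2
    rcases sb_q.1 h1 with ⟨e1, rfl⟩ | ⟨e1, d1, hd1, rfl, side⟩
    · rcases sb_q.1 h2 with ⟨e2, rfl⟩ | ⟨e2, -⟩
      · exact sb_q.2 (.inl ⟨e1, rfl⟩)
      · exact (e2 e1).elim
    · rcases sb_q.1 h2 with ⟨e2, -⟩ | ⟨e2, d2, hd2, rfl, -⟩
      · exact (e1 e2).elim
      · refine sb_q.2 (.inr ⟨e1, d2, ih _ hd1 _ hd2, rfl, fun hk => ?_⟩)
        subst hk
        rcases side rfl with rfl | hno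
        · by_cases hti : t = S.cV k' i
          · subst hti
            exact .inr (NO.of_as ht0 hc (no_cV fun h => e1 ⟨rfl, h.symm⟩) ht)
          · exact .inl (sb_func hg hd2 (sb_fix hg hd1 hti c))
        · exact .inr (hno.of_as ht0 hc ht)

end Struct
end SOA

namespace SOA
namespace Struct

variable {S : Struct}

/-! ### Sentences and instances of formulas -/

/-- The variable of kind `k` and index `i` is not free in `f`. -/
def NF (S : Struct) (k : Bool) (i f : S.N) : Prop := if k then S.NotFree i f else S.NotFreeS i f

/-- `t` is a closed term, possibly with constants `c_n`. -/
def Closed (S : Struct) (t : S.N) : Prop := S.IsTm True t ∧ ∀ i, S.TmSub i S.cZero t t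

/-- `f'` arises from `f` by substituting a constant for one free variable. -/
def Step (S : Struct) (f f' : S.N) : Prop :=
  (∃ i n, S.SB true i (S.cC true n) f f') ∨ ∃ i n, S.SB false i (S.cC false n) f f'

/-- `h` arises from `f` by finitely many substitutions of constants for variables: there is a code
of a finite set of pairs `⟨m, b⟩`, where `b` arises from `f` by `m` such substitutions. -/
def Reach (S : Struct) (f h : S.N) : Prop :=
  ∃ z m, S.inFin (S.pair m h) z ∧ ∀ l b, S.inFin (S.pair l b) z →
    (l = S.zero ∧ b = f) ∨ ∃ l' a, l = S.add l' S.one ∧ S.inFin (S.pair l' a) z ∧ S.Step a b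

section
variable {K : Ctx} {t u : K.TmFun} [K.DefT t] [K.DefT u] (k : Bool)
instance def_NF : K.Def fun i e E => (K.st i).NF k (t i e E) (u i e E) := by
  cases k <;> simp only [NF, reduceIte, Bool.false_eq_true] <;> infer_instance
instance def_closed : K.Def fun i e E => (K.st i).Closed (t i e E) := by
  unfold Closed; infer_instance
instance def_step : K.Def fun i e E => (K.st i).Step (t i e E) (u i e E) := by
  unfold Step; infer_instance
instance def_reach : K.Def fun i e E => (K.st i).Reach (t i e E) (u i e E) := by
  unfold Reach; infer_instance
end

theorem step_iff {f f' : S.N} : S.Step f f' ↔ ∃ k i n, S.SB k i (S.cC k n) f f' :=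
  ⟨fun h => h.elim (fun ⟨i, n, h⟩ => ⟨true, i, n, h⟩) fun ⟨i, n, h⟩ => ⟨false, i, n, h⟩,
    fun ⟨k, i, n, h⟩ => by cases k; exacts [.inr ⟨i, n, h⟩, .inl ⟨i, n, h⟩]⟩

/-- "Not free" means invariance under the substitution of one particular constant. By `sb_fix` the choice
of the constant does not matter. -/
theorem exists_NF_iff (k : Bool) : ∃ c, S.IsCst k c ∧ ∀ i f, S.NF k i f ↔ S.SB k i c f f := by
  cases k
  · exact ⟨_, ⟨_, rfl⟩, fun i f => Iff.rfl⟩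
  · exact ⟨_, isAtom_zero, fun i f => Iff.rfl⟩

theorem isSent_iff {f : S.N} : S.IsSent f ↔ S.IsFml True f ∧ ∀ k i, S.NF k i f :=
  and_congr_right fun _ => ⟨fun h k i => by cases k; exacts [(h i).2, (h i).1],
    fun h i => ⟨h true i, h false i⟩⟩

theorem IsSent.nf {f : S.N} (h : S.IsSent f) (k : Bool) (i : S.N) : S.NF k i f := (isSent_iff.1 h).2 k i

variable [hS : S.IsModel]

/-! #### Variables that are not free -/

theorem NF.sb {k : Bool} {i f : S.N} (h : S.NF k i f) (hf : S.IsFml True f) (t : S.N) : S.SB k i t f f := by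
  obtain ⟨c, hc, hNF⟩ := exists_NF_iff (S := S) k
  exact sb_fix hf ((hNF i f).1 h) hc.ne_cV t

theorem NF.of_sb {k : Bool} {i c f : S.N} (hf : S.IsFml True f) (hc : S.IsCst k c) (h : S.SB k i c f f) :
    S.NF k i f := by
  obtain ⟨c', hc', hNF⟩ := exists_NF_iff (S := S) k
  exact (hNF i f).2 (sb_fix hf h hc.ne_cV c')

theorem NF.sb_eq {k : Bool} {i t f f' : S.N} (h : S.NF k i f) (hf : S.IsFml True f) (h' : S.SB k i t f f') :
    f' = f := sb_func hf h' (h.sb hf t)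

/-- Substitution does not change constants. -/
theorem IsCst.as_self {k k' : Bool} {c : S.N} (hc : S.IsCst k c) (i t : S.N) : S.AS k k' i t c c := by
  cases k <;> cases k'
  · exact .inr ⟨(show S.NO false i c from hc.no i), rfl⟩
  · exact rfl
  · exact rfl
  · exact (tmSub_atom hc).2 rfl

/-- A variable is no longer free after a constant has been substituted for it. -/
theorem NF.of_const {k : Bool} {i c f f' : S.N} (hf : S.IsFml True f) (hc : S.IsCst k c)
    (h : S.SB k i c f f') : S.NF k i f' := by
  have hf' := sb_isFml hc hf h
  obtain ⟨g, hg, -⟩ := sb_total (i := i) hc hf'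
  have := sb_comp hc hf hc.isArg (hc.as_self i c) h hg
  obtain rfl := sb_func hf this h
  exact NF.of_sb hf' hc hg

/-- Substituting constants does not create free variables. -/
theorem NF.of_step {k k2 : Bool} {i j c f f' : S.N} (hf : S.IsFml True f) (hc : S.IsCst k2 c)
    (h : S.NF k i f) (h' : S.SB k2 j c f f') : S.NF k i f' := by
  by_cases hij : k = k2 ∧ i = j
  · obtain ⟨rfl, rfl⟩ := hij
    exact NF.of_const hf hc h'
  · obtain ⟨c0, hc0, hNF⟩ := exists_NF_iff (S := S) k
    obtain ⟨d, hd, hd'⟩ := sb_comm hij hc hf hc0.isArg (hc0.as_self j c) ((hNF i f).1 h) h'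
    obtain rfl := sb_func hf hd h'
    exact (hNF i d).2 hd'

theorem nf_neg {k : Bool} {i a : S.N} : S.NF k i (S.cNeg a) ↔ S.NF k i a := by
  obtain ⟨c, hc, hNF⟩ := exists_NF_iff (S := S) k
  rw [hNF, hNF, sb_neg]
  simp [cNeg_inj]

theorem nf_and {k : Bool} {i a b : S.N} : S.NF k i (S.cAnd a b) ↔ S.NF k i a ∧ S.NF k i b := by
  obtain ⟨c, hc, hNF⟩ := exists_NF_iff (S := S) k
  rw [hNF, hNF, hNF, sb_and]
  constructor
  · rintro ⟨a', b', ha, hb, he⟩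
    obtain ⟨rfl, rfl⟩ := cAnd_inj.1 he
    exact ⟨ha, hb⟩
  · exact fun h => ⟨a, b, h.1, h.2, rfl⟩

theorem nf_q {k k' : Bool} {i j a : S.N} : S.NF k i (S.cQ k' j a) ↔ (k' = k ∧ j = i) ∨ S.NF k i a := by
  obtain ⟨c, hc, hNF⟩ := exists_NF_iff (S := S) k
  rw [hNF, hNF, sb_q]
  constructor
  · rintro (⟨h, -⟩ | ⟨-, b, hb, he, -⟩)
    · exact .inl h
    · obtain ⟨-, -, rfl⟩ := cQ_inj.1 he
      exact .inr hb
  · intro h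
    by_cases hj : k' = k ∧ j = i
    · exact .inl ⟨hj, rfl⟩
    · exact .inr ⟨hj, a, h.resolve_left hj, rfl, fun _ => .inl rfl⟩

/-! #### Sentences -/

theorem IsSent.sb {k : Bool} {i f : S.N} (h : S.IsSent f) (t : S.N) : S.SB k i t f f :=
  (h.nf k i).sb h.1 t

theorem IsSent.sb_eq {k : Bool} {i t f f' : S.N} (h : S.IsSent f) (h' : S.SB k i t f f') : f' = f :=
  (h.nf k i).sb_eq h.1 h'

theorem IsSent.step_eq {f f' : S.N} (h : S.IsSent f) (h' : S.Step f f') : f' = f := by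
  obtain ⟨k, i, n, h'⟩ := step_iff.1 h'
  exact h.sb_eq h'

theorem isSent_neg {a : S.N} : S.IsSent (S.cNeg a) ↔ S.IsSent a := by
  simp only [isSent_iff, isFml_neg, nf_neg]

theorem isSent_and {a b : S.N} : S.IsSent (S.cAnd a b) ↔ S.IsSent a ∧ S.IsSent b := by
  simp only [isSent_iff, isFml_and, nf_and, forall_and]
  tauto

theorem isSent_imp {a b : S.N} : S.IsSent (S.cImp a b) ↔ S.IsSent a ∧ S.IsSent b := by
  rw [cImp, isSent_neg, isSent_and, isSent_neg]

theorem IsSent.inst {k : Bool} {i a c a' : S.N} (h : S.IsSent (S.cQ k i a)) (hc : S.IsCst k c)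
    (h' : S.SB k i c a a') : S.IsSent a' := by
  have ha := isFml_q.1 h.1
  refine isSent_iff.2 ⟨sb_isFml hc ha h', fun k' j => ?_⟩
  rcases nf_q.1 (h.nf k' j) with ⟨rfl, rfl⟩ | hj
  · exact NF.of_const ha hc h'
  · exact hj.of_step ha hc h'

theorem closed_op {o : ℕ} (ho : IsOp o) {a b : S.N} : S.Closed (S.tag o a b) ↔ S.Closed a ∧ S.Closed b := by
  simp only [Closed, isTm_op ho, tmSub_op ho]
  constructor
  · rintro ⟨⟨ha, hb⟩, h⟩
    have key : ∀ i, S.TmSub i S.cZero a a ∧ S.TmSub i S.cZero b b := by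
      intro i
      obtain ⟨a', b', ha, hb, he⟩ := h i
      obtain ⟨-, rfl, rfl⟩ := tag_inj.1 he
      exact ⟨ha, hb⟩
    exact ⟨⟨ha, fun i => (key i).1⟩, hb, fun i => (key i).2⟩
  · rintro ⟨⟨ha, ha'⟩, hb, hb'⟩
    exact ⟨⟨ha, hb⟩, fun i => ⟨a, b, ha' i, hb' i, rfl⟩⟩

theorem closed_atom {s : S.N} (hs : S.IsAtom s) : S.Closed s := ⟨isTm_atom hs, fun _ => (tmSub_atom hs).2 rfl⟩

theorem not_closed_var (i : S.N) : ¬ S.Closed (S.cVar i) := fun h => by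
  have := tmSub_var_self.1 (h.2 i)
  exact isAtom_ne_var isAtom_zero this.symm

theorem Closed.as {k : Bool} {i t : S.N} (ht : S.Closed t) (c : S.N) : S.AS true k i c t t := by
  cases k
  · exact rfl
  · exact tmSub_fix ht.1 (ht.2 i) (isAtom_ne_var isAtom_zero) c

theorem isSent_rel {r : ℕ} (hr : IsRel r) {s t : S.N} (h : S.IsSent (S.tag r s t)) :
    S.Closed s ∧ S.Closed t := by
  have hf := (isFml_rel hr).1 h.1
  have key : ∀ i, S.TmSub i S.cZero s s ∧ S.TmSub i S.cZero t t := by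
    intro i
    obtain ⟨s', t', hs, ht, he⟩ := (sb_rel (k := true) hr).1 (h.nf true i)
    obtain ⟨-, rfl, rfl⟩ := tag_inj.1 he
    exact ⟨hs, ht⟩
  exact ⟨⟨hf.1, fun i => (key i).1⟩, hf.2, fun i => (key i).2⟩

theorem isSent_mem {s X : S.N} (h : S.IsSent (S.cMem s X)) : S.Closed s ∧ ∃ n, X = S.cSConst n := by
  have hf := isFml_mem.1 h.1
  refine ⟨⟨hf.1, fun i => ?_⟩, ?_⟩
  · obtain ⟨s', t', hs, ht, he⟩ := (sb_mem (k := true)).1 (h.nf true i)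
    obtain ⟨rfl, rfl⟩ := cMem_inj.1 he
    exact hs
  · rcases hf.2 with ⟨i, rfl⟩ | ⟨-, hn⟩
    · obtain ⟨s', t', hs, ht, he⟩ := (sb_mem (k := false)).1 (h.nf false i)
      obtain ⟨rfl, rfl⟩ := cMem_inj.1 he
      rcases ht with ⟨-, ht⟩ | ⟨ht, -⟩
      · exact (cSConst_ne ht.symm).elim
      · exact (ht rfl).elim
    · exact hn

theorem isSent_oracle {s : S.N} (h : S.IsSent (S.cOracle s)) : S.Closed s := by
  refine ⟨isFml_oracle.1 h.1, fun i => ?_⟩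
  obtain ⟨s', hs, he⟩ := (sb_oracle (k := true)).1 (h.nf true i)
  obtain rfl := cOracle_inj.1 he
  exact hs

/-! #### Instances of a formula -/

theorem Step.isFml {f f' : S.N} (h : S.Step f f') (hf : S.IsFml True f) : S.IsFml True f' := by
  obtain ⟨k, i, n, h⟩ := step_iff.1 h
  exact sb_isFml (isCst_cC k n) hf h

theorem reach_refl (f : S.N) : S.Reach f f := by
  obtain ⟨z, -, hz⟩ := exists_code (fun x => x = S.pair S.zero f) (S.pair S.zero f + 1)
  refine ⟨z, S.zero, (hz _).2 ⟨lt_succ_iff.2 le_rfl, rfl⟩, fun l b h => .inl ?_⟩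
  exact pair_inj.1 ((hz _).1 h).2

theorem Reach.step {f a b : S.N} (h : S.Reach f a) (hab : S.Step a b) : S.Reach f b := by
  obtain ⟨z, m, hm, h⟩ := h
  let p := S.pair (m + 1) b
  obtain ⟨z', -, hz⟩ := exists_code (fun x => S.inFin x z ∨ x = S.pair (m + 1) b) (z + p + 1)
  have hz1 : ∀ x, S.inFin x z → S.inFin x z' := fun x hx =>
    (hz x).2 ⟨(lt_of_inFin hx).trans_le (le_self_add.trans le_self_add), .inl hx⟩
  refine ⟨z', m + 1, (hz _).2 ⟨lt_succ_iff.2 (show p ≤ z + p from le_add_self), .inr rfl⟩, fun l b' hl => ?_⟩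
  rcases ((hz _).1 hl).2 with hl | hl
  · rcases h l b' hl with h' | ⟨l', a', rfl, hl', hs⟩
    · exact .inl h'
    · exact .inr ⟨l', a', rfl, hz1 _ hl', hs⟩
  · obtain ⟨rfl, rfl⟩ := pair_inj.1 hl
    exact .inr ⟨m, a, rfl, hz1 _ hm, hab⟩

theorem reach_ind {f h : S.N} (P : S.N → Prop) [Ar P] (hr : S.Reach f h) (h0 : P f)
    (hs : ∀ a b, S.Reach f a → P a → S.Step a b → P b) : P h := by
  obtain ⟨z, m, hm, hz⟩ := hr
  have := isSet_setOf P
  have key : ∀ m a, S.inFin (S.pair m a) z → S.Reach f a ∧ a ∈ {x | P x} := by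
    apply ind (fun m => ∀ a, S.inFin (S.pair m a) z → S.Reach f a ∧ a ∈ {x | P x})
    · intro a ha
      refine ⟨⟨z, _, ha, hz⟩, ?_⟩
      rcases hz _ _ ha with ⟨-, rfl⟩ | ⟨l, b, hl, -⟩
      · exact h0
      · exact (Arith.succ_ne l hl.symm).elim
    · intro m ih a ha
      refine ⟨⟨z, _, ha, hz⟩, ?_⟩
      rcases hz _ _ ha with ⟨hl, -⟩ | ⟨l, b, hl, hb, hba⟩
      · exact (Arith.succ_ne m hl).elim
      · obtain rfl := Arith.succ_inj hl
        exact hs b a (ih b hb).1 (ih b hb).2 hba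
  exact (key m h hm).2

theorem Reach.trans {f g h : S.N} (h1 : S.Reach f g) (h2 : S.Reach g h) : S.Reach f h :=
  reach_ind (fun x => S.Reach f x) h2 h1 fun _ _ _ => Reach.step

theorem Reach.isFml {f h : S.N} (hr : S.Reach f h) (hf : S.IsFml True f) : S.IsFml True h :=
  reach_ind (fun h => S.IsFml True h) hr hf fun _ _ _ ha hs => hs.isFml ha

theorem Reach.eq_of_isSent {f h : S.N} (hf : S.IsSent f) (hr : S.Reach f h) : h = f := by
  refine reach_ind (fun h => h = f) hr rfl ?_
  rintro a b - rfl hs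
  exact hf.step_eq hs

theorem reach_neg {a h : S.N} (hr : S.Reach (S.cNeg a) h) : ∃ a', S.Reach a a' ∧ h = S.cNeg a' := by
  refine reach_ind (fun h => ∃ a', S.Reach a a' ∧ h = S.cNeg a') hr ⟨a, reach_refl a, rfl⟩ ?_
  rintro _ b - ⟨a', ha, rfl⟩ hs
  obtain ⟨k, i, n, hs⟩ := step_iff.1 hs
  obtain ⟨b', hb, rfl⟩ := sb_neg.1 hs
  exact ⟨b', ha.step (step_iff.2 ⟨k, i, n, hb⟩), rfl⟩

theorem reach_and {a b h : S.N} (hr : S.Reach (S.cAnd a b) h) :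
    ∃ a' b', S.Reach a a' ∧ S.Reach b b' ∧ h = S.cAnd a' b' := by
  refine reach_ind (fun h => ∃ a' b', S.Reach a a' ∧ S.Reach b b' ∧ h = S.cAnd a' b') hr
    ⟨a, b, reach_refl a, reach_refl b, rfl⟩ ?_
  rintro _ b - ⟨a', b', ha, hb, rfl⟩ hs
  obtain ⟨k, i, n, hs⟩ := step_iff.1 hs
  obtain ⟨a'', b'', ha', hb', rfl⟩ := sb_and.1 hs
  exact ⟨a'', b'', ha.step (step_iff.2 ⟨k, i, n, ha'⟩), hb.step (step_iff.2 ⟨k, i, n, hb'⟩), rfl⟩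

theorem reach_imp {a b h : S.N} (hr : S.Reach (S.cImp a b) h) :
    ∃ a' b', S.Reach a a' ∧ S.Reach b b' ∧ h = S.cImp a' b' := by
  obtain ⟨_, hr1, rfl⟩ := reach_neg hr
  obtain ⟨a', _, ha, hr2, rfl⟩ := reach_and hr1
  obtain ⟨b', hb, rfl⟩ := reach_neg hr2
  exact ⟨a', b', ha, hb, rfl⟩

theorem reach_q {k : Bool} {i a h : S.N} (hr : S.Reach (S.cQ k i a) h) :
    ∃ a', S.Reach a a' ∧ h = S.cQ k i a' := by
  refine reach_ind (fun h => ∃ a', S.Reach a a' ∧ h = S.cQ k i a') hr ⟨a, reach_refl a, rfl⟩ ?_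
  rintro _ b - ⟨a', ha, rfl⟩ hs
  obtain ⟨k, i, n, hs⟩ := step_iff.1 hs
  rcases sb_q.1 hs with ⟨-, rfl⟩ | ⟨-, b', hb, rfl, -⟩
  · exact ⟨a', ha, rfl⟩
  · exact ⟨b', ha.step (step_iff.2 ⟨k, i, n, hb⟩), rfl⟩

/-- Every formula has an instance that is a sentence. -/
theorem exists_reach_isSent {f : S.N} (hf : S.IsFml True f) : ∃ h, S.Reach f h ∧ S.IsSent h := by
  have key : ∀ m, ∃ h, S.Reach f h ∧ ∀ i, (i < m ∨ f ≤ i) → S.NF true i h ∧ S.NF false i h := by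
    apply ind (fun m => ∃ h, S.Reach f h ∧ ∀ i, (i < m ∨ f ≤ i) → S.NF true i h ∧ S.NF false i h)
    · -- the indices of variables of `f` are smaller than the code of `f`
      refine ⟨f, reach_refl f, fun i hi => ?_⟩
      have hi := hi.resolve_left (Arith.not_lt_zero i)
      exact ⟨NF.of_sb hf (isCst_cC true 0) (sb_fresh hf hi _),
        NF.of_sb hf (isCst_cC false 0) (sb_fresh hf hi _)⟩
    · rintro m ⟨h, hr, ih⟩
      have hh := hr.isFml hf
      have hc := isCst_cC (S := S)
      obtain ⟨g, hg, hg'⟩ := sb_total (i := m) (hc true 0) hh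
      obtain ⟨g', hg1, hg2⟩ := sb_total (i := m) (hc false 0) hg'
      refine ⟨g', (hr.step (step_iff.2 ⟨_, _, _, hg⟩)).step (step_iff.2 ⟨_, _, _, hg1⟩), fun i hi => ?_⟩
      by_cases him : i = m
      · subst him
        exact ⟨(NF.of_const hh (hc _ _) hg).of_step hg' (hc _ _) hg1, NF.of_const hg' (hc _ _) hg1⟩
      · have hi : i < m ∨ f ≤ i := hi.imp_left fun h => (lt_succ_iff.1 h).lt_of_ne him
        exact ⟨((ih i hi).1.of_step hh (hc _ _) hg).of_step hg' (hc _ _) hg1,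
          ((ih i hi).2.of_step hh (hc _ _) hg).of_step hg' (hc _ _) hg1⟩
  obtain ⟨h, hr, hh⟩ := key f
  exact ⟨h, hr, hr.isFml hf, fun i => hh i (lt_or_ge i f)⟩

/-- Induction on formulas, in which the quantifier case may use all instances by constants. -/
theorem inst_ind (P : S.N → Prop) [Ar P]
    (rel : ∀ r, IsRel r → ∀ s t, S.IsTm True s → S.IsTm True t → P (S.tag r s t))
    (mem : ∀ t X, S.IsTm True t → S.IsSTm True X → P (S.cMem t X))
    (oracle : ∀ t, S.IsTm True t → P (S.cOracle t))
    (neg : ∀ a, S.IsFml True a → P a → P (S.cNeg a))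
    (and : ∀ a b, S.IsFml True a → S.IsFml True b → P a → P b → P (S.cAnd a b))
    (q : ∀ k i a, S.IsFml True a → (∀ n a', S.SB k i (S.cC k n) a a' → P a') → P (S.cQ k i a))
    {x : S.N} (hx : S.IsFml True x) : P x := by
  have := isSet_setOf P
  -- the induction is on the formula `f`, and simultaneous for all its instances `h`
  refine fml_ind (K := True) (fun f => ∀ h, S.Reach f h → h ∈ {x | P x}) ?_ ?_ ?_ ?_ ?_ ?_ hx x (reach_refl x)
  · intro r hr s t hs ht h h'
    have : ∃ s t, h = S.tag r s t := by
      refine reach_ind (fun h => ∃ s t, h = S.tag r s t) h' ⟨s, t, rfl⟩ ?_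
      rintro _ b - ⟨s, t, rfl⟩ hs
      obtain ⟨k, i, n, hs⟩ := step_iff.1 hs
      obtain ⟨s', t', -, -, rfl⟩ := (sb_rel hr).1 hs
      exact ⟨s', t', rfl⟩
    obtain ⟨s', t', rfl⟩ := this
    have hf := (isFml_rel hr).1 (h'.isFml ((isFml_rel hr).2 ⟨hs, ht⟩))
    exact rel r hr s' t' hf.1 hf.2
  · intro s t hs ht h h'
    have : ∃ s t, h = S.cMem s t := by
      refine reach_ind (fun h => ∃ s t, h = S.cMem s t) h' ⟨s, t, rfl⟩ ?_
      rintro _ b - ⟨s, t, rfl⟩ hs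
      obtain ⟨k, i, n, hs⟩ := step_iff.1 hs
      obtain ⟨s', t', -, -, rfl⟩ := sb_mem.1 hs
      exact ⟨s', t', rfl⟩
    obtain ⟨s', t', rfl⟩ := this
    have hf := isFml_mem.1 (h'.isFml (isFml_mem.2 ⟨hs, ht⟩))
    exact mem s' t' hf.1 hf.2
  · intro s hs h h'
    have : ∃ s, h = S.cOracle s := by
      refine reach_ind (fun h => ∃ s, h = S.cOracle s) h' ⟨s, rfl⟩ ?_
      rintro _ b - ⟨s, rfl⟩ hs
      obtain ⟨k, i, n, hs⟩ := step_iff.1 hs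
      obtain ⟨s', -, rfl⟩ := sb_oracle.1 hs
      exact ⟨s', rfl⟩
    obtain ⟨s', rfl⟩ := this
    exact oracle s' (isFml_oracle.1 (h'.isFml (isFml_oracle.2 hs)))
  · intro a ha ih h h'
    obtain ⟨a', h1, rfl⟩ := reach_neg h'
    exact neg a' (h1.isFml ha) (ih a' h1)
  · intro a b ha hb iha ihb h h'
    obtain ⟨a', b', h1, h2, rfl⟩ := reach_and h'
    exact and a' b' (h1.isFml ha) (h2.isFml hb) (iha a' h1) (ihb b' h2)
  · intro k i a ha ih h h'
    obtain ⟨a', h1, rfl⟩ := reach_q h'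
    exact q k i a' (h1.isFml ha) fun n a'' h2 => ih a'' (h1.step (step_iff.2 ⟨k, i, n, h2⟩))

end Struct
end SOA

namespace SOA
namespace Struct

variable {S : Struct} {M Y : Set S.N}

/-! ### Satisfaction definitions -/

theorem IsSat.isSent (h : S.IsSat M Y) {f : S.N} (hf : f ∈ Y) : S.IsSent f := h.1 f hf

theorem IsSat.neg (h : S.IsSat M Y) {f : S.N} (hf : S.IsSent f) : S.cNeg f ∈ Y ↔ f ∉ Y :=
  h.2.2.2.2.1 f hf

theorem IsSat.and (h : S.IsSat M Y) {f g : S.N} (hf : S.IsSent f) (hg : S.IsSent g) :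
    S.cAnd f g ∈ Y ↔ f ∈ Y ∧ g ∈ Y := h.2.2.2.2.2.1 f g hf hg

theorem IsSat.q (h : S.IsSat M Y) {k : Bool} {i a : S.N} (ha : S.IsSent (S.cQ k i a)) :
    S.cQ k i a ∈ Y ↔ ∀ n a', S.SB k i (S.cC k n) a a' → a' ∈ Y := by
  cases k
  · exact h.2.2.2.2.2.2.2 i a ha
  · exact h.2.2.2.2.2.2.1 i a ha

theorem IsSat.eq (h : S.IsSat M Y) {s t a b : S.N} (hs : S.Val s a) (ht : S.Val t b) :
    S.cEq s t ∈ Y ↔ a = b := (h.2.1 s t a b hs ht).1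

theorem IsSat.mem (h : S.IsSat M Y) {t a n : S.N} (ht : S.Val t a) :
    S.cMem t (S.cSConst n) ∈ Y ↔ S.pair n a ∈ M := h.2.2.1 t a n ht

theorem IsSat.oracle (h : S.IsSat M Y) {t a : S.N} (ht : S.Val t a) :
    S.cOracle t ∈ Y ↔ S.pair S.zero a ∈ M := h.2.2.2.1 t a ht

/-- The truth value of a relation depends only on the values of the terms. -/
theorem IsSat.rel {M' Y' : Set S.N} (h : S.IsSat M Y) (h' : S.IsSat M' Y') {r : ℕ} (hr : IsRel r)
    {s t s' t' a b : S.N} (hs : S.Val s a) (ht : S.Val t b) (hs' : S.Val s' a) (ht' : S.Val t' b) :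
    S.tag r s t ∈ Y ↔ S.tag r s' t' ∈ Y' := by
  have h1 := h.2.1 s t a b hs ht
  have h2 := h'.2.1 s' t' a b hs' ht'
  rcases hr with rfl | rfl
  · exact h1.1.trans h2.1.symm
  · exact h1.2.trans h2.2.symm

variable [hS : S.IsModel]

/-! ### Values of closed terms -/

theorem val_iff {t a : S.N} : S.Val t a ↔
    (t = S.cZero ∧ a = S.zero) ∨ (t = S.cOne ∧ a = S.one) ∨ t = S.cConst a ∨
    ∃ s₁ b₁ s₂ b₂, S.Val s₁ b₁ ∧ S.Val s₂ b₂ ∧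
      ((t = S.cAdd s₁ s₂ ∧ a = S.add b₁ b₂) ∨ (t = S.cMul s₁ s₂ ∧ a = S.mul b₁ b₂) ∨
       (t = S.cExp s₁ s₂ ∧ a = S.exp b₁ b₂)) := by
  constructor
  · rintro ⟨z, hz, h⟩
    refine (h t a hz).imp_right (Or.imp_right (Or.imp_right ?_))
    rintro ⟨s₁, b₁, s₂, b₂, h1, h2, h3⟩
    exact ⟨s₁, b₁, s₂, b₂, ⟨z, h1, h⟩, ⟨z, h2, h⟩, h3⟩
  · -- adding a pair to a code in which its components are already present
    have key : ∀ z : S.N, (∀ s b, S.inFin (S.pair s b) z →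
        (s = S.cZero ∧ b = S.zero) ∨ (s = S.cOne ∧ b = S.one) ∨ s = S.cConst b ∨
        ∃ s₁ b₁ s₂ b₂, S.inFin (S.pair s₁ b₁) z ∧ S.inFin (S.pair s₂ b₂) z ∧
        ((s = S.cAdd s₁ s₂ ∧ b = S.add b₁ b₂) ∨ (s = S.cMul s₁ s₂ ∧ b = S.mul b₁ b₂) ∨
         (s = S.cExp s₁ s₂ ∧ b = S.exp b₁ b₂))) → 
        ((t = S.cZero ∧ a = S.zero) ∨ (t = S.cOne ∧ a = S.one) ∨ t = S.cConst a ∨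
        ∃ s₁ b₁ s₂ b₂, S.inFin (S.pair s₁ b₁) z ∧ S.inFin (S.pair s₂ b₂) z ∧
        ((t = S.cAdd s₁ s₂ ∧ a = S.add b₁ b₂) ∨ (t = S.cMul s₁ s₂ ∧ a = S.mul b₁ b₂) ∨
         (t = S.cExp s₁ s₂ ∧ a = S.exp b₁ b₂))) → S.Val t a := by
      intro z hz ht
      obtain ⟨z', -, hz'⟩ := exists_code (fun x => S.inFin x z ∨ x = S.pair t a) (z + S.pair t a + 1)
      have hz1 : ∀ x, S.inFin x z → S.inFin x z' := fun x hx =>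
        (hz' x).2 ⟨(lt_of_inFin hx).trans_le (le_self_add.trans le_self_add), .inl hx⟩
      refine ⟨z', (hz' _).2 ⟨lt_succ_iff.2 le_add_self, .inr rfl⟩, fun s b hsb => ?_⟩
      have : _ ∨ _ ∨ _ ∨ _ := ((hz' _).1 hsb).2.elim (hz s b) fun h => by
        obtain ⟨rfl, rfl⟩ := pair_inj.1 h
        exact ht
      refine this.imp_right (Or.imp_right (Or.imp_right ?_))
      rintro ⟨s₁, b₁, s₂, b₂, h1, h2, h3⟩
      exact ⟨s₁, b₁, s₂, b₂, hz1 _ h1, hz1 _ h2, h3⟩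
    rintro (h | h | h | ⟨s₁, b₁, s₂, b₂, ⟨z1, h1, h1'⟩, ⟨z2, h2, h2'⟩, h3⟩)
    · exact key 0 (fun s b h => (Arith.not_lt_zero _ (lt_of_inFin h)).elim) (.inl h)
    · exact key 0 (fun s b h => (Arith.not_lt_zero _ (lt_of_inFin h)).elim) (.inr (.inl h))
    · exact key 0 (fun s b h => (Arith.not_lt_zero _ (lt_of_inFin h)).elim) (.inr (.inr (.inl h)))
    · obtain ⟨z, -, hz⟩ := exists_code (fun x => S.inFin x z1 ∨ S.inFin x z2) (z1 + z2)
      have hz1 : ∀ x, S.inFin x z1 → S.inFin x z := fun x hx =>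
        (hz x).2 ⟨(lt_of_inFin hx).trans_le le_self_add, .inl hx⟩
      have hz2 : ∀ x, S.inFin x z2 → S.inFin x z := fun x hx =>
        (hz x).2 ⟨(lt_of_inFin hx).trans_le le_add_self, .inr hx⟩
      refine key z (fun s b h => ?_) (.inr (.inr (.inr ⟨s₁, b₁, s₂, b₂, hz1 _ h1, hz2 _ h2, h3⟩)))
      rcases ((hz _).1 h).2 with h | h
      · refine (h1' s b h).imp_right (Or.imp_right (Or.imp_right ?_))
        rintro ⟨s₁, b₁, s₂, b₂, h1, h2, h3⟩
        exact ⟨s₁, b₁, s₂, b₂, hz1 _ h1, hz1 _ h2, h3⟩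
      · refine (h2' s b h).imp_right (Or.imp_right (Or.imp_right ?_))
        rintro ⟨s₁, b₁, s₂, b₂, h1, h2, h3⟩
        exact ⟨s₁, b₁, s₂, b₂, hz2 _ h1, hz2 _ h2, h3⟩

theorem val_const {n a : S.N} : S.Val (S.cConst n) a ↔ n = a := by
  rw [val_iff]; simp [cZero, cOne, cConst, cAdd, cMul, cExp, tag_inj]

theorem val_atom {s : S.N} (hs : S.IsAtom s) : ∃ a, ∀ b, S.Val s b ↔ b = a := by
  rcases hs with rfl | rfl | ⟨n, rfl⟩
  · exact ⟨S.zero, fun b => by rw [val_iff]; simp [cZero, cOne, cConst, cAdd, cMul, cExp, tag_inj]⟩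
  · exact ⟨S.one, fun b => by rw [val_iff]; simp [cZero, cOne, cConst, cAdd, cMul, cExp, tag_inj]⟩
  · exact ⟨n, fun b => by rw [val_const, eq_comm]⟩

/-- The value of a compound term is a function of the values of its components. -/
theorem val_op {o : ℕ} (ho : IsOp o) : ∃ F : S.N → S.N → S.N, ∀ s t a,
    S.Val (S.tag o s t) a ↔ ∃ b c, S.Val s b ∧ S.Val t c ∧ a = F b c := by
  rcases ho with rfl | rfl | rfl
  · refine ⟨S.add, fun s t a => ?_⟩
    rw [val_iff]; simp [cZero, cOne, cConst, cAdd, cMul, cExp, tag_inj]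
  · refine ⟨S.mul, fun s t a => ?_⟩
    rw [val_iff]; simp [cZero, cOne, cConst, cAdd, cMul, cExp, tag_inj]
  · refine ⟨S.exp, fun s t a => ?_⟩
    rw [val_iff]; simp [cZero, cOne, cConst, cAdd, cMul, cExp, tag_inj]

theorem Closed.exists_val {t : S.N} (ht : S.Closed t) : ∃ a, S.Val t a := by
  refine tm_ind (fun t => S.Closed t → ∃ a, S.Val t a) ?_ ?_ ?_ ht.1 ht
  · intro s hs _
    obtain ⟨c, hc⟩ := val_atom hs
    exact ⟨c, (hc c).2 rfl⟩
  · exact fun i h => (not_closed_var i h).elim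
  · intro o ho s t _ _ ihs iht h
    obtain ⟨hs, ht⟩ := (closed_op ho).1 h
    obtain ⟨F, hF⟩ := val_op (S := S) ho
    obtain ⟨a, ha⟩ := ihs hs
    obtain ⟨b, hb⟩ := iht ht
    exact ⟨_, (hF _ _ _).2 ⟨a, b, ha, hb, rfl⟩⟩

/-- Substituting terms of equal value yields terms of equal value. -/
theorem exists_val_tmSub {i s t u u' u'' x : S.N} (hu : S.IsTm True u) (hs : S.Val s x) (ht : S.Val t x)
    (h1 : S.TmSub i s u u') (h2 : S.TmSub i t u u'') (hc : S.Closed u') :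
    ∃ y, S.Val u' y ∧ S.Val u'' y := by
  refine tm_ind (fun u => ∀ u' u'', S.TmSub i s u u' → S.TmSub i t u u'' → S.Closed u' →
    ∃ y, S.Val u' y ∧ S.Val u'' y) ?_ ?_ ?_ hu _ _ h1 h2 hc
  · intro u hu u' u'' h1 h2 _
    rw [tmSub_atom hu] at h1 h2
    obtain ⟨c, hc⟩ := val_atom hu
    rw [h1, h2]
    exact ⟨c, (hc c).2 rfl, (hc c).2 rfl⟩
  · intro j u' u'' h1 h2 hc
    by_cases hj : j = i
    · subst hj
      rw [tmSub_var_self] at h1 h2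
      rw [h1, h2]
      exact ⟨x, hs, ht⟩
    · rw [tmSub_var_ne hj] at h1
      rw [h1] at hc
      exact (not_closed_var j hc).elim
  · intro o ho a b _ _ iha ihb u' u'' h1 h2 hc
    obtain ⟨a', b', ha', hb', rfl⟩ := (tmSub_op ho).1 h1
    obtain ⟨a'', b'', ha'', hb'', rfl⟩ := (tmSub_op ho).1 h2
    obtain ⟨hca, hcb⟩ := (closed_op ho).1 hc
    obtain ⟨y, hy, hy'⟩ := iha _ _ ha' ha'' hca
    obtain ⟨w, hw, hw'⟩ := ihb _ _ hb' hb'' hcb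
    obtain ⟨F, hF⟩ := val_op (S := S) ho
    exact ⟨F y w, (hF _ _ _).2 ⟨_, _, hy, hw, rfl⟩, (hF _ _ _).2 ⟨_, _, hy', hw', rfl⟩⟩

theorem numeral_iff {n t : S.N} : S.Numeral n t ↔ ∃ m s, S.pair n t = S.pair m s ∧
    ((m = S.zero ∧ s = S.cZero) ∨
     ∃ m' s', S.Numeral m' s' ∧ m = S.add m' S.one ∧ s = S.cAdd s' S.cOne) := by
  refine built_iff (hdef := by unfold Built; infer_instance) ?_
  rintro R R' y hR ⟨m, s, rfl, h⟩
  refine ⟨m, s, rfl, h.imp_right ?_⟩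
  rintro ⟨m', s', h', rfl, rfl⟩
  exact ⟨m', s', hR _ (pair_lt_pair (lt_succ_iff.2 le_rfl) (lt_tag_left (by decide) _ _).le) h', rfl, rfl⟩

/-- The numeral of `n` is a closed term with value `n`. -/
theorem closed_val_of_numeral {n t : S.N} (h : S.Numeral n t) : S.Closed t ∧ S.Val t n := by
  refine strong_ind (fun t => ∀ n, S.Numeral n t → S.Closed t ∧ S.Val t n) ?_ t n h
  intro t ih n h
  obtain ⟨m, s, he, h⟩ := numeral_iff.1 h
  obtain ⟨rfl, rfl⟩ := pair_inj.1 he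
  rcases h with ⟨rfl, rfl⟩ | ⟨m, s, h', rfl, rfl⟩
  · exact ⟨closed_atom isAtom_zero, val_iff.2 (.inl ⟨rfl, rfl⟩)⟩
  · obtain ⟨hc, hv⟩ := ih s (lt_tag_left (by decide) _ _) m h'
    exact ⟨(closed_op (.inl rfl)).2 ⟨hc, closed_atom (.inr (.inl rfl))⟩,
      val_iff.2 (.inr (.inr (.inr ⟨s, m, _, _, hv, val_iff.2 (.inr (.inl ⟨rfl, rfl⟩)), .inl ⟨rfl, rfl⟩⟩)))⟩

/-! ### Truth of sentences in a coded model -/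

theorem IsSat.imp (h : S.IsSat M Y) {f g : S.N} (hf : S.IsSent f) (hg : S.IsSent g) :
    S.cImp f g ∈ Y ↔ (f ∈ Y → g ∈ Y) := by
  rw [cImp, h.neg (isSent_and.2 ⟨hf, isSent_neg.2 hg⟩), h.and hf (isSent_neg.2 hg), h.neg hg]
  tauto

/-- There is at most one satisfaction definition. -/
theorem IsSat.unique {Y' : Set S.N} [IsSet Y] [IsSet Y'] (h : S.IsSat M Y) (h' : S.IsSat M Y') {f : S.N}
    (hf : S.IsSent f) : f ∈ Y ↔ f ∈ Y' := by
  refine inst_ind (fun f => S.IsSent f → (f ∈ Y ↔ f ∈ Y')) ?_ ?_ ?_ ?_ ?_ ?_ hf.1 hf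
  · intro r hr s t _ _ hf
    obtain ⟨hs, ht⟩ := isSent_rel hr hf
    obtain ⟨a, ha⟩ := hs.exists_val
    obtain ⟨b, hb⟩ := ht.exists_val
    exact h.rel h' hr ha hb ha hb
  · intro s X _ _ hf
    obtain ⟨hs, n, rfl⟩ := isSent_mem hf
    obtain ⟨a, ha⟩ := hs.exists_val
    rw [h.mem ha, h'.mem ha]
  · intro s _ hf
    obtain ⟨a, ha⟩ := (isSent_oracle hf).exists_val
    rw [h.oracle ha, h'.oracle ha]
  · intro a _ ih hf
    have hf := isSent_neg.1 hf
    rw [h.neg hf, h'.neg hf, ih hf]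
  · intro a b _ _ iha ihb hf
    have hf := isSent_and.1 hf
    rw [h.and hf.1 hf.2, h'.and hf.1 hf.2, iha hf.1, ihb hf.2]
  · intro k i a _ ih hf
    rw [h.q hf, h'.q hf]
    exact forall_congr' fun n => forall_congr' fun a' => forall_congr' fun ha =>
      ih n a' ha (hf.inst (isCst_cC k n) ha)

/-- Closed terms of equal value may be replaced by each other. -/
theorem IsSat.replace [IsSet Y] (h : S.IsSat M Y) {i s t x f f' f'' : S.N} (hf : S.IsFml True f)
    (hs : S.Closed s) (ht : S.Closed t) (hs' : S.Val s x) (ht' : S.Val t x) (h1 : S.SB true i s f f')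
    (h2 : S.SB true i t f f'') (h1' : S.IsSent f') (h2' : S.IsSent f'') : f' ∈ Y ↔ f'' ∈ Y := by
  refine inst_ind (fun f => ∀ f' f'', S.SB true i s f f' → S.SB true i t f f'' → S.IsSent f' →
    S.IsSent f'' → (f' ∈ Y ↔ f'' ∈ Y)) ?_ ?_ ?_ ?_ ?_ ?_ hf f' f'' h1 h2 h1' h2'
  · intro r hr u v hu hv f' f'' h1 h2 h1' h2'
    obtain ⟨u', v', hu', hv', rfl⟩ := (sb_rel hr).1 h1
    obtain ⟨u'', v'', hu'', hv'', rfl⟩ := (sb_rel hr).1 h2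
    obtain ⟨hcu, hcv⟩ := isSent_rel hr h1'
    obtain ⟨y, hy, hy'⟩ := exists_val_tmSub hu hs' ht' hu' hu'' hcu
    obtain ⟨w, hw, hw'⟩ := exists_val_tmSub hv hs' ht' hv' hv'' hcv
    exact h.rel h hr hy hw hy' hw'
  · intro u X hu _ f' f'' h1 h2 h1' h2'
    obtain ⟨u', X', hu', hX', rfl⟩ := sb_mem.1 h1
    obtain ⟨u'', X'', hu'', hX'', rfl⟩ := sb_mem.1 h2
    obtain rfl : X' = X := hX'
    obtain rfl : X'' = X' := hX''
    obtain ⟨hcu, n, rfl⟩ := isSent_mem h1'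
    obtain ⟨y, hy, hy'⟩ := exists_val_tmSub hu hs' ht' hu' hu'' hcu
    rw [h.mem hy, h.mem hy']
  · intro u hu f' f'' h1 h2 h1' h2'
    obtain ⟨u', hu', rfl⟩ := sb_oracle.1 h1
    obtain ⟨u'', hu'', rfl⟩ := sb_oracle.1 h2
    obtain ⟨y, hy, hy'⟩ := exists_val_tmSub hu hs' ht' hu' hu'' (isSent_oracle h1')
    rw [h.oracle hy, h.oracle hy']
  · intro a _ ih f' f'' h1 h2 h1' h2'
    obtain ⟨a', ha', rfl⟩ := sb_neg.1 h1
    obtain ⟨a'', ha'', rfl⟩ := sb_neg.1 h2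
    have h1' := isSent_neg.1 h1'
    have h2' := isSent_neg.1 h2'
    rw [h.neg h1', h.neg h2', ih _ _ ha' ha'' h1' h2']
  · intro a b _ _ iha ihb f' f'' h1 h2 h1' h2'
    obtain ⟨a', b', ha', hb', rfl⟩ := sb_and.1 h1
    obtain ⟨a'', b'', ha'', hb'', rfl⟩ := sb_and.1 h2
    have h1' := isSent_and.1 h1'
    have h2' := isSent_and.1 h2'
    rw [h.and h1'.1 h1'.2, h.and h2'.1 h2'.2, iha _ _ ha' ha'' h1'.1 h2'.1, ihb _ _ hb' hb'' h1'.2 h2'.2]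
  · intro k j a ha ih f' f'' h1 h2 h1' h2'
    rcases sb_q.1 h1 with ⟨e1, rfl⟩ | ⟨e1, a', ha', rfl, -⟩ <;>
    rcases sb_q.1 h2 with ⟨e2, rfl⟩ | ⟨e2, a'', ha'', rfl, -⟩
    · rfl
    · exact (e2 e1).elim
    · exact (e1 e2).elim
    · have hij : ¬ (true = k ∧ i = j) := fun h => e1 ⟨h.1.symm, h.2.symm⟩
      -- instances of the two formulas arise from an instance of `a`
      have key : ∀ {s a'}, S.Closed s → S.SB true i s a a' → ∀ {n b b'}, S.SB k j (S.cC k n) a b →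
          S.SB k j (S.cC k n) a' b' → S.IsFml True a' → S.SB true i s b b' := by
        intro s a' hs ha' n b b' hb hb' hf
        obtain ⟨d, hd, hd'⟩ := sb_comm hij (isCst_cC k n) ha hs.1 (hs.as _) ha' hb
        rwa [sb_func hf hb' hd]
      have hf1 := isFml_q.1 h1'.1
      have hf2 := isFml_q.1 h2'.1
      rw [h.q h1', h.q h2']
      have step : ∀ n b' b'', S.SB k j (S.cC k n) a' b' → S.SB k j (S.cC k n) a'' b'' → (b' ∈ Y ↔ b'' ∈ Y) := by
        intro n b' b'' hb' hb''
        obtain ⟨b, hb, -⟩ := sb_total (i := j) (isCst_cC k n) ha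
        exact ih n b hb b' b'' (key hs ha' hb hb' hf1) (key ht ha'' hb hb'' hf2)
          (h1'.inst (isCst_cC k n) hb') (h2'.inst (isCst_cC k n) hb'')
      constructor
      · intro H n b'' hb''
        obtain ⟨b', hb', -⟩ := sb_total (i := j) (isCst_cC k n) hf1
        exact (step n b' b'' hb' hb'').1 (H n b' hb')
      · intro H n b' hb'
        obtain ⟨b'', hb'', -⟩ := sb_total (i := j) (isCst_cC k n) hf2
        exact (step n b' b'' hb' hb'').2 (H n b'' hb'')

end Struct
end SOA

namespace SOA
namespace Struct

variable {S : Struct}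

/-! ### Valid formulas -/

/-- All instances of the formula `f` that are sentences belong to the satisfaction definition `Y`. -/
def Valid (S : Struct) (Y : Set S.N) (f : S.N) : Prop :=
  S.IsFml True f ∧ ∀ h, S.Reach f h → S.IsSent h → h ∈ Y

instance def_valid {K : Ctx} {t : K.TmFun} {X : K.SetFun} [K.DefT t] [K.DefS X] :
    K.Def fun i e E => (K.st i).Valid (X i e E) (t i e E) := by
  unfold Valid; infer_instance

variable [hS : S.IsModel] {M Y : Set S.N}

theorem isTm_mono {t : S.N} (h : S.IsTm False t) : S.IsTm True t := by
  refine strong_ind (fun t => S.IsTm False t → S.IsTm True t) (fun t ih h => ?_) t h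
  rw [isTm_iff] at h ⊢
  rcases h with h | h | h | h | ⟨a, b, ha, hb, h⟩
  · exact .inl h
  · exact .inr (.inl h)
  · exact .inr (.inr (.inl h))
  · exact h.1.elim
  · refine .inr (.inr (.inr (.inr ⟨a, b, ih a ?_ ha, ih b ?_ hb, h⟩)))
    · rcases h with rfl | rfl | rfl <;> exact lt_tag_left (by decide) _ _
    · rcases h with rfl | rfl | rfl <;> exact lt_tag_right (by decide) _ _

theorem isFml_mono {f : S.N} (h : S.IsFml False f) : S.IsFml True f := by
  refine fml_ind (fun f => S.IsFml True f) ?_ ?_ ?_ ?_ ?_ ?_ h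
  · exact fun r hr s t hs ht => (isFml_rel hr).2 ⟨isTm_mono hs, isTm_mono ht⟩
  · exact fun t X ht hX => isFml_mem.2 ⟨isTm_mono ht, hX.imp_right fun h => h.1.elim⟩
  · exact fun t ht => isFml_oracle.2 (isTm_mono ht)
  · exact fun a _ ha => isFml_neg.2 ha
  · exact fun a b _ _ ha hb => isFml_and.2 ⟨ha, hb⟩
  · exact fun k i a _ ha => isFml_q.2 ha

theorem Valid.of_mem {f : S.N} (hf : S.IsSent f) (h : f ∈ Y) : S.Valid Y f :=
  ⟨hf.1, fun h' hr _ => by rwa [hr.eq_of_isSent hf]⟩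

theorem Valid.mem {f : S.N} (h : S.Valid Y f) (hf : S.IsSent f) : f ∈ Y := h.2 f (reach_refl f) hf

/-- Modus ponens preserves validity. -/
theorem IsSat.valid_mp (hY : S.IsSat M Y) {a b : S.N} (hab : S.Valid Y (S.cImp a b)) (ha : S.Valid Y a) :
    S.Valid Y b := by
  refine ⟨(isFml_imp.1 hab.1).2, fun b' hb hb' => ?_⟩
  -- extend the instantiation of `b` to one of `a → b`, and then to one that is a sentence
  have key : ∃ a1, S.Reach (S.cImp a b) (S.cImp a1 b') := by
    refine reach_ind (fun b' => ∃ a1, S.Reach (S.cImp a b) (S.cImp a1 b')) hb ⟨a, reach_refl _⟩ ?_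
    rintro b1 b2 - ⟨a1, h1⟩ hs
    obtain ⟨k, i, n, hs⟩ := step_iff.1 hs
    obtain ⟨a2, ha2, -⟩ := sb_total (i := i) (isCst_cC k n) (isFml_imp.1 (h1.isFml hab.1)).1
    exact ⟨a2, h1.step (step_iff.2 ⟨k, i, n, sb_imp.2 ⟨a2, b2, ha2, hs, rfl⟩⟩)⟩
  obtain ⟨a1, h1⟩ := key
  obtain ⟨h, hr, hh⟩ := exists_reach_isSent (h1.isFml hab.1)
  obtain ⟨a2, b2, ha2, hb2, rfl⟩ := reach_imp hr
  obtain rfl := hb2.eq_of_isSent hb'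
  obtain ⟨a3, b3, ha3, -, he⟩ := reach_imp h1
  obtain ⟨rfl, -⟩ := cImp_inj.1 he
  obtain ⟨hs, -⟩ := isSent_imp.1 hh
  exact (hY.imp hs hb').1 (hab.2 _ (h1.trans hr) hh) (ha.2 _ (ha3.trans ha2) hs)

/-- Generalization preserves validity. -/
theorem IsSat.valid_gen (hY : S.IsSat M Y) {k : Bool} {i a : S.N} (ha : S.Valid Y a) :
    S.Valid Y (S.cQ k i a) := by
  refine ⟨isFml_q.2 ha.1, fun h hr hh => ?_⟩
  obtain ⟨a', ha', rfl⟩ := reach_q hr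
  refine (hY.q hh).2 fun n b hb => ?_
  exact ha.2 b (ha'.step (step_iff.2 ⟨k, i, n, hb⟩)) (hh.inst (isCst_cC k n) hb)

/-- A formula is valid if it has a property that is inherited by instances and implies truth. -/
theorem valid_of (P : S.N → Prop) [Ar P]
    (hstep : ∀ k i c f f', S.IsFml True f → P f → S.IsCst k c → S.SB k i c f f' → P f')
    (htrue : ∀ f, S.IsSent f → P f → f ∈ Y) {f : S.N} (hf : S.IsFml True f) (h : P f) : S.Valid Y f := by
  refine ⟨hf, fun h' hr hh => htrue h' hh ?_⟩
  refine reach_ind P hr h ?_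
  rintro a b hr ha hs
  obtain ⟨k, i, n, hs⟩ := step_iff.1 hs
  exact hstep k i _ a b (hr.isFml hf) ha (isCst_cC k n) hs

/-! #### Propositional axioms -/

theorem IsSat.valid_ax_k (hY : S.IsSat M Y) {a b : S.N} (hf : S.IsFml True (S.cImp a (S.cImp b a))) :
    S.Valid Y (S.cImp a (S.cImp b a)) := by
  refine valid_of (fun f => ∃ a b, f = S.cImp a (S.cImp b a)) ?_ ?_ hf ⟨a, b, rfl⟩
  · rintro k i c _ f' hf ⟨a, b, rfl⟩ hc hs
    simp only [isFml_imp] at hf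
    simp only [sb_imp] at hs
    obtain ⟨a', _, ha, ⟨b', a'', hb, ha', rfl⟩, rfl⟩ := hs
    obtain rfl := sb_func hf.1 ha ha'
    exact ⟨a', b', rfl⟩
  · rintro _ hf ⟨a, b, rfl⟩
    simp only [isSent_imp] at hf
    rw [hY.imp hf.1 (isSent_imp.2 hf.2), hY.imp hf.2.1 hf.2.2]
    tauto

theorem IsSat.valid_ax_s (hY : S.IsSat M Y) {a b c : S.N}
    (hf : S.IsFml True (S.cImp (S.cImp a (S.cImp b c)) (S.cImp (S.cImp a b) (S.cImp a c)))) :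
    S.Valid Y (S.cImp (S.cImp a (S.cImp b c)) (S.cImp (S.cImp a b) (S.cImp a c))) := by
  refine valid_of (fun f => ∃ a b c, f = S.cImp (S.cImp a (S.cImp b c)) (S.cImp (S.cImp a b) (S.cImp a c)))
    ?_ ?_ hf ⟨a, b, c, rfl⟩
  · rintro k i t _ f' hf ⟨a, b, c, rfl⟩ ht hs
    simp only [isFml_imp] at hf
    simp only [sb_imp] at hs
    obtain ⟨_, _, ⟨a1, _, ha1, ⟨b1, c1, hb1, hc1, rfl⟩, rfl⟩, ⟨_, _, ⟨a2, b2, ha2, hb2, rfl⟩,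
      ⟨a3, c3, ha3, hc3, rfl⟩, rfl⟩, rfl⟩ := hs
    obtain rfl := sb_func hf.1.1 ha1 ha2
    obtain rfl := sb_func hf.1.1 ha1 ha3
    obtain rfl := sb_func hf.1.2.1 hb1 hb2
    obtain rfl := sb_func hf.1.2.2 hc1 hc3
    exact ⟨_, _, _, rfl⟩
  · rintro _ hf ⟨a, b, c, rfl⟩
    simp only [isSent_imp] at hf
    obtain ⟨⟨ha, hb, hc⟩, -⟩ := hf
    have hab := isSent_imp.2 ⟨ha, hb⟩
    have hac := isSent_imp.2 ⟨ha, hc⟩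
    have hbc := isSent_imp.2 ⟨hb, hc⟩
    rw [hY.imp (isSent_imp.2 ⟨ha, hbc⟩) (isSent_imp.2 ⟨hab, hac⟩), hY.imp ha hbc, hY.imp hb hc,
      hY.imp hab hac, hY.imp ha hb, hY.imp ha hc]
    tauto

theorem IsSat.valid_ax_contra (hY : S.IsSat M Y) {a b : S.N}
    (hf : S.IsFml True (S.cImp (S.cImp (S.cNeg a) (S.cNeg b)) (S.cImp b a))) :
    S.Valid Y (S.cImp (S.cImp (S.cNeg a) (S.cNeg b)) (S.cImp b a)) := by
  refine valid_of (fun f => ∃ a b, f = S.cImp (S.cImp (S.cNeg a) (S.cNeg b)) (S.cImp b a))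
    ?_ ?_ hf ⟨a, b, rfl⟩
  · rintro k i t _ f' hf ⟨a, b, rfl⟩ ht hs
    simp only [isFml_imp] at hf
    simp only [sb_imp, sb_neg] at hs
    obtain ⟨_, _, ⟨_, _, ⟨a1, ha1, rfl⟩, ⟨b1, hb1, rfl⟩, rfl⟩, ⟨b2, a2, hb2, ha2, rfl⟩, rfl⟩ := hs
    obtain rfl := sb_func hf.2.2 ha1 ha2
    obtain rfl := sb_func hf.2.1 hb1 hb2
    exact ⟨_, _, rfl⟩
  · rintro _ hf ⟨a, b, rfl⟩
    simp only [isSent_imp] at hf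
    obtain ⟨-, hb, ha⟩ := hf
    have hna := isSent_neg.2 ha
    have hnb := isSent_neg.2 hb
    rw [hY.imp (isSent_imp.2 ⟨hna, hnb⟩) (isSent_imp.2 ⟨hb, ha⟩), hY.imp hna hnb, hY.imp hb ha,
      hY.neg ha, hY.neg hb]
    tauto

theorem IsSat.valid_ax_left (hY : S.IsSat M Y) {a b : S.N} (hf : S.IsFml True (S.cImp (S.cAnd a b) a)) :
    S.Valid Y (S.cImp (S.cAnd a b) a) := by
  refine valid_of (fun f => ∃ a b, f = S.cImp (S.cAnd a b) a) ?_ ?_ hf ⟨a, b, rfl⟩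
  · rintro k i t _ f' hf ⟨a, b, rfl⟩ ht hs
    simp only [sb_imp, sb_and] at hs
    obtain ⟨_, _, ⟨a1, b1, ha1, -, rfl⟩, ha2, rfl⟩ := hs
    obtain rfl := sb_func (isFml_imp.1 hf).2 ha1 ha2
    exact ⟨_, _, rfl⟩
  · rintro _ hf ⟨a, b, rfl⟩
    simp only [isSent_imp, isSent_and] at hf
    rw [hY.imp (isSent_and.2 hf.1) hf.2, hY.and hf.1.1 hf.1.2]
    tauto

theorem IsSat.valid_ax_right (hY : S.IsSat M Y) {a b : S.N} (hf : S.IsFml True (S.cImp (S.cAnd a b) b)) :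
    S.Valid Y (S.cImp (S.cAnd a b) b) := by
  refine valid_of (fun f => ∃ a b, f = S.cImp (S.cAnd a b) b) ?_ ?_ hf ⟨a, b, rfl⟩
  · rintro k i t _ f' hf ⟨a, b, rfl⟩ ht hs
    simp only [sb_imp, sb_and] at hs
    obtain ⟨_, _, ⟨a1, b1, -, hb1, rfl⟩, hb2, rfl⟩ := hs
    obtain rfl := sb_func (isFml_imp.1 hf).2 hb1 hb2
    exact ⟨_, _, rfl⟩
  · rintro _ hf ⟨a, b, rfl⟩
    simp only [isSent_imp, isSent_and] at hf
    rw [hY.imp (isSent_and.2 hf.1) hf.2, hY.and hf.1.1 hf.1.2]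
    tauto

theorem IsSat.valid_ax_and (hY : S.IsSat M Y) {a b : S.N}
    (hf : S.IsFml True (S.cImp a (S.cImp b (S.cAnd a b)))) : S.Valid Y (S.cImp a (S.cImp b (S.cAnd a b))) := by
  refine valid_of (fun f => ∃ a b, f = S.cImp a (S.cImp b (S.cAnd a b))) ?_ ?_ hf ⟨a, b, rfl⟩
  · rintro k i t _ f' hf ⟨a, b, rfl⟩ ht hs
    simp only [isFml_imp] at hf
    simp only [sb_imp, sb_and] at hs
    obtain ⟨a1, _, ha1, ⟨b1, _, hb1, ⟨a2, b2, ha2, hb2, rfl⟩, rfl⟩, rfl⟩ := hs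
    obtain rfl := sb_func hf.1 ha1 ha2
    obtain rfl := sb_func hf.2.1 hb1 hb2
    exact ⟨_, _, rfl⟩
  · rintro _ hf ⟨a, b, rfl⟩
    simp only [isSent_imp] at hf
    obtain ⟨ha, hb, hab⟩ := hf
    rw [hY.imp ha (isSent_imp.2 ⟨hb, hab⟩), hY.imp hb hab, hY.and ha hb]
    tauto

/-! #### Axioms for quantifiers -/

/-- If `a'` and `∀ v a` are sentences and `a'` is `a(t)`, then substituting a constant in `t` yields
a term `t'` for which `a'` is also `a(t')`. -/
theorem sb_close {k k2 : Bool} {i j c t t' a a' : S.N} (ht : S.IsArg k t) (hc : S.IsCst k2 c)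
    (hq : S.IsSent (S.cQ k i a)) (ha' : S.IsSent a') (h : S.SB k i t a a') (htt : S.AS k k2 j c t t') :
    S.SB k i t' a a' := by
  have ha := isFml_q.1 hq.1
  by_cases hij : k = k2 ∧ i = j
  · obtain ⟨rfl, rfl⟩ := hij
    exact sb_comp hc ha ht htt h (ha'.sb c)
  · have hnf := (nf_q.1 (hq.nf k2 j)).resolve_left hij
    obtain ⟨d, hd, hd'⟩ := sb_comm hij hc ha ht htt h (hnf.sb ha c)
    rwa [ha'.sb_eq hd] at hd'

/-- A true universal sentence implies its instance by the term `t`, provided that this instance is a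
sentence. The term may contain variables, if the quantified variable does not occur; these are first
replaced by constants. -/
theorem IsSat.inst_mem [IsSet Y] (hY : S.IsSat M Y) {k : Bool} {i t a a' : S.N} (ht : S.IsArg k t)
    (h : S.SB k i t a a') (hq : S.IsSent (S.cQ k i a)) (ha' : S.IsSent a') (hqY : S.cQ k i a ∈ Y) :
    a' ∈ Y := by
  have ha := isFml_q.1 hq.1
  cases k
  · have key : ∃ n, S.SB false i (S.cSConst n) a a' := by
      rcases ht with ⟨j, rfl⟩ | ⟨-, n, rfl⟩
      · exact ⟨S.zero, sb_close (.inl ⟨j, rfl⟩) (isCst_cC false S.zero) hq ha' h (.inl ⟨rfl, rfl⟩)⟩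
      · exact ⟨n, h⟩
    obtain ⟨n, hn⟩ := key
    exact (hY.q hq).1 hqY n a' hn
  · have key : ∃ t, S.Closed t ∧ S.SB true i t a a' := by
      obtain ⟨e, hr, he⟩ := exists_reach_isSent (f := S.cEq t t) ((isFml_rel (.inl rfl)).2 ⟨ht, ht⟩)
      have key : ∃ t', e = S.cEq t' t' ∧ S.IsTm True t' ∧ S.SB true i t' a a' := by
        refine reach_ind (fun e => ∃ t', e = S.cEq t' t' ∧ S.IsTm True t' ∧ S.SB true i t' a a') hr
          ⟨t, rfl, ht, h⟩ ?_
        rintro _ e' - ⟨t', rfl, ht', h'⟩ hs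
        obtain ⟨k, j, n, hs⟩ := step_iff.1 hs
        obtain ⟨t1, t2, h1, h2, rfl⟩ := (sb_rel (.inl rfl)).1 hs
        obtain ⟨t3, h3, h3'⟩ := as_total (k := true) (i := j) ht' (isCst_cC k n).isArg
        obtain rfl := as_func (k := true) ht' h1 h3
        obtain rfl := as_func (k := true) ht' h1 h2
        exact ⟨t1, rfl, h3', sb_close ht' (isCst_cC k n) hq ha' h' h1⟩
      obtain ⟨t', rfl, -, h'⟩ := key
      exact ⟨t', (isSent_rel (.inl rfl) he).1, h'⟩
    obtain ⟨t, ht, h⟩ := key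
    obtain ⟨v, hv⟩ := ht.exists_val
    obtain ⟨b, hb, -⟩ := sb_total (i := i) (isCst_cC true v) ha
    have hbY := (hY.q hq).1 hqY v b hb
    exact (hY.replace ha ht (closed_atom (isAtom_const v)) hv (val_const.2 rfl) h hb ha'
      (hY.isSent hbY)).2 hbY

theorem IsSat.valid_ax_inst [IsSet Y] (hY : S.IsSat M Y) {k : Bool} {i t a a' : S.N} (ht : S.IsArg k t)
    (h : S.SB k i t a a') (hf : S.IsFml True (S.cImp (S.cQ k i a) a')) :
    S.Valid Y (S.cImp (S.cQ k i a) a') := by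
  refine valid_of (fun f => ∃ i t a a', S.IsArg k t ∧ S.SB k i t a a' ∧ f = S.cImp (S.cQ k i a) a')
    ?_ ?_ hf ⟨i, t, a, a', ht, h, rfl⟩
  · rintro k2 j c _ f' hf ⟨i, t, a, a', ht, h, rfl⟩ hc hs
    obtain ⟨b, b', hb, hb', rfl⟩ := sb_imp.1 hs
    obtain ⟨hq, hf'⟩ := isFml_imp.1 hf
    have ha := isFml_q.1 hq
    obtain ⟨t', ht', ht''⟩ := as_total (i := j) ht hc.isArg
    rcases sb_q.1 hb with ⟨⟨rfl, rfl⟩, rfl⟩ | ⟨hij, b, hb1, rfl, -⟩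
    · exact ⟨i, t', a, b', ht'', sb_comp hc ha ht ht' h hb', rfl⟩
    · obtain ⟨d, hd, hd'⟩ := sb_comm hij hc ha ht ht' h hb1
      obtain rfl := sb_func hf' hd hb'
      exact ⟨i, t', b, d, ht'', hd', rfl⟩
  · rintro _ hf ⟨i, t, a, a', ht, h, rfl⟩
    obtain ⟨hq, ha'⟩ := isSent_imp.1 hf
    exact (hY.imp hq ha').2 (hY.inst_mem ht h hq ha')

theorem IsSat.valid_of_q [IsSet Y] (hY : S.IsSat M Y) {k : Bool} {i a : S.N} (h : S.Valid Y (S.cQ k i a)) :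
    S.Valid Y a := by
  have ha := isFml_q.1 h.1
  exact hY.valid_mp (hY.valid_ax_inst (isArg_cV k i) (sb_ident ha) (isFml_imp.2 ⟨h.1, ha⟩)) h

theorem IsSat.valid_ax_dist (hY : S.IsSat M Y) {k : Bool} {i a b : S.N} (hi : S.NF k i a)
    (hf : S.IsFml True (S.cImp (S.cQ k i (S.cImp a b)) (S.cImp a (S.cQ k i b)))) :
    S.Valid Y (S.cImp (S.cQ k i (S.cImp a b)) (S.cImp a (S.cQ k i b))) := by
  refine valid_of (fun f => ∃ i a b, S.NF k i a ∧ f = S.cImp (S.cQ k i (S.cImp a b)) (S.cImp a (S.cQ k i b)))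
    ?_ ?_ hf ⟨i, a, b, hi, rfl⟩
  · rintro k2 j c _ f' hf ⟨i, a, b, hi, rfl⟩ hc hs
    simp only [isFml_imp, isFml_q] at hf
    simp only [sb_imp] at hs
    obtain ⟨q1, _, hq1, ⟨a2, q2, ha2, hq2, rfl⟩, rfl⟩ := hs
    rcases sb_q.1 hq1 with ⟨e1, rfl⟩ | ⟨e1, _, h1, rfl, -⟩ <;>
    rcases sb_q.1 hq2 with ⟨e2, rfl⟩ | ⟨e2, b2, hb2, rfl, -⟩
    · obtain ⟨rfl, rfl⟩ := e1
      rw [hi.sb_eq hf.1.1 ha2]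
      exact ⟨i, a, b, hi, rfl⟩
    · exact (e2 e1).elim
    · exact (e1 e2).elim
    · obtain ⟨a1, b1, ha1, hb1, rfl⟩ := sb_imp.1 h1
      obtain rfl := sb_func hf.1.1 ha1 ha2
      obtain rfl := sb_func hf.1.2 hb1 hb2
      exact ⟨i, a1, b1, hi.of_step hf.1.1 hc ha1, rfl⟩
  · rintro _ hf ⟨i, a, b, -, rfl⟩
    simp only [isSent_imp] at hf
    obtain ⟨hq, ha, hb⟩ := hf
    rw [hY.imp hq (isSent_imp.2 ⟨ha, hb⟩), hY.imp ha hb]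
    intro h haY
    refine (hY.q hb).2 fun n b' hb' => ?_
    have h1 : S.SB k i (S.cC k n) (S.cImp a b) (S.cImp a b') := sb_imp.2 ⟨a, b', ha.sb _, hb', rfl⟩
    exact (hY.imp ha (hb.inst (isCst_cC k n) hb')).1 ((hY.q hq).1 h n _ h1) haY

/-! #### Axioms for equality -/

theorem IsSat.valid_ax_refl (hY : S.IsSat M Y) {t : S.N} (hf : S.IsFml True (S.cEq t t)) :
    S.Valid Y (S.cEq t t) := by
  refine valid_of (fun f => ∃ t, f = S.cEq t t) ?_ ?_ hf ⟨t, rfl⟩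
  · rintro k i c _ f' hf ⟨t, rfl⟩ hc hs
    obtain ⟨t1, t2, h1, h2, rfl⟩ := (sb_rel (.inl rfl)).1 hs
    obtain rfl := as_func (k := true) ((isFml_rel (.inl rfl)).1 hf).1 h1 h2
    exact ⟨t1, rfl⟩
  · rintro _ hf ⟨t, rfl⟩
    obtain ⟨v, hv⟩ := (isSent_rel (.inl rfl) hf).1.exists_val
    exact (hY.eq hv hv).2 rfl

theorem IsSat.valid_ax_eq [IsSet Y] (hY : S.IsSat M Y) {s t i a a' a'' : S.N} (ha : S.IsFml True a)
    (h1 : S.SB true i s a a') (h2 : S.SB true i t a a'')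
    (hf : S.IsFml True (S.cImp (S.cEq s t) (S.cImp a' a''))) :
    S.Valid Y (S.cImp (S.cEq s t) (S.cImp a' a'')) := by
  refine valid_of (fun f => ∃ s t i a a' a'', S.IsFml True a ∧ S.SB true i s a a' ∧ S.SB true i t a a'' ∧
    f = S.cImp (S.cEq s t) (S.cImp a' a'')) ?_ ?_ hf ⟨s, t, i, a, a', a'', ha, h1, h2, rfl⟩
  · rintro k j c _ f' hf ⟨s, t, i, a, a', a'', ha, h1, h2, rfl⟩ hc hs
    simp only [isFml_imp] at hf
    obtain ⟨hst, ha', ha''⟩ := hf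
    obtain ⟨hs', ht'⟩ := (isFml_rel (.inl rfl)).1 hst
    simp only [sb_imp] at hs
    obtain ⟨_, _, he, ⟨b', b'', hb', hb'', rfl⟩, rfl⟩ := hs
    obtain ⟨s1, t1, hs1, ht1, rfl⟩ := (sb_rel (.inl rfl)).1 he
    by_cases hij : true = k ∧ i = j
    · obtain ⟨rfl, rfl⟩ := hij
      exact ⟨s1, t1, i, a, b', b'', ha, sb_comp hc ha hs' hs1 h1 hb', sb_comp hc ha ht' ht1 h2 hb'', rfl⟩
    · obtain ⟨b, hb, hbf⟩ := sb_total (i := j) hc ha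
      obtain ⟨d, hd, hd'⟩ := sb_comm hij hc ha hs' hs1 h1 hb
      obtain ⟨e, he, he'⟩ := sb_comm hij hc ha ht' ht1 h2 hb
      obtain rfl := sb_func ha' hd hb'
      obtain rfl := sb_func ha'' he hb''
      exact ⟨s1, t1, i, b, d, e, hbf, hd', he', rfl⟩
  · rintro _ hf ⟨s, t, i, a, a', a'', ha, h1, h2, rfl⟩
    simp only [isSent_imp] at hf
    obtain ⟨hst, ha', ha''⟩ := hf
    obtain ⟨hs, ht⟩ := isSent_rel (.inl rfl) hst
    obtain ⟨x, hx⟩ := hs.exists_val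
    obtain ⟨y, hy⟩ := ht.exists_val
    rw [hY.imp hst (isSent_imp.2 ⟨ha', ha''⟩), hY.eq hx hy, hY.imp ha' ha'']
    rintro rfl
    exact (hY.replace ha hs ht hx hy h1 h2 ha' ha'').1

/-- Logical axioms are valid. -/
theorem IsSat.valid_logAx [IsSet Y] (hY : S.IsSat M Y) {f : S.N} (hf : S.IsFml True f) (h : S.LogAx f) :
    S.Valid Y f := by
  rcases h with ⟨a, b, rfl⟩ | ⟨a, b, c, rfl⟩ | ⟨a, b, rfl⟩ | ⟨a, b, rfl⟩ | ⟨a, b, rfl⟩ | ⟨a, b, rfl⟩ |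
    ⟨i, t, a, a', ht, h, rfl⟩ | ⟨i, a, b, hi, rfl⟩ | ⟨i, j, a, a', h, rfl⟩ | ⟨i, a, b, hi, rfl⟩ |
    ⟨t, rfl⟩ | ⟨s, t, i, a, a', a'', ha, h1, h2, rfl⟩
  · exact hY.valid_ax_k hf
  · exact hY.valid_ax_s hf
  · exact hY.valid_ax_contra hf
  · exact hY.valid_ax_left hf
  · exact hY.valid_ax_right hf
  · exact hY.valid_ax_and hf
  · exact hY.valid_ax_inst (k := true) (isTm_mono ht) h hf
  · exact hY.valid_ax_dist (k := true) hi hf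
  · exact hY.valid_ax_inst (k := false) (.inl ⟨j, rfl⟩) h hf
  · exact hY.valid_ax_dist (k := false) hi hf
  · exact hY.valid_ax_refl hf
  · exact hY.valid_ax_eq (isFml_mono ha) h1 h2 hf

/-! #### The `ω`-rule -/

theorem isSent_eq {s t : S.N} (hs : S.Closed s) (ht : S.Closed t) : S.IsSent (S.cEq s t) :=
  isSent_iff.2 ⟨(isFml_rel (.inl rfl)).2 ⟨hs.1, ht.1⟩, fun k _ => NF.of_sb
    ((isFml_rel (.inl rfl)).2 ⟨hs.1, ht.1⟩) (isCst_cC k S.zero)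
    ((sb_rel (.inl rfl)).2 ⟨s, t, hs.as (k := k) _, ht.as (k := k) _, rfl⟩)⟩

theorem isSent_oracle' {t : S.N} (ht : S.Closed t) : S.IsSent (S.cOracle t) :=
  isSent_iff.2 ⟨isFml_oracle.2 ht.1, fun k _ => NF.of_sb (isFml_oracle.2 ht.1) (isCst_cC k S.zero)
    (sb_oracle.2 ⟨t, ht.as (k := k) _, rfl⟩)⟩

/-- The `ω`-rule preserves validity. -/
theorem IsSat.valid_omega [IsSet Y] (hY : S.IsSat M Y) {i g : S.N} (hg : S.IsFml True g)
    (h : ∀ n, ∃ t g', S.Numeral n t ∧ S.Sub i t g g' ∧ S.Valid Y g') : S.Valid Y (S.cAll i g) := by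
  -- the premises for numerals give the premises for constants
  have hconst : ∀ n g', S.SB true i (S.cC true n) g g' → S.Valid Y g' := by
    intro n g'' h''
    obtain ⟨t, g', hn, h', hv⟩ := h n
    obtain ⟨ht, htn⟩ := closed_val_of_numeral hn
    have hc : S.Closed (S.cC true n) := closed_atom (isAtom_const n)
    have he := isSent_eq ht hc
    have he' := Valid.of_mem he ((hY.eq htn (val_const.2 rfl)).2 rfl)
    exact hY.valid_mp (hY.valid_mp (hY.valid_ax_eq hg h' h'' (isFml_imp.2 ⟨he.1, isFml_imp.2
      ⟨hv.1, sb_isFml (isCst_cC true n) hg h''⟩⟩)) he') hv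
  refine ⟨isFml_q (k := true).2 hg, fun e hr he => ?_⟩
  have key : ∃ g1, e = S.cQ true i g1 ∧ ∀ n g', S.SB true i (S.cC true n) g g' →
      ∀ f, S.SB true i (S.cC true n) g1 f → S.Reach g' f := by
    refine reach_ind (fun e => ∃ g1, e = S.cQ true i g1 ∧ ∀ n g', S.SB true i (S.cC true n) g g' →
      ∀ f, S.SB true i (S.cC true n) g1 f → S.Reach g' f) hr ⟨g, rfl, fun n g' h1 f h2 => ?_⟩ ?_
    · rw [sb_func hg h1 h2]
      exact reach_refl f
    · rintro _ e' hr' ⟨g1, rfl, ih⟩ hs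
      have hg1 := isFml_q.1 (hr'.isFml (isFml_q (k := true).2 hg))
      obtain ⟨k, j, n, hs⟩ := step_iff.1 hs
      rcases sb_q.1 hs with ⟨-, rfl⟩ | ⟨hij, g2, hg2, rfl, -⟩
      · exact ⟨g1, rfl, ih⟩
      · refine ⟨g2, rfl, fun m g' hg' f hf => ?_⟩
        obtain ⟨f1, hf1, -⟩ := sb_total (i := i) (isCst_cC true m) hg1
        obtain ⟨d, hd, hd'⟩ := sb_comm hij (isCst_cC k n) hg1 (isCst_cC true m).isArg
          ((isCst_cC true m).as_self j _) hf1 hg2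
        obtain rfl := sb_func (sb_isFml (isCst_cC k n) hg1 hg2) hd' hf
        exact (ih m g' hg' f1 hf1).step (step_iff.2 ⟨k, j, n, hd⟩)
  obtain ⟨g1, rfl, hg1⟩ := key
  refine (hY.q he).2 fun n f hf => ?_
  obtain ⟨g', hg', -⟩ := sb_total (i := i) (isCst_cC true n) hg
  exact (hconst n g' hg').2 f (hg1 n g' hg' f hf) (he.inst (isCst_cC true n) hf)

end Struct
end SOA

namespace SOA
namespace Struct

variable {S : Struct} {M Y X L : Set S.N} {T : RepTheory}

/-! ### Universal closures -/

/-- `g` arises from `f` by successive quantification of free variables. A universal closure of `f` is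
such a formula that is a sentence. -/
def QuantClosure (S : Struct) (f g : S.N) : Prop :=
  S.Built (fun R y => y = f ∨ ∃ i a, R a ∧
    ((¬ S.NotFree i a ∧ y = S.cAll i a) ∨ (¬ S.NotFreeS i a ∧ y = S.cAllS i a))) g

instance def_quantClosure {K : Ctx} {t u : K.TmFun} [K.DefT t] [K.DefT u] :
    K.Def fun i e E => (K.st i).QuantClosure (t i e E) (u i e E) := by
  unfold QuantClosure Built; infer_instance

variable [hS : S.IsModel]

/-- The fixed point equation of `QuantClosure`. -/
theorem quantClosure_iff {f g : S.N} :
    S.QuantClosure f g ↔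
    g = f ∨ ∃ i a, S.QuantClosure f a ∧
      ((¬ S.NotFree i a ∧ g = S.cAll i a) ∨ (¬ S.NotFreeS i a ∧ g = S.cAllS i a)) := by
  refine built_iff (hdef := (inferInstance : Ar (S.QuantClosure f))) ?_
  intro R R' y hR
  refine Or.imp_right ?_
  rintro ⟨i, a, ha, h⟩
  refine ⟨i, a, hR _ ?_ ha, h⟩
  rcases h with ⟨-, rfl⟩ | ⟨-, rfl⟩
  · exact lt_cQ true i a
  · exact lt_cQ false i a

/-- Formulas with a true universal closure are valid. -/
theorem IsSat.valid_of_closure [IsSet Y] (hY : S.IsSat M Y) {f g : S.N} (h : S.UnivClosure f g) (hg : g ∈ Y) :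
    S.Valid Y f := by
  refine strong_ind (fun g => S.QuantClosure f g → S.Valid Y g → S.Valid Y f) ?_ g h.2 (Valid.of_mem h.1 hg)
  intro g ih hg hv
  rcases quantClosure_iff.1 hg with rfl | ⟨i, a, ha, ⟨-, rfl⟩ | ⟨-, rfl⟩⟩
  · exact hv
  · exact ih a (lt_cQ true i a) ha (hY.valid_of_q (k := true) hv)
  · exact ih a (lt_cQ false i a) ha (hY.valid_of_q (k := false) hv)

/-- Every valid formula has a universal closure that is true. -/
theorem IsSat.exists_closure [IsSet Y] (hY : S.IsSat M Y) {f : S.N} (hf : S.Valid Y f) :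
    ∃ g, S.UnivClosure f g ∧ g ∈ Y := by
  have key : ∀ m, ∃ g, S.QuantClosure f g ∧ S.Valid Y g ∧
      ∀ i, (i < m ∨ f ≤ i) → S.NF true i g ∧ S.NF false i g := by
    refine ind (fun m => ∃ g, S.QuantClosure f g ∧ S.Valid Y g ∧
      ∀ i, (i < m ∨ f ≤ i) → S.NF true i g ∧ S.NF false i g) ?_ ?_
    · refine ⟨f, quantClosure_iff.2 (.inl rfl), hf, fun i hi => ?_⟩
      have hi := hi.resolve_left (Arith.not_lt_zero i)
      exact ⟨NF.of_sb hf.1 (isCst_cC true 0) (sb_fresh hf.1 hi _),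
        NF.of_sb hf.1 (isCst_cC false 0) (sb_fresh hf.1 hi _)⟩
    · rintro m ⟨g, hb, hv, ih⟩
      -- quantify over the variables with index `m`, if they are free
      have h1 : ∃ g', S.QuantClosure f g' ∧ S.Valid Y g' ∧
          S.NF true m g' ∧ ∀ k i, S.NF k i g → S.NF k i g' := by
        by_cases h : S.NF true m g
        · exact ⟨g, hb, hv, h, fun _ _ h => h⟩
        · exact ⟨S.cQ true m g, quantClosure_iff.2 (.inr ⟨m, g, hb, .inl ⟨h, rfl⟩⟩), hY.valid_gen hv,
            nf_q.2 (.inl ⟨rfl, rfl⟩), fun _ _ h => nf_q.2 (.inr h)⟩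
      obtain ⟨g1, hb1, hv1, hm1, h1⟩ := h1
      have h2 : ∃ g', S.QuantClosure f g' ∧ S.Valid Y g' ∧
          S.NF false m g' ∧ ∀ k i, S.NF k i g1 → S.NF k i g' := by
        by_cases h : S.NF false m g1
        · exact ⟨g1, hb1, hv1, h, fun _ _ h => h⟩
        · exact ⟨S.cQ false m g1, quantClosure_iff.2 (.inr ⟨m, g1, hb1, .inr ⟨h, rfl⟩⟩), hY.valid_gen hv1,
            nf_q.2 (.inl ⟨rfl, rfl⟩), fun _ _ h => nf_q.2 (.inr h)⟩
      obtain ⟨g2, hb2, hv2, hm2, h2⟩ := h2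
      refine ⟨g2, hb2, hv2, fun i hi => ?_⟩
      by_cases him : i = m
      · subst him
        exact ⟨h2 _ _ hm1, hm2⟩
      · have hi : i < m ∨ f ≤ i := hi.imp_left fun h => (lt_succ_iff.1 h).lt_of_ne him
        exact ⟨h2 _ _ (h1 _ _ (ih i hi).1), h2 _ _ (h1 _ _ (ih i hi).2)⟩
  obtain ⟨g, hb, hv, hg⟩ := key f
  have hs : S.IsSent g := ⟨hv.1, fun i => hg i (lt_or_ge i f)⟩
  exact ⟨g, ⟨hs, hb⟩, hv.mem hs⟩

/-- Satisfaction in a full model amounts to validity for any satisfaction definition. -/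
theorem IsSat.sats_iff [hYs : IsSet Y] (hY : S.IsSat M Y) {f : S.N} : S.Sats M f ↔ S.Valid Y f := by
  constructor
  · rintro ⟨Y', hY's, hY', g, hg, hgY'⟩
    have : IsSet Y' := ⟨hY's⟩
    exact hY.valid_of_closure hg ((hY.unique hY' hg.1).2 hgY')
  · intro h
    exact ⟨Y, hYs.mem, hY, hY.exists_closure h⟩

/-! ### Derivations with an oracle -/

/-- The axiom `∃ X ∀ x (x ∈ X ↔ O(x))` is true, because the oracle is interpreted by `M_0`. -/
theorem IsSat.valid_comp (hY : S.IsSat M Y) :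
    S.Valid Y (S.cNeg (S.cAllS S.zero (S.cNeg (S.cAll S.zero
      (S.cIff (S.cMem (S.cVar S.zero) (S.cSVar S.zero)) (S.cOracle (S.cVar S.zero))))))) := by
  have hmem : S.IsFml True (S.cMem (S.cVar S.zero) (S.cSVar S.zero)) :=
    isFml_mem.2 ⟨isTm_var _, .inl ⟨_, rfl⟩⟩
  have hor : S.IsFml True (S.cOracle (S.cVar S.zero)) := isFml_oracle.2 (isTm_var _)
  have hbody : S.IsFml True (S.cIff (S.cMem (S.cVar S.zero) (S.cSVar S.zero)) (S.cOracle (S.cVar S.zero))) :=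
    isFml_and.2 ⟨isFml_imp.2 ⟨hmem, hor⟩, isFml_imp.2 ⟨hor, hmem⟩⟩
  have hq : S.IsSent (S.cQ false S.zero (S.cNeg (S.cQ true S.zero
      (S.cIff (S.cMem (S.cVar S.zero) (S.cSVar S.zero)) (S.cOracle (S.cVar S.zero)))))) := by
    refine isSent_iff.2 ⟨isFml_q.2 (isFml_neg.2 (isFml_q.2 hbody)), fun k i => ?_⟩
    rw [nf_q, nf_neg, nf_q]
    by_cases hi : S.zero = i
    · subst hi
      cases k
      · exact .inl ⟨rfl, rfl⟩
      · exact .inr (.inl ⟨rfl, rfl⟩)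
    · have h1 : S.AS true k i (S.cC k S.zero) (S.cVar S.zero) (S.cVar S.zero) := by
        cases k
        · exact rfl
        · exact (tmSub_var_ne hi).2 rfl
      have h2 : S.AS false k i (S.cC k S.zero) (S.cSVar S.zero) (S.cSVar S.zero) := by
        cases k
        · exact .inr ⟨fun h => hi (cSVar_inj.1 h), rfl⟩
        · exact rfl
      have h3 : S.NF k i (S.cMem (S.cVar S.zero) (S.cSVar S.zero)) :=
        NF.of_sb hmem (isCst_cC k S.zero) (sb_mem.2 ⟨_, _, h1, h2, rfl⟩)
      have h4 : S.NF k i (S.cOracle (S.cVar S.zero)) :=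
        NF.of_sb hor (isCst_cC k S.zero) (sb_oracle.2 ⟨_, h1, rfl⟩)
      simp only [cIff, cImp, nf_and, nf_neg]
      exact .inr (.inr ⟨⟨h3, h4⟩, h4, h3⟩)
  refine Valid.of_mem (isSent_neg.2 hq) ((hY.neg hq).2 fun h => ?_)
  -- the witness is the set constant `C_0`
  have hC : S.SB false S.zero (S.cSConst S.zero) (S.cNeg (S.cQ true S.zero
      (S.cIff (S.cMem (S.cVar S.zero) (S.cSVar S.zero)) (S.cOracle (S.cVar S.zero)))))
      (S.cNeg (S.cQ true S.zero
      (S.cIff (S.cMem (S.cVar S.zero) (S.cSConst S.zero)) (S.cOracle (S.cVar S.zero))))) := by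
    have h1 : S.SB false S.zero (S.cSConst S.zero) (S.cMem (S.cVar S.zero) (S.cSVar S.zero))
        (S.cMem (S.cVar S.zero) (S.cSConst S.zero)) := sb_mem.2 ⟨_, _, rfl, .inl ⟨rfl, rfl⟩, rfl⟩
    have h2 : S.SB false S.zero (S.cSConst S.zero) (S.cOracle (S.cVar S.zero)) (S.cOracle (S.cVar S.zero)) :=
      sb_oracle.2 ⟨_, rfl, rfl⟩
    refine sb_neg.2 ⟨_, sb_q.2 (.inr ⟨by simp, _, ?_, rfl, by simp⟩), rfl⟩
    exact sb_and.2 ⟨_, _, sb_imp.2 ⟨_, _, h1, h2, rfl⟩, sb_imp.2 ⟨_, _, h2, h1, rfl⟩, rfl⟩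
  have hs := isSent_neg.1 (hq.inst (isCst_cC false S.zero) hC)
  refine (hY.neg hs).1 ((hY.q hq).1 h S.zero _ hC) ((hY.q hs).2 fun n a ha => ?_)
  have hsa := hs.inst (isCst_cC true n) ha
  have hn := val_const.2 (rfl : n = n)
  simp only [cIff, sb_and, sb_imp, sb_mem, sb_oracle, TS, XS, reduceIte, tmSub_var_self] at ha
  obtain ⟨_, _, ⟨_, _, ⟨_, _, rfl, rfl, rfl⟩, ⟨_, rfl, rfl⟩, rfl⟩, ⟨_, _, ⟨_, rfl, rfl⟩,
    ⟨_, _, rfl, rfl, rfl⟩, rfl⟩, rfl⟩ := ha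
  obtain ⟨h1, h2⟩ := isSent_and.1 hsa
  obtain ⟨h3, h4⟩ := isSent_imp.1 h1
  simp only [hY.and h1 h2, hY.imp h3 h4, hY.imp h4 h3, hY.mem (show S.Val (S.cC true n) n from hn),
    hY.oracle (show S.Val (S.cC true n) n from hn), imp_self, and_self]

theorem IsSat.valid_axTX (hY : S.IsSat M Y) (hX : ∀ i, S.pair S.zero i ∈ M ↔ i ∈ X)
    (hT : ∀ f, S.AxT T f → S.Valid Y f) {f : S.N} (h : S.AxTX T X f) : S.Valid Y f := by
  rcases h with h | ⟨n, t, ht, hn, rfl⟩ | ⟨n, t, ht, hn, rfl⟩ | rfl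
  · exact hT f h
  · obtain ⟨hc, hv⟩ := closed_val_of_numeral ht
    exact Valid.of_mem (isSent_oracle' hc) ((hY.oracle hv).2 ((hX n).2 hn))
  · obtain ⟨hc, hv⟩ := closed_val_of_numeral ht
    have hs := isSent_oracle' hc
    refine Valid.of_mem (isSent_neg.2 hs) ((hY.neg hs).2 ?_)
    rwa [hY.oracle hv, hX]
  · exact hY.valid_comp

/-- Formulas derivable in `T` with the oracle `M_0` are valid. -/
theorem IsSat.valid_of_proof [IsSet Y] (hY : S.IsSat M Y) (hX : ∀ i, S.pair S.zero i ∈ M ↔ i ∈ X)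
    (hT : ∀ f, S.AxT T f → S.Valid Y f) {d f : S.N} (h : S.ProofTX T X d f) : S.Valid Y f := by
  obtain ⟨hd, i, hi⟩ := h
  refine strong_ind (fun i => ∀ g, S.inFin (S.pair i g) d → S.Valid Y g) (fun i ih g hg => ?_) i f hi
  obtain ⟨hf, h | h | ⟨j, k, a, hj, hk, ha, hag⟩ | ⟨j, a, v, hj, ha, rfl | rfl⟩⟩ := hd i g hg
  · exact hY.valid_logAx (isFml_mono hf) h
  · exact hY.valid_axTX hX hT h
  · exact hY.valid_mp (ih k hk _ hag) (ih j hj _ ha)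
  · exact hY.valid_gen (k := true) (ih j hj _ ha)
  · exact hY.valid_gen (k := false) (ih j hj _ ha)

/-! ### Iterated oracle provability -/

/-- Arithmetic transfinite recursion yields an iterated oracle provability class. -/
theorem exists_ipc (T : RepTheory) (hX : X ∈ S.sets) (hL : L ∈ S.sets) (hwo : S.IsWO L) :
    ∃ P ∈ S.sets, S.IPC T X L P := by
  have : IsSet X := ⟨hX⟩
  obtain ⟨P, hP, h⟩ := recursion hL hwo fun f Z => ∃ d, S.ProofTX T X d f ∨
    ∃ i x g, (∀ n, ∃ t g', S.Numeral n t ∧ S.Sub i t g g' ∧ S.pair x g' ∈ Z) ∧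
      S.ProofTX T X d (S.cImp (S.cAll i g) f)
  refine ⟨P, hP, fun l hl f => (h l hl f).trans ⟨?_, ?_⟩⟩
  · rintro ⟨d, hd | ⟨i, x, g, hx, hd⟩⟩
    · exact ⟨_, d, S.zero, S.zero, rfl, .inl hd⟩
    · refine ⟨_, d, x, g, rfl, .inr ⟨i, ?_, fun n => ?_, hd⟩⟩
      · obtain ⟨t, g', -, -, -, a, b, he, ha⟩ := hx S.zero
        obtain ⟨rfl, rfl⟩ := pair_inj.1 he
        exact ha
      · obtain ⟨t, g', hn, hs, hP, -⟩ := hx n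
        exact ⟨t, g', hn, hs, hP⟩
  · rintro ⟨_, d, x, g, rfl, hd | ⟨i, hxl, hx, hd⟩⟩
    · exact ⟨d, .inl hd⟩
    · refine ⟨d, .inr ⟨i, x, g, fun n => ?_, hd⟩⟩
      obtain ⟨t, g', hn, hs, hP⟩ := hx n
      exact ⟨t, g', hn, hs, hP, x, g', rfl, hxl⟩

/-- The members of an iterated oracle provability class are valid. Validity is arithmetic in the
satisfaction definition, so that the indices of invalid members form a set, which has a least element
if it is not empty. -/
theorem IsSat.valid_of_ipc [IsSet Y] (hY : S.IsSat M Y) (hX : ∀ i, S.pair S.zero i ∈ M ↔ i ∈ X)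
    (hT : ∀ f, S.AxT T f → S.Valid Y f) (hLs : L ∈ S.sets) (hwo : S.IsWO L) {P : Set S.N} (hPs : P ∈ S.sets)
    (hP : S.IPC T X L P) {l f : S.N} (hl : S.inField L l) (h : S.pair l f ∈ P) : S.Valid Y f := by
  have : IsSet L := ⟨hLs⟩
  have : IsSet P := ⟨hPs⟩
  by_contra hf
  obtain ⟨m, ⟨hm, f, hmf, hf⟩, hmin⟩ := hwo.2 _
    (comprehension fun l => S.inField L l ∧ ∃ f, S.pair l f ∈ P ∧ ¬ S.Valid Y f)
    (fun x hx => hx.1) ⟨l, hl, f, h, hf⟩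
  obtain ⟨_, d, x, g, rfl, hd | ⟨i, hxm, hx, hd⟩⟩ := (hP m hm f).1 hmf
  · exact hf (hY.valid_of_proof hX hT hd)
  · -- the premises of the `ω`-rule have indices below `m`, hence they are valid
    refine hf ?_
    have himp := hY.valid_of_proof hX hT hd
    refine hY.valid_mp himp (hY.valid_omega (isFml_q (k := true).1 (isFml_imp.1 himp.1).1) fun n => ?_)
    obtain ⟨t, g', hn, hs, hg'⟩ := hx n
    refine ⟨t, g', hn, hs, by_contra fun hv => ?_⟩
    obtain ⟨-, hirr, htrans, -⟩ := hwo.1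
    rcases hmin x ⟨(hwo.1.1 x m hxm).1, g', hg', hv⟩ with rfl | h
    · exact hirr _ hxm
    · exact hirr _ (htrans _ _ _ h hxm)

/-- Every model of `ATR₀` satisfies the soundness of iterated oracle provability. -/
theorem omegaModelSoundness (T : RepTheory) : S.OmegaModelSoundness T := by
  intro X hX L hL M _ hwo hM hMX l hl f hf
  obtain ⟨⟨Y, hYs, hY⟩, hT⟩ := hM
  have : IsSet Y := ⟨hYs⟩
  obtain ⟨P, hPs, hP⟩ := exists_ipc T hX hL hwo
  exact hY.sats_iff.2 (hY.valid_of_ipc hMX (fun f h => hY.sats_iff.1 (hT f h)) hL hwo hPs hP hl (hf P hPs hP))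

end Struct
end SOA

/-- For every representable theory `T`, the sentence of second-order arithmetic that expresses
soundness of iterated oracle provability over `T` for full `ω`-models is provable in `ATR₀`. -/
theorem mainTheorem9 (T : SOA.RepTheory) :
    ∃ q : SOA.Fml, SOA.Expresses q (fun S => S.OmegaModelSoundness T) ∧
      SOA.Provable SOA.ATR0 q := by
  obtain ⟨q, hq⟩ := SOA.exists_expresses (P := fun S => S.OmegaModelSoundness T) (SOA.Ctx.def_soundness T)
  refine ⟨q, hq, SOA.provable_of_valid (fun p hp => hp.1) hq.1 fun S hS => (hq.2 S).2 ?_⟩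
  have := SOA.Struct.isModel_of_ATR0 hS
  exact SOA.Struct.omegaModelSoundness T
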